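/- \textbf{Setting.} Let $n,d\ge 1$, and let $L_f,L_m,\hat\sigma>0$, $\bar R$, $\underline R>0$ with $2\underline R^2\ge 1$, and $c>4$ be given. \emph{Network.} $\mathcal G$ is a connected undirected graph on $\{1,\dots,n\}$ with a symmetric doubly stochastic matrix $\mathbf W$ of non-negative weights, $\mathbf W_{ij}=0$ if $i\ne j$ are not adjacent, such that $\operatorname{null}(\mathbf I-\mathbf W)=\operatorname{span}\{\mathbf 1\}$ and $\mathbf I+\mathbf W\succ 0$. Put $\beta=\|\mathbf I-\mathbf W\|_2$ and $\delta=1-\|\mathbf W-\tfrac1n\mathbf 1\mathbf 1^{\mathsf T}\|_2$. \emph{Problem.} $\Omega\subseteq\mathbb R^d$ is closed and convex with $\{\|x\|\le\underline R\}\subseteq\Omega\subseteq\{\|x\|\le\bar R\}$. For each agent $i$, $\xi_i\sim\mathcal P_i$, the sample functions $F_i(\cdot,\xi_i)$ are (almost surely) convex and $L_f$-Lipschitz on $\Omega$, $f_i(x)=\mathbb E[F_i(x,\xi_i)]$ has $L_m$-Lipschitz gradient on $\Omega$, and $\mathbb E\|\nabla_xF_i(x,\xi_i)-\nabla f_i(x)\|^2\le\hat\sigma^2$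 for all $x\in\Omega$. Let $f=\frac1n\sum_i f_i$ and let $x^*$ be any minimizer of $f$ on $\Omega$. \emph{Compressor.} $\mathcal C:\mathbb R^d\to\mathbb R^d$ is a random operator such that, for some $r\ge1$ and $\omega\in(0,1]$, $\mathbb E\|\tfrac1r\mathcal C(x)-x\|^2\le(1-\omega)\|x\|^2$ for all $x\in\mathbb R^d$. \emph{Algorithm (Com-DSZO).} With $\Omega_\epsilon=\{(1-\epsilon)x:x\in\Omega\}$, start from arbitrary $x_{i,0}\in\Omega$ and $\hat x_{i,0}=b_{i,0}=0$, and for $k\ge0$ put $$q_{i,k}=\mathcal C(x_{i,k}-\hat x_{i,k}),\quad \hat x_{i,k+1}=\hat x_{i,k}+\psi q_{i,k},\quad b_{i,k+1}=b_{i,k}+\psi\Big(q_{i,k}-\sum_{j}\mathbf W_{ij}q_{j,k}\Big),$$ $$x_{i,k+1}=\Pi_{\Omega_\epsilon}\big[x_{i,k}-\gamma b_{i,k+1}-\eta_k g_{i,k}\big],\qquad g_{i,k}=\tfrac d\mu\big(F_i(x_{i,k}+\mu u_{i,k},\xi_{i,k})-F_i(x_{i,k},\xi_{i,k})\big)u_{i,k},$$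 where the samples $\xi_{i,k}\sim\mathcal P_i$, the directions $u_{i,k}$, uniform on the unit sphere, and the compressor randomness of the different calls are all independent. Put $\bar x_k=\frac1n\sum_i x_{i,k}$. \emph{Constants.} Let $\psi\in(0,r^{-1}]$, $c_0=\psi r\omega/2$, $M_1=(5+\frac{10}n)4dL_m$, $$\kappa_1=\tfrac\delta4+2(1+c_0^{-1})^2\gamma\beta^2,\qquad \kappa_2=(1+c_0^{-1})^2\gamma\beta^2+(1+\tfrac2\delta)\beta^2,$$ and let $\gamma$ satisfy $0<\gamma<1$, $\gamma\kappa_1<\delta$ and $\gamma\kappa_2<c_0$. Let $\kappa_0=\max(\mathbf C_1,\mathbf C_2)$ and $\kappa_3=nd^2L_f^2\widetilde{\mathbf C}_3$, where $$\mathbf C_1=\big(1+\tfrac{\gamma\delta}2\big)^2(1-\gamma\delta)^2+2(1+c_0^{-1})(1+c_0)\gamma^2\beta^2(1-\psi r\omega),$$ $$\mathbf C_2=\big(1+\tfrac2{\gamma\delta}\big)\gamma^2\beta^2+\big[1+c_0+(1+c_0^{-1})^2\gamma^2\beta^2\big](1-\psi r\omega),$$ $$\widetilde{\mathbf C}_3=4\big(1+\tfrac{\gamma\delta}2\big)\big(1+\tfrac2{\gamma\delta}\big)+2(1+c_0^{-1}).$$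 \textbf{Theorem.} Then $\kappa_0<1$, and there is a constant $C$ depending only on $d,n,L_f,L_m,\hat\sigma,\underline R,\bar R,c$ such that, for every integer $T\ge4\underline R^2$, Com-DSZO run with $\mu=1/\sqrt T$, $\epsilon=2\underline R/\sqrt T$ and $\eta_k=\frac1{M_1\sqrt{k+c}}$ satisfies $$\sum_{k=1}^T\mathbb E\big[f(\bar x_k)-f(x^*)\big]\le C\sqrt T+C\,\frac{\kappa_3}{1-\kappa_0}\big(\sqrt{T+c}+\ln(T+c)\big).$$ -/

import Mathlib

open MeasureTheory ProbabilityTheory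

open scoped Matrix

noncomputable section

namespace ComDSZO

/-- The Euclidean space `ℝ^d`. -/
abbrev Vec (d : ℕ) : Type := EuclideanSpace ℝ (Fin d)

/-- The unit sphere of `ℝ^d`, centred at the origin. -/
abbrev UnitSphere (d : ℕ) : Type := Metric.sphere (0 : Vec d) 1

/-- The uniform probability measure on the unit sphere of `ℝ^d` (for `d ≥ 1`): the normalized
surface measure. -/
def uniformSphere (d : ℕ) : Measure (UnitSphere d) :=
  ((volume : Measure (Vec d)).toSphere Set.univ)⁻¹ • (volume : Measure (Vec d)).toSphere

/-! ### The network -/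

/-- The spectral norm of a real square matrix. -/
def spectralNorm {n : ℕ} (A : Matrix (Fin n) (Fin n) ℝ) : ℝ :=
  ‖Matrix.toEuclideanCLM (n := Fin n) (𝕜 := ℝ) A‖

/-- The averaging matrix `H = (1/n) 1 1ᵀ`. -/
def avgMatrix (n : ℕ) : Matrix (Fin n) (Fin n) ℝ := Matrix.of fun _ _ => 1 / (n : ℝ)

/-- The spectral gap `δ`, given by `‖W - H‖₂ = 1 - δ`. -/
def spectralGap {n : ℕ} (W : Matrix (Fin n) (Fin n) ℝ) : ℝ := 1 - spectralNorm (W - avgMatrix n)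

/-- `β = ‖I - W‖₂`. -/
def disagreementNorm {n : ℕ} (W : Matrix (Fin n) (Fin n) ℝ) : ℝ := spectralNorm (1 - W)

/-- `G` is a connected undirected graph and `W` is a doubly stochastic weight matrix on it that is
symmetric, satisfies `null (I - W) = span {1}` and `I + W ≻ 0`. -/
structure IsNetwork {n : ℕ} (G : SimpleGraph (Fin n)) (W : Matrix (Fin n) (Fin n) ℝ) : Prop where
  connected : G.Connected
  nonneg : ∀ i j, 0 ≤ W i j
  support : ∀ i j, i ≠ j → ¬ G.Adj i j → W i j = 0
  symm : Wᵀ = W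
  row_sum : ∀ i, ∑ j, W i j = 1
  consensus : ∀ v : Fin n → ℝ, (1 - W) *ᵥ v = 0 ↔ ∃ a : ℝ, v = fun _ => a
  spectral : (1 + W).PosDef

/-! ### The constraint set -/

/-- `K` is closed and convex, contains the ball of radius `Rl > 0` about the origin and is contained
in the ball of radius `Ru`. -/
structure IsConstraintSet {d : ℕ} (K : Set (Vec d)) (Rl Ru : ℝ) : Prop where
  closed : IsClosed K
  convex : Convex ℝ K
  inner_pos : 0 < Rl
  inner_ball : Metric.closedBall 0 Rl ⊆ K
  outer_ball : K ⊆ Metric.closedBall 0 Ru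

/-- The shrunk set `{(1 - ε) x | x ∈ K}`. -/
def shrink {d : ℕ} (ε : ℝ) (K : Set (Vec d)) : Set (Vec d) := (fun x => (1 - ε) • x) '' K

/-- The projection `argmin_{x ∈ K} ‖x - z‖²`. -/
def proj {d : ℕ} (K : Set (Vec d)) (z : Vec d) : Vec d :=
  Classical.epsilon fun p => p ∈ K ∧ IsMinOn (fun x => ‖x - z‖ ^ 2) K p

/-! ### The objective -/

section Objective

variable {d n : ℕ} {Ξ : Fin n → Type*} [∀ i, MeasurableSpace (Ξ i)]

/-- The local loss `f_i(x) = 𝔼[F_i(x, ξ_i)]`, where `ξ_i` has law `P i`. -/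
def localLoss (P : ∀ i, Measure (Ξ i)) (F : ∀ i, Vec d → Ξ i → ℝ) (i : Fin n) (x : Vec d) : ℝ :=
  ∫ z, F i x z ∂(P i)

/-- The global loss `f(x) = (1/n) ∑ f_i(x)`. -/
def globalLoss (P : ∀ i, Measure (Ξ i)) (F : ∀ i, Vec d → Ξ i → ℝ) (x : Vec d) : ℝ :=
  (1 / (n : ℝ)) * ∑ i, localLoss P F i x

/-- The standing assumptions on the stochastic objective, all of them on the constraint set `K` only:
the samples `F_i(·, ξ)` are convex, `Lf`-Lipschitz and differentiable, the variance of their gradient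
is at most `σ²`, and the gradients of the `f_i` are `Lm`-Lipschitz. Gradients are taken relative to
`K`; when `K` is convex with nonempty interior they are unique, and on `K` they are the ordinary
gradients of any function that is differentiable around `K`. -/
structure IsSmoothObjective (K : Set (Vec d)) (P : ∀ i, Measure (Ξ i))
    (F : ∀ i, Vec d → Ξ i → ℝ) (Lf Lm σ : ℝ) : Prop where
  prob : ∀ i, IsProbabilityMeasure (P i)
  meas : ∀ i, Measurable (Function.uncurry (F i))
  integrable : ∀ i, ∀ x ∈ K, Integrable (F i x) (P i)
  convex : ∀ i, ∀ᵐ z ∂(P i), ConvexOn ℝ K fun x => F i x z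
  lipschitz : ∀ i, ∀ᵐ z ∂(P i), ∀ x ∈ K, ∀ y ∈ K, |F i x z - F i y z| ≤ Lf * ‖x - y‖
  sample_diff : ∀ i, ∀ x ∈ K, ∀ᵐ z ∂(P i), DifferentiableWithinAt ℝ (fun y => F i y z) K x
  variance : ∀ i, ∀ x ∈ K,
    ∫⁻ z, ‖gradientWithin (fun y => F i y z) K x - gradientWithin (localLoss P F i) K x‖ₑ ^ 2 ∂(P i)
      ≤ ENNReal.ofReal (σ ^ 2)
  diff : ∀ i, DifferentiableOn ℝ (localLoss P F i) K
  smooth : ∀ i, ∀ x ∈ K, ∀ y ∈ K,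
    ‖gradientWithin (localLoss P F i) K x - gradientWithin (localLoss P F i) K y‖ ≤ Lm * ‖x - y‖

end Objective

/-! ### Compressors -/

/-- `Q v s` is the output of the random compressor on the vector `v` when its internal randomness is
`s`, which has law `ν`. The rescaled compressor `Q / r` satisfies
`𝔼 ‖Q v / r - v‖² ≤ (1 - ω) ‖v‖²` for all `v`. -/
structure IsCompressor {d : ℕ} {S : Type*} [MeasurableSpace S] (ν : Measure S)
    (Q : Vec d → S → Vec d) (r ω : ℝ) : Prop where
  prob : IsProbabilityMeasure ν
  meas : Measurable (Function.uncurry Q)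
  one_le : 1 ≤ r
  level_pos : 0 < ω
  level_le : ω ≤ 1
  error : ∀ v : Vec d, ∫⁻ s, ‖(1 / r) • Q v s - v‖ₑ ^ 2 ∂ν ≤ ENNReal.ofReal ((1 - ω) * ‖v‖ ^ 2)

/-! ### The algorithm -/

/-- The two-point gradient estimator `(d/μ) (F(x + μ u, ξ) - F(x, ξ)) u`. -/
def gradEst {d : ℕ} {Z : Type*} (μ : ℝ) (F : Vec d → Z → ℝ) (x : Vec d) (u : UnitSphere d) (z : Z) :
    Vec d :=
  ((d : ℝ) / μ * (F (x + μ • (u : Vec d)) z - F x z)) • (u : Vec d)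

/-- The variables `x_i`, `x̂_i`, `b_i` of all agents. -/
structure State (d n : ℕ) where
  x : Fin n → Vec d
  xhat : Fin n → Vec d
  b : Fin n → Vec d

section Algorithm

variable {d n : ℕ} {Ξ : Fin n → Type*} {S : Type*}

/-- One iteration of the algorithm with step size `η`, smoothing `μ`, shrinkage `ε`, and parameters
`ψ`, `γ`, given the samples `ξ_i`, the directions `u_i` and the compressor randomness `s_i` of this
iteration. The vector `q_i = Q(x_i - x̂_i)` is what agent `i` transmits; as `W` vanishes outside the
edges and the diagonal, the sum over `j` involves agent `i` and its neighbours only. -/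
def step (K : Set (Vec d)) (W : Matrix (Fin n) (Fin n) ℝ) (F : ∀ i, Vec d → Ξ i → ℝ)
    (Q : Vec d → S → Vec d) (μ ε ψ γ η : ℝ) (st : State d n)
    (ξ : ∀ i, Ξ i) (u : Fin n → UnitSphere d) (s : Fin n → S) : State d n :=
  let q : Fin n → Vec d := fun i => Q (st.x i - st.xhat i) (s i)
  let b' : Fin n → Vec d := fun i => st.b i + ψ • (q i - ∑ j, W i j • q j)
  { xhat := fun i => st.xhat i + ψ • q i
    b := b'
    x := fun i => proj (shrink ε K)
      (st.x i - γ • b' i - η • gradEst μ (F i) (st.x i) (u i) (ξ i)) }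

/-- The state after `k` iterations, from `x_{i,0} = x₀ i` and `x̂_{i,0} = b_{i,0} = 0`, with step
sizes `η k`. -/
def run (K : Set (Vec d)) (W : Matrix (Fin n) (Fin n) ℝ) (F : ∀ i, Vec d → Ξ i → ℝ)
    (Q : Vec d → S → Vec d) (μ ε ψ γ : ℝ) (η : ℕ → ℝ) (x₀ : Fin n → Vec d)
    (ξ : ∀ i, ℕ → Ξ i) (u : Fin n → ℕ → UnitSphere d) (s : Fin n → ℕ → S) : ℕ → State d n
  | 0 => { x := x₀, xhat := fun _ => 0, b := fun _ => 0 }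
  | k + 1 => step K W F Q μ ε ψ γ (η k) (run K W F Q μ ε ψ γ η x₀ ξ u s k)
      (fun i => ξ i k) (fun i => u i k) (fun i => s i k)

/-- The network average of the `x_i`. -/
def State.mean (st : State d n) : Vec d := (1 / (n : ℝ)) • ∑ i, st.x i

/-- The network average `x̄_k` of the iterates over the time horizon `T`, with the parameters
`μ = 1/√T`, `ε = 2 Rl/√T` and `η_k = 1/(M √(k + c))`, as a function of the random draws. -/
def meanIterate (K : Set (Vec d)) (W : Matrix (Fin n) (Fin n) ℝ) (F : ∀ i, Vec d → Ξ i → ℝ)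
    (Q : Vec d → S → Vec d) (Rl M c ψ γ : ℝ) (T : ℕ) (x₀ : Fin n → Vec d)
    (ξ : ∀ i, ℕ → Ξ i) (u : Fin n → ℕ → UnitSphere d) (s : Fin n → ℕ → S) (k : ℕ) : Vec d :=
  (run K W F Q (1 / √T) (2 * Rl / √T) ψ γ (fun k => 1 / (M * √(k + c))) x₀ ξ u s k).mean

/-- All the random draws of the algorithm are independent: over all agents `i` and iterations `k`,
the samples `ξ_{i,k}` have law `P i`, the directions `u_{i,k}` are uniform on the unit sphere and the
compressor randomness `s_{i,k}` has law `ν`. -/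
structure IsSampling [∀ i, MeasurableSpace (Ξ i)] [MeasurableSpace S]
    {A : Type*} [MeasurableSpace A] (Pr : Measure A)
    (P : ∀ i, Measure (Ξ i)) (ν : Measure S)
    (ξ : ∀ i, ℕ → A → Ξ i) (u : Fin n → ℕ → A → UnitSphere d) (s : Fin n → ℕ → A → S) : Prop where
  prob : IsProbabilityMeasure Pr
  meas_sample : ∀ i k, Measurable (ξ i k)
  meas_dir : ∀ i k, Measurable (u i k)
  meas_comp : ∀ i k, Measurable (s i k)
  law : ∀ i k, Pr.map (fun a => (ξ i k a, u i k a, s i k a)) = (P i).prod ((uniformSphere d).prod ν)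
  indep : iIndepFun (β := fun p : Fin n × ℕ => Ξ p.1 × UnitSphere d × S)
    (fun p a => (ξ p.1 p.2 a, u p.1 p.2 a, s p.1 p.2 a)) Pr

end Algorithm

/-! ### The constants -/

/-- `M₁ = (5 + 10/n) 4 d Lm`. -/
def M₁ (d n : ℕ) (Lm : ℝ) : ℝ := (5 + 10 / (n : ℝ)) * 4 * d * Lm

/-- `c₀ = ψ r ω / 2`. -/
def c₀ (ψ r ω : ℝ) : ℝ := ψ * r * ω / 2

/-- `C₁ = A₁ + B₁`, where `A₁ = (1 + α₁) (1 + α₂) (1 - γδ)²` and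
`B₁ = (1 + α₃⁻¹) (1 + α₄⁻¹) 2γ²β² (1 - ψrω)`, with `α₁ = α₂ = γδ/2` and `α₃ = α₄⁻¹ = c = ψrω/2`. -/
def C₁ (γ δ β c : ℝ) : ℝ :=
  (1 + γ * δ / 2) * (1 + γ * δ / 2) * (1 - γ * δ) ^ 2
    + (1 + c⁻¹) * (1 + c) * (2 * γ ^ 2 * β ^ 2) * (1 - 2 * c)

/-- `C₂ = A₂ + B₂`, where `A₂ = (1 + α₁⁻¹) γ²β²` and
`B₂ = ((1 + α₃) + (1 + α₃⁻¹) (1 + α₄) γ²β²) (1 - ψrω)`, with the same `α₁, …, α₄`. -/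
def C₂ (γ δ β c : ℝ) : ℝ :=
  (1 + (γ * δ / 2)⁻¹) * (γ ^ 2 * β ^ 2)
    + ((1 + c) + (1 + c⁻¹) * (1 + c⁻¹) * (γ ^ 2 * β ^ 2)) * (1 - 2 * c)

/-- `C̃₃ = 4 (1 + γδ/2) (1 + 2/(γδ)) + 2 (1 + c₀⁻¹)`. -/
def C₃ (γ δ c : ℝ) : ℝ := 4 * (1 + γ * δ / 2) * (1 + 2 / (γ * δ)) + 2 * (1 + c⁻¹)

/-- The contraction factor `κ₀ = max (C₁, C₂)`. -/
def κ₀ (γ δ β c : ℝ) : ℝ := max (C₁ γ δ β c) (C₂ γ δ β c)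

/-- `κ₁ = δ/4 + 2 (1 + c₀⁻¹)² γβ²`. -/
def κ₁ (γ δ β c : ℝ) : ℝ := δ / 4 + 2 * (1 + c⁻¹) ^ 2 * γ * β ^ 2

/-- `κ₂ = (1 + c₀⁻¹)² γβ² + (1 + 2/δ) β²`. -/
def κ₂ (γ δ β c : ℝ) : ℝ := (1 + c⁻¹) ^ 2 * γ * β ^ 2 + (1 + 2 / δ) * β ^ 2

/-- `κ₃ = n d² Lf² C̃₃`. -/
def κ₃ (d n : ℕ) (Lf γ δ c : ℝ) : ℝ := n * (d : ℝ) ^ 2 * Lf ^ 2 * C₃ γ δ c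

/-- The smallness condition `0 < γ < min {1, δ/κ₁, c₀/κ₂}` on the consensus step size, with the
denominators cleared (`κ₂ = 0` for a single agent). -/
structure IsConsensusStep (γ δ β c : ℝ) : Prop where
  pos : 0 < γ
  lt_one : γ < 1
  gap : γ * κ₁ γ δ β c < δ
  compression : γ * κ₂ γ δ β c < c

end ComDSZO

end

open ComDSZO

namespace ComDSZO

/-! ### Second moments of the uniform distribution on the sphere -/

section Sphere

open scoped Pointwise

/-! Since `b` always equals `(I - W) x̂` (`run_b`), the method is projected stochastic descent with
a consensus term computed from the compressed copies: `x_{k+1} = Π[x_k - γ (I - W) x̂_{k+1} - η_k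
g_k]`. Two errors separate it from descent at a single point: the deviations of the `x_i` from their
mean, and `x_k - x̂_{k+1}`, the compression error left after the transmission of iteration `k`. The
sum `V_k` of their squares is the Lyapunov function `lyapunov`.

Mixing contracts the deviations by `1 - γδ`, where `δ > 0` (`spectralGap_pos`). Compression with
fresh randomness contracts its mean square error by `1 - ψrω = 1 - 2c₀`. Each error feeds the other
through terms carrying `γ²β²`, and the estimators have norm at most `d Lf`. Young's inequality turns
this into `𝔼 V_{k+1} ≤ κ₀ 𝔼 V_k + (κ₃ / M₁²) / (k + c)` (`lyapunov_step`,
`IsTrajectory.integral_lyapunov_succ_le`), and the bound on `γ κ₂` makes `κ₀ < 1`.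

For the regret, expand the squared distances to `y = (1 - ε) x*` (`descent_step`). In expectation
`⟨g_i, x_i - y⟩` dominates `f_i(x_i) - f_i(y)` up to `O(μ)`: the uniform law on the sphere has
second moment matrix `I/d`, gradients are Lipschitz, and `f_i` is convex. Dividing by `2 η_k` and
summing by parts with weights `√(k + c)` leaves the weighted sum of the `𝔼 V_k`
(`IsTrajectory.mul_sum_integral_gap_le`).

If `1/(1 - κ₀) ≤ √(T + c)`, that sum is at most a multiple of `√(T + c)/(1 - κ₀)`
(`sum_sqrt_mul_le_of_contraction`). Otherwise the trivial regret bound `T · 2 Lf Ru` is already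
small enough (`le_of_regret_bounds`). This dichotomy keeps `C` independent of the graph, the
compressor and `γ`. Because `κ₃ ≥ 6 Lf²`, every contribution is absorbed into `κ₃/(1 - κ₀) · √(T +
c)`; the `√T` and logarithmic terms of the conclusion are slack.

Estimates start at `k = 1`: `x_0` lies only in `K`, so its query points may leave `K` and `g_0` is
uncontrolled. Projection makes `x_1` feasible whatever `g_0` is, and `V_1` is bounded through the
diameter of `K`. -/

theorem isProbabilityMeasure_uniformSphere {d : ℕ} (hd : 1 ≤ d) :
    IsProbabilityMeasure (uniformSphere d) := by
  have : Nonempty (Fin d) := ⟨⟨0, hd⟩⟩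
  have : Nontrivial (Vec d) := inferInstance
  constructor
  rw [uniformSphere, Measure.smul_apply, smul_eq_mul]
  exact ENNReal.inv_mul_cancel
    (by rw [Ne, Measure.measure_univ_eq_zero]; exact Measure.toSphere_ne_zero _) (measure_ne_top _ _)

/-- A linear isometry acting on the unit sphere. -/
noncomputable def sphereMap {d : ℕ} (e : Vec d ≃ₗᵢ[ℝ] Vec d) (u : UnitSphere d) : UnitSphere d :=
  ⟨e u, by simp⟩

theorem continuous_sphereMap {d : ℕ} (e : Vec d ≃ₗᵢ[ℝ] Vec d) : Continuous (sphereMap e) :=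
  Continuous.subtype_mk (e.continuous.comp continuous_subtype_val) _

/-- The surface measure of a set is a multiple of the volume of the cone over it; a linear isometry
carries cones to cones and preserves volume. -/
theorem map_sphereMap_uniformSphere {d : ℕ} (e : Vec d ≃ₗᵢ[ℝ] Vec d) :
    (uniformSphere d).map (sphereMap e) = uniformSphere d := by
  have hm : Measurable (sphereMap e) := (continuous_sphereMap e).measurable
  rw [uniformSphere, Measure.map_smul]
  congr 1
  ext s hs
  rw [Measure.map_apply hm hs, Measure.toSphere_apply' _ (hm hs), Measure.toSphere_apply' _ hs]
  congr 1
  have h : Set.Ioo (0 : ℝ) 1 • (Subtype.val '' (sphereMap e ⁻¹' s) : Set (Vec d))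
      = e ⁻¹' (Set.Ioo (0 : ℝ) 1 • (Subtype.val '' s)) := by
    ext x
    simp only [Set.mem_smul, Set.mem_image, Set.mem_preimage]
    constructor
    · rintro ⟨t, ht, _, ⟨u, hu, rfl⟩, rfl⟩
      exact ⟨t, ht, e u, ⟨sphereMap e u, hu, rfl⟩, by simp⟩
    · rintro ⟨t, ht, _, ⟨u, hu, rfl⟩, h⟩
      refine ⟨t, ht, e.symm u, ⟨sphereMap e.symm u, ?_, rfl⟩, ?_⟩
      · have : sphereMap e (sphereMap e.symm u) = u := by
          ext1; simp [sphereMap]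
        simpa [this] using hu
      · apply e.injective
        simp [h]
  rw [h]
  exact (e.measurePreserving).measure_preimage_emb
    e.toHomeomorph.measurableEmbedding _

theorem integrable_inner_mul_inner_uniformSphere {d : ℕ} (hd : 1 ≤ d) (a b : Vec d) :
    Integrable (fun u : UnitSphere d => inner ℝ a (u : Vec d) * inner ℝ b (u : Vec d))
      (uniformSphere d) := by
  have := isProbabilityMeasure_uniformSphere hd
  refine Integrable.of_bound (C := ‖a‖ * ‖b‖) ?_ (ae_of_all _ fun u => ?_)
  · exact Continuous.aestronglyMeasurable (by fun_prop)
  · rw [norm_mul]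
    have h (c : Vec d) : ‖inner ℝ c (u : Vec d)‖ ≤ ‖c‖ := by
      simpa using norm_inner_le_norm (𝕜 := ℝ) c (u : Vec d)
    exact mul_le_mul (h a) (h b) (norm_nonneg _) (norm_nonneg _)

/-- The reflection in the hyperplane orthogonal to `b` fixes `a`, negates `b` and preserves the
measure, so the integral equals its own negative. -/
theorem integral_inner_mul_inner_uniformSphere_of_orthogonal {d : ℕ} {a b : Vec d}
    (hab : inner ℝ a b = 0) :
    ∫ u : UnitSphere d, inner ℝ a (u : Vec d) * inner ℝ b (u : Vec d) ∂uniformSphere d = 0 := by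
  set e : Vec d ≃ₗᵢ[ℝ] Vec d := (ℝ ∙ b)ᗮ.reflection with he
  have hea : e a = a := by
    rw [he, Submodule.reflection_eq_self_iff, Submodule.mem_orthogonal_singleton_iff_inner_left]
    exact hab
  have heb : e b = -b := Submodule.reflection_orthogonalComplement_singleton_eq_neg b
  have h := map_sphereMap_uniformSphere e
  have key : ∫ u : UnitSphere d, inner ℝ a (u : Vec d) * inner ℝ b (u : Vec d) ∂uniformSphere d
      = ∫ u : UnitSphere d, -(inner ℝ a (u : Vec d) * inner ℝ b (u : Vec d)) ∂uniformSphere d := by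
    conv_lhs => rw [← h]
    rw [integral_map (continuous_sphereMap e).aemeasurable
      (Continuous.aestronglyMeasurable (by fun_prop))]
    congr 1
    ext u
    have h1 : inner ℝ a (e (u : Vec d)) = inner ℝ a (u : Vec d) := by
      conv_lhs => rw [← hea]
      exact e.inner_map_map _ _
    have h2 : inner ℝ b (e (u : Vec d)) = - inner ℝ b (u : Vec d) := by
      have : b = - e b := by rw [heb, neg_neg]
      conv_lhs => rw [this]
      rw [inner_neg_left, e.inner_map_map]
    change inner ℝ a (e (u : Vec d)) * inner ℝ b (e (u : Vec d)) = _
    rw [h1, h2]; ring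
  rw [integral_neg] at key
  linarith

/-- If `‖a‖ = ‖b‖` then `a + b ⊥ a - b`, so the orthogonal case shows that the integral depends only
on `‖a‖`. Comparing with `‖a‖ e_i` for every coordinate `i` and adding up, `∑ u_i² = 1` gives the
value. -/
theorem integral_inner_sq_uniformSphere {d : ℕ} (hd : 1 ≤ d) (a : Vec d) :
    (d : ℝ) * ∫ u : UnitSphere d, inner ℝ a (u : Vec d) * inner ℝ a (u : Vec d) ∂uniformSphere d
      = ‖a‖ ^ 2 := by
  have := isProbabilityMeasure_uniformSphere hd
  have hint := integrable_inner_mul_inner_uniformSphere hd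
  have heq (b : Vec d) (hb : ‖a‖ = ‖b‖) :
      ∫ u : UnitSphere d, inner ℝ a (u : Vec d) * inner ℝ a (u : Vec d) ∂uniformSphere d
      = ∫ u : UnitSphere d, inner ℝ b (u : Vec d) * inner ℝ b (u : Vec d) ∂uniformSphere d := by
    have h0 : inner ℝ (a + b) (a - b) = 0 := by
      rw [inner_add_left, inner_sub_right, inner_sub_right, real_inner_comm a b,
        real_inner_self_eq_norm_sq, real_inner_self_eq_norm_sq, hb]
      ring
    have h1 := integral_inner_mul_inner_uniformSphere_of_orthogonal h0
    rw [← sub_eq_zero, ← integral_sub (hint a a) (hint b b), ← h1]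
    congr 1
    ext u
    rw [inner_add_left, inner_sub_left]
    ring
  have hbasis (i : Fin d) :
      ∫ u : UnitSphere d, inner ℝ a (u : Vec d) * inner ℝ a (u : Vec d) ∂uniformSphere d
      = ∫ u : UnitSphere d, ‖a‖ ^ 2 * ((u : Vec d) i) ^ 2 ∂uniformSphere d := by
    rw [heq (EuclideanSpace.single i ‖a‖) (by simp)]
    congr 1
    ext u
    simp [EuclideanSpace.inner_single_left]
    ring
  have hint2 (i : Fin d) : Integrable (fun u : UnitSphere d => ‖a‖ ^ 2 * ((u : Vec d) i) ^ 2)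
      (uniformSphere d) := by
    have := hint (EuclideanSpace.single i 1) (EuclideanSpace.single i 1)
    refine (this.const_mul (‖a‖ ^ 2)).congr (ae_of_all _ fun u => ?_)
    simp [EuclideanSpace.inner_single_left]
    ring_nf
    simp
  have hsum : ∑ i : Fin d, ∫ u : UnitSphere d, ‖a‖ ^ 2 * ((u : Vec d) i) ^ 2 ∂uniformSphere d
      = ‖a‖ ^ 2 := by
    rw [← integral_finsetSum _ fun i _ => hint2 i]
    have : ∀ u : UnitSphere d, ∑ i : Fin d, ‖a‖ ^ 2 * ((u : Vec d) i) ^ 2 = ‖a‖ ^ 2 := by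
      intro u
      have hu : ‖(u : Vec d)‖ ^ 2 = 1 := by simp
      rw [EuclideanSpace.real_norm_sq_eq] at hu
      rw [← Finset.mul_sum, hu, mul_one]
    simp [this]
  rw [← hsum, ← Finset.sum_congr rfl fun i _ => hbasis i]
  simp

/-- The second moment matrix of the uniform distribution on the sphere is `1/d` times the
identity. -/
theorem integral_inner_mul_inner_uniformSphere {d : ℕ} (hd : 1 ≤ d) (a b : Vec d) :
    (d : ℝ) * ∫ u : UnitSphere d, inner ℝ a (u : Vec d) * inner ℝ b (u : Vec d) ∂uniformSphere d
      = inner ℝ a b := by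
  have hint := integrable_inner_mul_inner_uniformSphere hd
  have h1 := integral_inner_sq_uniformSphere hd (a + b)
  have h2 := integral_inner_sq_uniformSphere hd (a - b)
  have h3 : ∫ u : UnitSphere d, inner ℝ a (u : Vec d) * inner ℝ b (u : Vec d) ∂uniformSphere d
      = (1 / 4) * ((∫ u : UnitSphere d,
          inner ℝ (a + b) (u : Vec d) * inner ℝ (a + b) (u : Vec d) ∂uniformSphere d)
        - ∫ u : UnitSphere d,
          inner ℝ (a - b) (u : Vec d) * inner ℝ (a - b) (u : Vec d) ∂uniformSphere d) := by
    rw [← integral_sub (hint _ _) (hint _ _), ← integral_const_mul]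
    congr 1
    ext u
    rw [inner_add_left, inner_sub_left]
    ring
  rw [norm_add_sq_real] at h1
  rw [norm_sub_sq_real] at h2
  rw [h3]
  linear_combination (1 / 4) * h1 - (1 / 4) * h2

end Sphere

/-! ### Linear algebra of the network -/

section Network

variable {n d : ℕ}

/-- The action of an `n × n` matrix on a stack of `n` vectors. -/
noncomputable def act (A : Matrix (Fin n) (Fin n) ℝ) (X : Fin n → Vec d) (i : Fin n) : Vec d :=
  ∑ j, A i j • X j

theorem act_add (A : Matrix (Fin n) (Fin n) ℝ) (X Y : Fin n → Vec d) :
    act A (X + Y) = act A X + act A Y := by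
  ext1 i
  simp [act, Finset.sum_add_distrib]

theorem act_sub (A : Matrix (Fin n) (Fin n) ℝ) (X Y : Fin n → Vec d) :
    act A (X - Y) = act A X - act A Y := by
  ext1 i
  simp [act, smul_sub, Finset.sum_sub_distrib]

theorem act_smul (A : Matrix (Fin n) (Fin n) ℝ) (t : ℝ) (X : Fin n → Vec d) :
    act A (t • X) = t • act A X := by
  ext1 i
  simp [act, Finset.smul_sum, smul_comm t]

theorem sub_act (A B : Matrix (Fin n) (Fin n) ℝ) (X : Fin n → Vec d) :
    act (A - B) X = act A X - act B X := by
  ext1 i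
  simp [act, sub_smul, Finset.sum_sub_distrib]

theorem one_act (X : Fin n → Vec d) : act 1 X = X := by
  ext1 i
  simp [act, Matrix.one_apply, ite_smul]

theorem act_act (A B : Matrix (Fin n) (Fin n) ℝ) (X : Fin n → Vec d) :
    act A (act B X) = act (A * B) X := by
  ext1 i
  simp only [act, Matrix.mul_apply, Finset.smul_sum, Finset.sum_smul, mul_smul]
  exact Finset.sum_comm

theorem sum_inner_act (A : Matrix (Fin n) (Fin n) ℝ) (X Y : Fin n → Vec d) :
    ∑ i, inner ℝ (act A X i) (Y i) = ∑ i, inner ℝ (X i) (act Aᵀ Y i) := by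
  simp only [act, sum_inner, inner_sum, real_inner_smul_left, real_inner_smul_right,
    Matrix.transpose_apply]
  exact Finset.sum_comm

/-- A matrix acts on stacks of vectors with operator norm at most its spectral norm. -/
theorem sum_norm_sq_act_le (A : Matrix (Fin n) (Fin n) ℝ) (X : Fin n → Vec d) :
    ∑ i, ‖act A X i‖ ^ 2 ≤ spectralNorm A ^ 2 * ∑ i, ‖X i‖ ^ 2 := by
  have h (v : EuclideanSpace ℝ (Fin n)) :
      ∑ i, (∑ j, A i j * v j) ^ 2 ≤ spectralNorm A ^ 2 * ∑ i, v i ^ 2 := by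
    have h1 := (Matrix.toEuclideanCLM (n := Fin n) (𝕜 := ℝ) A).le_opNorm v
    have h2 := pow_le_pow_left₀ (norm_nonneg _) h1 2
    rw [mul_pow, EuclideanSpace.real_norm_sq_eq, EuclideanSpace.real_norm_sq_eq] at h2
    simpa [spectralNorm, Matrix.mulVec, dotProduct] using h2
  simp only [EuclideanSpace.real_norm_sq_eq]
  -- The action is coordinatewise: for each coordinate `c` of `ℝ^d`, the matrix acts on the vector
  -- of `c`-th coordinates in `ℝ^n`.
  rw [Finset.sum_comm, Finset.sum_comm (f := fun i j => (X i) j ^ 2), Finset.mul_sum]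
  refine Finset.sum_le_sum fun c _ => ?_
  have := h (WithLp.toLp 2 fun j => X j c)
  simpa [act] using this

theorem spectralNorm_nonneg (A : Matrix (Fin n) (Fin n) ℝ) : 0 ≤ spectralNorm A := norm_nonneg _

theorem spectralGap_le_one (W : Matrix (Fin n) (Fin n) ℝ) : spectralGap W ≤ 1 := by
  have := spectralNorm_nonneg (W - avgMatrix n)
  rw [spectralGap]; linarith

/-- The deviation of a stack of vectors from its average. -/
noncomputable def dev (X : Fin n → Vec d) : Fin n → Vec d := act (1 - avgMatrix n) X

theorem dev_apply (X : Fin n → Vec d) (i : Fin n) :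
    dev X i = X i - (1 / (n : ℝ)) • ∑ j, X j := by
  rw [dev, sub_act, one_act, Pi.sub_apply]
  simp [act, avgMatrix, Finset.smul_sum]

theorem sum_dev (hn : 1 ≤ n) (X : Fin n → Vec d) : ∑ i, dev X i = 0 := by
  have h : (n : ℝ) ≠ 0 := by positivity
  simp only [dev_apply, Finset.sum_sub_distrib, Finset.sum_const, Finset.card_univ,
    Fintype.card_fin]
  rw [← Nat.cast_smul_eq_nsmul ℝ, smul_smul, mul_one_div_cancel h, one_smul, sub_self]

/-- The average minimizes the total squared deviation. -/
theorem sum_norm_sq_dev_le (hn : 1 ≤ n) (X : Fin n → Vec d) (p : Vec d) :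
    ∑ i, ‖dev X i‖ ^ 2 ≤ ∑ i, ‖X i - p‖ ^ 2 := by
  set m : Vec d := (1 / (n : ℝ)) • ∑ j, X j with hm
  have h (i : Fin n) : ‖X i - p‖ ^ 2
      = ‖dev X i‖ ^ 2 + 2 * inner ℝ (dev X i) (m - p) + ‖m - p‖ ^ 2 := by
    rw [← norm_add_sq_real, dev_apply]
    congr 2; abel
  simp only [h, Finset.sum_add_distrib, ← Finset.mul_sum, ← sum_inner, sum_dev hn X,
    inner_zero_left, mul_zero, add_zero]
  have : 0 ≤ ∑ _i : Fin n, ‖m - p‖ ^ 2 := by positivity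
  linarith

/-- Cross terms vanish because deviations sum to zero. Pairwise distances are the form in which a
nonexpansive projection can be applied, as projecting does not commute with averaging. -/
theorem two_mul_sum_norm_sq_dev (hn : 1 ≤ n) (X : Fin n → Vec d) :
    2 * n * ∑ i, ‖dev X i‖ ^ 2 = ∑ i, ∑ j, ‖X i - X j‖ ^ 2 := by
  have h (i j : Fin n) : ‖X i - X j‖ ^ 2
      = ‖dev X i‖ ^ 2 - 2 * inner ℝ (dev X i) (dev X j) + ‖dev X j‖ ^ 2 := by
    rw [← norm_sub_sq_real, dev_apply, dev_apply]
    congr 2; abel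
  simp only [h, Finset.sum_add_distrib, Finset.sum_sub_distrib, ← Finset.mul_sum, ← inner_sum,
    sum_dev hn X, inner_zero_right, mul_zero, Finset.sum_const, Finset.card_univ, Fintype.card_fin,
    nsmul_eq_mul]
  ring

/-- A nonexpansive map does not increase the total squared deviation. -/
theorem sum_norm_sq_dev_le_of_nonexpansive (hn : 1 ≤ n) {X Y : Fin n → Vec d}
    (h : ∀ i j, ‖Y i - Y j‖ ≤ ‖X i - X j‖) :
    ∑ i, ‖dev Y i‖ ^ 2 ≤ ∑ i, ‖dev X i‖ ^ 2 := by
  have h1 := two_mul_sum_norm_sq_dev hn X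
  have h2 := two_mul_sum_norm_sq_dev hn Y
  have h3 : ∑ i, ∑ j, ‖Y i - Y j‖ ^ 2 ≤ ∑ i, ∑ j, ‖X i - X j‖ ^ 2 := by
    gcongr with i _ j _
    exact h i j
  have hn' : (0 : ℝ) < 2 * n := by positivity
  rw [← h1, ← h2] at h3
  exact le_of_mul_le_mul_left h3 hn'

namespace IsNetwork

variable {G : SimpleGraph (Fin n)} {W : Matrix (Fin n) (Fin n) ℝ}

theorem col_sum (h : IsNetwork G W) (j : Fin n) : ∑ i, W i j = 1 := by
  rw [← h.row_sum j]
  refine Finset.sum_congr rfl fun i _ => ?_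
  conv_lhs => rw [← h.symm]
  rfl

theorem mul_avgMatrix (h : IsNetwork G W) : W * avgMatrix n = avgMatrix n := by
  ext i j
  simp [Matrix.mul_apply, avgMatrix, ← Finset.sum_mul, h.row_sum]

theorem avgMatrix_mul (h : IsNetwork G W) : avgMatrix n * W = avgMatrix n := by
  ext i j
  simp [Matrix.mul_apply, avgMatrix, ← Finset.mul_sum, h.col_sum]

theorem transpose_one_sub (h : IsNetwork G W) : (1 - W)ᵀ = 1 - W := by
  rw [Matrix.transpose_sub, Matrix.transpose_one, h.symm]

/-- `I - W` is positive semidefinite. -/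
theorem quadForm_one_sub_nonneg (h : IsNetwork G W) (v : Fin n → ℝ) :
    0 ≤ v ⬝ᵥ ((1 - W) *ᵥ v) := by
  -- Graph Laplacian identity: row and column sums equal to one turn the quadratic form into a
  -- nonnegative combination of squared differences.
  have h1 : v ⬝ᵥ ((1 - W) *ᵥ v) = (1 / 2) * ∑ i, ∑ j, W i j * (v i - v j) ^ 2 := by
    have e1 : ∑ i, ∑ j, W i j * v i ^ 2 = ∑ i, v i ^ 2 := by
      simp [← Finset.sum_mul, h.row_sum]
    have e2 : ∑ i, ∑ j, W i j * v j ^ 2 = ∑ i, v i ^ 2 := by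
      rw [Finset.sum_comm]
      simp [← Finset.sum_mul, h.col_sum]
    have e3 : v ⬝ᵥ (W *ᵥ v) = ∑ i, ∑ j, W i j * (v i * v j) := by
      simp only [dotProduct, Matrix.mulVec, Finset.mul_sum]
      refine Finset.sum_congr rfl fun i _ => Finset.sum_congr rfl fun j _ => by ring
    have e4 : v ⬝ᵥ v = ∑ i, v i ^ 2 := by
      simp only [dotProduct, sq]
    have e5 : ∑ i, ∑ j, W i j * (v i - v j) ^ 2 = ∑ i, ∑ j, W i j * v i ^ 2
        - 2 * (∑ i, ∑ j, W i j * (v i * v j)) + ∑ i, ∑ j, W i j * v j ^ 2 := by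
      simp only [Finset.mul_sum, ← Finset.sum_sub_distrib, ← Finset.sum_add_distrib]
      refine Finset.sum_congr rfl fun i _ => Finset.sum_congr rfl fun j _ => by ring
    rw [Matrix.sub_mulVec, Matrix.one_mulVec, dotProduct_sub, e3, e4, e5, e1, e2]
    ring
  rw [h1]
  have : 0 ≤ ∑ i, ∑ j, W i j * (v i - v j) ^ 2 :=
    Finset.sum_nonneg fun i _ => Finset.sum_nonneg fun j _ =>
      mul_nonneg (h.nonneg i j) (sq_nonneg _)
  linarith

theorem sum_inner_act_one_sub_nonneg (h : IsNetwork G W) (X : Fin n → Vec d) :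
    0 ≤ ∑ i, inner ℝ (act (1 - W) X i) (X i) := by
  have e : ∑ i, inner ℝ (act (1 - W) X i) (X i)
      = ∑ c, (fun j => X j c) ⬝ᵥ ((1 - W) *ᵥ fun j => X j c) := by
    simp only [dotProduct, Matrix.mulVec]
    rw [Finset.sum_comm]
    refine Finset.sum_congr rfl fun i _ => ?_
    rw [PiLp.inner_apply]
    refine Finset.sum_congr rfl fun c _ => ?_
    simp [act]
  rw [e]
  exact Finset.sum_nonneg fun c _ => h.quadForm_one_sub_nonneg _

theorem act_one_sub_const (h : IsNetwork G W) (p : Vec d) : act (1 - W) (fun _ => p) = 0 := by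
  rw [sub_act, one_act]
  ext1 i
  simp [act, ← Finset.sum_smul, h.row_sum]

theorem act_one_sub_dev (h : IsNetwork G W) (X : Fin n → Vec d) :
    act (1 - W) (dev X) = act (1 - W) X := by
  have : dev X = X - fun _ => (1 / (n : ℝ)) • ∑ j, X j := by
    ext1 i; rw [dev_apply]; rfl
  rw [this, act_sub, h.act_one_sub_const, sub_zero]

theorem dev_act_one_sub (h : IsNetwork G W) (X : Fin n → Vec d) :
    dev (act (1 - W) X) = act (1 - W) X := by
  rw [← h.act_one_sub_dev X, dev, act_act]
  have h1 : avgMatrix n * (1 - W) = 0 := by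
    rw [mul_sub, mul_one, h.avgMatrix_mul, sub_self]
  rw [sub_mul, h1, one_mul, sub_zero]

/-- On nonconstant vectors, `W` strictly decreases the norm. -/
theorem dotProduct_mulVec_lt (h : IsNetwork G W) {v : Fin n → ℝ} (hv : (1 - W) *ᵥ v ≠ 0) :
    (W *ᵥ v) ⬝ᵥ (W *ᵥ v) < v ⬝ᵥ v := by
  set a := (1 - W) *ᵥ v with ha
  set b := (1 + W) *ᵥ v with hb
  have hsym (x y : Fin n → ℝ) : (W *ᵥ x) ⬝ᵥ y = x ⬝ᵥ (W *ᵥ y) := by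
    rw [dotProduct_comm, Matrix.dotProduct_mulVec, ← Matrix.mulVec_transpose, h.symm,
      dotProduct_comm]
  have h1 : 0 < a ⬝ᵥ ((1 + W) *ᵥ a) := by
    simpa using h.spectral.dotProduct_mulVec_pos hv
  have h2 : 0 ≤ b ⬝ᵥ ((1 - W) *ᵥ b) := h.quadForm_one_sub_nonneg b
  -- With `W` symmetric, `2(I - W²) = (I - W)(I + W)(I - W) + (I + W)(I - W)(I + W)`. Strictness
  -- comes from the first summand, where `I + W ≻ 0`.
  have key : 2 * (v ⬝ᵥ v - (W *ᵥ v) ⬝ᵥ (W *ᵥ v))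
      = a ⬝ᵥ ((1 + W) *ᵥ a) + b ⬝ᵥ ((1 - W) *ᵥ b) := by
    simp only [ha, hb, Matrix.add_mulVec, Matrix.sub_mulVec, Matrix.one_mulVec,
      Matrix.mulVec_add, Matrix.mulVec_sub, add_dotProduct, dotProduct_add, sub_dotProduct,
      dotProduct_sub, hsym]
    ring
  linarith

/-- With `H` the averaging projection, `(W - H) v = W p` for `p = (I - H) v`, and `‖p‖ ≤ ‖v‖`.
Either `W` strictly shrinks `p`, or `p` is constant with zero average, hence zero, and `v ≠ 0` gives
strictness. -/
theorem norm_toEuclideanCLM_sub_avg_lt (h : IsNetwork G W) (hn : 1 ≤ n)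
    {v : EuclideanSpace ℝ (Fin n)} (hv : v ≠ 0) :
    ‖Matrix.toEuclideanCLM (n := Fin n) (𝕜 := ℝ) (W - avgMatrix n) v‖ < ‖v‖ := by
  have hn0 : (n : ℝ) ≠ 0 := by positivity
  set w : Fin n → ℝ := v.ofLp with hw
  set p : Fin n → ℝ := (1 - avgMatrix n) *ᵥ w with hp
  have hH : avgMatrix n * avgMatrix n = avgMatrix n := by
    ext i j
    simp [Matrix.mul_apply, avgMatrix, hn0]
  have hHs : (avgMatrix n)ᵀ = avgMatrix n := by ext i j; simp [avgMatrix]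
  have hnorm (z : EuclideanSpace ℝ (Fin n)) : ‖z‖ ^ 2 = z.ofLp ⬝ᵥ z.ofLp := by
    rw [EuclideanSpace.real_norm_sq_eq]; simp only [dotProduct, sq]
  have h1 : ‖Matrix.toEuclideanCLM (n := Fin n) (𝕜 := ℝ) (W - avgMatrix n) v‖ ^ 2
      = (W *ᵥ p) ⬝ᵥ (W *ᵥ p) := by
    rw [hnorm, Matrix.ofLp_toEuclideanCLM, hp, Matrix.mulVec_mulVec, mul_sub, mul_one,
      h.mul_avgMatrix]
  have hsymH (x y : Fin n → ℝ) : (avgMatrix n *ᵥ x) ⬝ᵥ y = x ⬝ᵥ (avgMatrix n *ᵥ y) := by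
    rw [dotProduct_comm, Matrix.dotProduct_mulVec, ← Matrix.mulVec_transpose, hHs,
      dotProduct_comm]
  have h2 : w ⬝ᵥ w = p ⬝ᵥ p + (avgMatrix n *ᵥ w) ⬝ᵥ (avgMatrix n *ᵥ w) := by
    simp only [hp, Matrix.sub_mulVec, Matrix.one_mulVec, sub_dotProduct, dotProduct_sub, hsymH,
      Matrix.mulVec_mulVec, hH]
    ring
  have h3 : 0 ≤ (avgMatrix n *ᵥ w) ⬝ᵥ (avgMatrix n *ᵥ w) := by
    simp only [dotProduct]
    exact Finset.sum_nonneg fun i _ => mul_self_nonneg _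
  have h4 : (W *ᵥ p) ⬝ᵥ (W *ᵥ p) < w ⬝ᵥ w := by
    by_cases hc : (1 - W) *ᵥ p = 0
    · obtain ⟨a, ha⟩ := (h.consensus p).1 hc
      have hp0 : avgMatrix n *ᵥ p = 0 := by
        rw [hp, Matrix.mulVec_mulVec, mul_sub, mul_one, hH, sub_self, Matrix.zero_mulVec]
      have ha0 : a = 0 := by
        have := congrFun hp0 ⟨0, hn⟩
        rw [ha] at this
        simpa [Matrix.mulVec, dotProduct, avgMatrix, hn0] using this
      have hpz : p = 0 := by rw [ha, ha0]; rfl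
      rw [hpz, Matrix.mulVec_zero, zero_dotProduct, ← hnorm v]
      positivity
    · have := h.dotProduct_mulVec_lt hc
      linarith
  rw [← hnorm v, ← h1] at h4
  exact lt_of_pow_lt_pow_left₀ 2 (norm_nonneg _) h4

/-- The operator norm is attained on the compact unit sphere, so strict decrease at every vector
yields a norm strictly below one. -/
theorem spectralGap_pos (h : IsNetwork G W) (hn : 1 ≤ n) : 0 < spectralGap W := by
  have : Nonempty (Fin n) := ⟨⟨0, hn⟩⟩
  have : Nontrivial (EuclideanSpace ℝ (Fin n)) := inferInstance
  rw [spectralGap, spectralNorm, sub_pos]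
  set A := Matrix.toEuclideanCLM (n := Fin n) (𝕜 := ℝ) (W - avgMatrix n) with hA
  obtain ⟨v, hv, hmax⟩ := (isCompact_sphere (0 : EuclideanSpace ℝ (Fin n)) 1).exists_isMaxOn
    (NormedSpace.sphere_nonempty.2 zero_le_one) (f := fun v => ‖A v‖) (by fun_prop)
  have hv1 : ‖v‖ = 1 := by simpa using hv
  have hlt : ‖A v‖ < 1 := by
    rw [← hv1]
    exact h.norm_toEuclideanCLM_sub_avg_lt hn (by rintro rfl; simp at hv1)
  refine lt_of_le_of_lt (A.opNorm_le_of_unit_norm (norm_nonneg (A v)) fun x hx => ?_) hlt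
  exact hmax (by simpa using hx)

/-- The consensus map `I - γ (I - W)` contracts deviations by the factor `1 - γ δ`. -/
theorem sum_norm_sq_mixing_le (h : IsNetwork G W) {γ : ℝ} (hγ0 : 0 ≤ γ) (hγ1 : γ ≤ 1) (hn : 1 ≤ n)
    (X : Fin n → Vec d) :
    ∑ i, ‖dev X i - γ • act (1 - W) X i‖ ^ 2
      ≤ (1 - γ * spectralGap W) ^ 2 * ∑ i, ‖dev X i‖ ^ 2 := by
  have hn0 : (n : ℝ) ≠ 0 := by positivity
  have hH : avgMatrix n * avgMatrix n = avgMatrix n := by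
    ext i j
    simp [Matrix.mul_apply, avgMatrix, hn0]
  -- Deviations have zero average, so on them `W - H` acts as `W`.
  have hA : act (W - avgMatrix n) (dev X) = dev X - act (1 - W) X := by
    rw [dev, act_act, ← sub_act]
    congr 1
    rw [sub_mul, mul_sub, mul_sub, h.mul_avgMatrix, hH]
    noncomm_ring
  set ρ := spectralNorm (W - avgMatrix n) with hρ
  have hρ0 : 0 ≤ ρ := spectralNorm_nonneg _
  have hle := sum_norm_sq_act_le (W - avgMatrix n) (dev X)
  rw [hA, ← hρ] at hle
  have hgap : 1 - γ * spectralGap W = (1 - γ) + γ * ρ := by rw [spectralGap]; ring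
  rw [hgap]
  set D := ∑ i, ‖dev X i‖ ^ 2 with hD
  set E := ∑ i, ‖(dev X - act (1 - W) X) i‖ ^ 2 with hE
  have hcross : ∑ i, ‖dev X i‖ * ‖(dev X - act (1 - W) X) i‖ ≤ ρ * D := by
    have hcs := Finset.sum_mul_sq_le_sq_mul_sq Finset.univ (fun i => ‖dev X i‖)
      (fun i => ‖(dev X - act (1 - W) X) i‖)
    have hD0 : 0 ≤ D := Finset.sum_nonneg fun i _ => sq_nonneg _
    refine abs_le_of_sq_le_sq' ?_ (by positivity) |>.2
    calc _ ≤ D * E := hcs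
      _ ≤ D * (ρ ^ 2 * D) := by gcongr
      _ = _ := by ring
  have hpt (i : Fin n) : ‖dev X i - γ • act (1 - W) X i‖ ^ 2
      ≤ (1 - γ) ^ 2 * ‖dev X i‖ ^ 2
        + 2 * ((1 - γ) * γ) * (‖dev X i‖ * ‖(dev X - act (1 - W) X) i‖)
        + γ ^ 2 * ‖(dev X - act (1 - W) X) i‖ ^ 2 := by
    -- `I - γ(I - W)` is the convex combination `(1 - γ) I + γ W`, whence the factor `(1 - γ) + γ(1
    -- - δ)`.
    have e : dev X i - γ • act (1 - W) X i
        = (1 - γ) • dev X i + γ • (dev X - act (1 - W) X) i := by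
      rw [Pi.sub_apply]; module
    have h1 : ‖dev X i - γ • act (1 - W) X i‖
        ≤ (1 - γ) * ‖dev X i‖ + γ * ‖(dev X - act (1 - W) X) i‖ := by
      rw [e]
      refine (norm_add_le _ _).trans ?_
      rw [norm_smul, norm_smul, Real.norm_of_nonneg (by linarith), Real.norm_of_nonneg hγ0]
    refine (pow_le_pow_left₀ (norm_nonneg _) h1 2).trans (le_of_eq ?_)
    ring
  refine (Finset.sum_le_sum fun i _ => hpt i).trans ?_
  rw [Finset.sum_add_distrib, Finset.sum_add_distrib, ← Finset.mul_sum, ← Finset.mul_sum,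
    ← Finset.mul_sum, ← hD, ← hE]
  have hg : 0 ≤ 2 * ((1 - γ) * γ) := mul_nonneg (by norm_num) (mul_nonneg (by linarith) hγ0)
  calc _ ≤ (1 - γ) ^ 2 * D + 2 * ((1 - γ) * γ) * (ρ * D) + γ ^ 2 * (ρ ^ 2 * D) := by gcongr
    _ = _ := by ring

end IsNetwork

end Network

/-! ### The contraction factor -/

section Constants

variable {γ δ β c : ℝ}

theorem mul_sq_disagreement_lt (h : IsConsensusStep γ δ β c) :
    γ * (1 + 2 / δ) * β ^ 2 < c := by
  have h1 := h.compression
  have h2 : 0 ≤ γ * ((1 + c⁻¹) ^ 2 * γ * β ^ 2) := by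
    have := h.pos
    positivity
  rw [κ₂] at h1
  linarith

/-- `γ²β² ≤ γβ² ≤ γ(1 + 2/δ)β² < c`. It lets the descent inequality carry absolute constants. -/
theorem mul_disagreement_sq_le_one (hδ : 0 < δ) (hc : c ≤ 1 / 2) (h : IsConsensusStep γ δ β c) :
    γ ^ 2 * β ^ 2 ≤ 1 := by
  have h1 := mul_sq_disagreement_lt h
  have hγ := h.pos
  have hγ1 := h.lt_one
  have h2 : 0 ≤ γ * (2 / δ) * β ^ 2 := by positivity
  have h3 : γ ^ 2 * β ^ 2 ≤ γ * β ^ 2 := by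
    gcongr
    nlinarith
  linarith

/-- Put `x = γδ`. The compression condition gives `2γ²β² ≤ c x`, so the second summand is at most
`(1 + c)²(1 - 2c) x ≤ x`. The first is `(1 - x(1 + x)/2)² < 1 - x`. -/
theorem C₁_lt_one (hδ : 0 < δ) (hδ1 : δ ≤ 1) (hc0 : 0 < c) (hc : c ≤ 1 / 2)
    (h : IsConsensusStep γ δ β c) : C₁ γ δ β c < 1 := by
  have h1 := mul_sq_disagreement_lt h
  have hγ := h.pos
  have hγ1 := h.lt_one
  set x := γ * δ with hx
  have hx0 : 0 < x := mul_pos hγ hδ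
  have hx1 : x < 1 := by nlinarith
  have hb : γ * β ^ 2 * (2 + δ) ≤ c * δ := by
    have : γ * (1 + 2 / δ) * β ^ 2 * δ = γ * β ^ 2 * (2 + δ) := by field_simp; ring
    nlinarith
  have hb2 : 2 * (γ ^ 2 * β ^ 2) ≤ c * x := by
    have h5 : 2 * (γ * β ^ 2) ≤ c * δ := by
      have : 0 ≤ γ * β ^ 2 * δ := by positivity
      linarith
    calc 2 * (γ ^ 2 * β ^ 2) = γ * (2 * (γ * β ^ 2)) := by ring
      _ ≤ γ * (c * δ) := by gcongr
      _ = c * x := by rw [hx]; ring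
  have hB : (1 + c⁻¹) * (1 + c) * (2 * γ ^ 2 * β ^ 2) * (1 - 2 * c) ≤ x := by
    calc (1 + c⁻¹) * (1 + c) * (2 * γ ^ 2 * β ^ 2) * (1 - 2 * c)
        = (1 + c⁻¹) * (1 + c) * (1 - 2 * c) * (2 * (γ ^ 2 * β ^ 2)) := by ring
      _ ≤ (1 + c⁻¹) * (1 + c) * (1 - 2 * c) * (c * x) := by
        gcongr
        have : 0 ≤ 1 - 2 * c := by linarith
        positivity
      _ = ((1 + c) ^ 2 * (1 - 2 * c)) * x := by field_simp; ring
      _ ≤ 1 * x := by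
        gcongr
        nlinarith [mul_pos hc0 hc0, mul_pos (mul_pos hc0 hc0) hc0]
      _ = x := one_mul x
  have hA : (1 + x / 2) * (1 + x / 2) * (1 - x) ^ 2 < 1 - x := by
    have h3 : (1 + x / 2) * (1 + x / 2) * (1 - x) ^ 2
        = 1 - x - x ^ 2 * (1 - ((1 + x) / 2) ^ 2) := by ring
    have h4 : 0 < 1 - ((1 + x) / 2) ^ 2 := by nlinarith
    have h5 : 0 < x ^ 2 * (1 - ((1 + x) / 2) ^ 2) := by positivity
    linarith
  rw [C₁]
  linarith

/-- The two terms carrying `γ²β²` are bounded by the two terms of `γ κ₂`, hence together by less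
than `c`. What remains is `(1 + c)(1 - 2c) = 1 - c - 2c²`. -/
theorem C₂_lt_one (hδ : 0 < δ) (hc0 : 0 < c) (hc : c ≤ 1 / 2)
    (h : IsConsensusStep γ δ β c) : C₂ γ δ β c < 1 := by
  have hγ := h.pos
  have hγ1 := h.lt_one
  have h1 := h.compression
  rw [κ₂] at h1
  have e1 : (1 + (γ * δ / 2)⁻¹) * (γ ^ 2 * β ^ 2) ≤ γ * ((1 + 2 / δ) * β ^ 2) := by
    have : (1 + (γ * δ / 2)⁻¹) * (γ ^ 2 * β ^ 2) = γ ^ 2 * β ^ 2 + γ * (2 / δ) * β ^ 2 := by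
      field_simp
    rw [this]
    have : γ ^ 2 * β ^ 2 ≤ γ * β ^ 2 := by
      gcongr
      nlinarith
    linarith
  have e2 : (1 + c⁻¹) * (1 + c⁻¹) * (γ ^ 2 * β ^ 2) * (1 - 2 * c)
      ≤ γ * ((1 + c⁻¹) ^ 2 * γ * β ^ 2) := by
    have h0 : 0 ≤ (1 + c⁻¹) * (1 + c⁻¹) * (γ ^ 2 * β ^ 2) := by positivity
    calc _ ≤ (1 + c⁻¹) * (1 + c⁻¹) * (γ ^ 2 * β ^ 2) * 1 := by gcongr; linarith
      _ = _ := by ring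
  rw [C₂, add_mul]
  nlinarith [mul_pos hc0 hc0]

theorem κ₀_lt_one (hδ : 0 < δ) (hδ1 : δ ≤ 1) (hc0 : 0 < c) (hc : c ≤ 1 / 2)
    (h : IsConsensusStep γ δ β c) : κ₀ γ δ β c < 1 :=
  max_lt (C₁_lt_one hδ hδ1 hc0 hc h) (C₂_lt_one hδ hc0 hc h)

theorem κ₀_nonneg (hδ : 0 < δ) (hγ : 0 < γ) (hc0 : 0 < c) (hc : c ≤ 1 / 2) : 0 ≤ κ₀ γ δ β c := by
  refine le_max_of_le_right ?_
  have : 0 ≤ 1 - 2 * c := by linarith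
  rw [C₂]
  positivity

/-- Guarantees `κ₃ ≥ 6 Lf²`, by which contributions not containing `κ₃` are absorbed in the final
bound. -/
theorem six_le_C₃ (hδ : 0 < δ) (hγ : 0 < γ) (hc0 : 0 < c) : 6 ≤ C₃ γ δ c := by
  have h1 : 0 < c⁻¹ := by positivity
  have h2 : 1 ≤ (1 + γ * δ / 2) * (1 + 2 / (γ * δ)) := by
    have : 0 < γ * δ / 2 := by positivity
    have : 0 < 2 / (γ * δ) := by positivity
    nlinarith
  rw [C₃]
  linarith

end Constants

/-! ### Projections and the shrunk constraint set -/

section Projection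

variable {d : ℕ} {K : Set (Vec d)}

/-- A nearest point exists in a nonempty closed convex set of a complete space, so the choice
defining `proj` is genuine; minimality is equivalent to the variational inequality. -/
theorem proj_spec (hne : K.Nonempty) (hc : IsClosed K) (hconv : Convex ℝ K) (z : Vec d) :
    proj K z ∈ K ∧ ∀ w ∈ K, inner ℝ (z - proj K z) (w - proj K z) ≤ 0 := by
  have hex : ∃ p, p ∈ K ∧ IsMinOn (fun x => ‖x - z‖ ^ 2) K p := by
    obtain ⟨v, hv, hmin⟩ := exists_norm_eq_iInf_of_complete_convex hne hc.isComplete hconv z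
    refine ⟨v, hv, fun w hw => ?_⟩
    have h1 : ‖z - v‖ ≤ ‖z - w‖ := by
      rw [hmin]
      exact ciInf_le ⟨0, Set.forall_mem_range.2 fun _ => norm_nonneg _⟩ (⟨w, hw⟩ : K)
    change ‖v - z‖ ^ 2 ≤ ‖w - z‖ ^ 2
    rw [norm_sub_rev v, norm_sub_rev w]
    gcongr
  obtain ⟨hmem, hmin⟩ := Classical.epsilon_spec hex
  change proj K z ∈ K at hmem
  refine ⟨hmem, (norm_eq_iInf_iff_real_inner_le_zero hconv hmem).1 ?_⟩
  have : Nonempty K := ⟨⟨_, hmem⟩⟩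
  refine le_antisymm (le_ciInf fun w => ?_)
    (ciInf_le ⟨0, Set.forall_mem_range.2 fun _ => norm_nonneg _⟩ (⟨_, hmem⟩ : K))
  have h2 : ‖proj K z - z‖ ^ 2 ≤ ‖(w : Vec d) - z‖ ^ 2 := hmin w.2
  rw [norm_sub_rev z, norm_sub_rev z]
  exact (pow_le_pow_iff_left₀ (norm_nonneg _) (norm_nonneg _) two_ne_zero).1 h2

theorem proj_mem (hne : K.Nonempty) (hc : IsClosed K) (hconv : Convex ℝ K) (z : Vec d) :
    proj K z ∈ K :=
  (proj_spec hne hc hconv z).1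

/-- Adding the variational inequalities at the two projections gives `‖p - q‖² ≤ ⟨z - w, p - q⟩`;
conclude by Cauchy–Schwarz. -/
theorem norm_proj_sub_proj_le (hne : K.Nonempty) (hc : IsClosed K) (hconv : Convex ℝ K)
    (z w : Vec d) : ‖proj K z - proj K w‖ ≤ ‖z - w‖ := by
  obtain ⟨hz, hz'⟩ := proj_spec hne hc hconv z
  obtain ⟨hw, hw'⟩ := proj_spec hne hc hconv w
  set p := proj K z
  set q := proj K w
  have h1 := hz' q hw
  have h2 := hw' p hz
  have h3 : ‖p - q‖ ^ 2 ≤ inner ℝ (z - w) (p - q) := by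
    rw [← real_inner_self_eq_norm_sq]
    have e1 : inner ℝ (z - p) (q - p) = inner ℝ (p - z) (p - q) := by
      rw [← neg_sub p z, ← neg_sub p q, inner_neg_neg]
    have e2 : inner ℝ (p - q) (p - q)
        = inner ℝ (p - z) (p - q) + inner ℝ (w - q) (p - q) + inner ℝ (z - w) (p - q) := by
      rw [← inner_add_left, ← inner_add_left]
      congr 1; abel
    rw [e1] at h1
    linarith
  have h4 := real_inner_le_norm (z - w) (p - q)
  rcases (norm_nonneg (p - q)).eq_or_lt with h0 | h0
  · rw [← h0]; exact norm_nonneg _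
  · nlinarith

theorem proj_eq_self (hne : K.Nonempty) (hc : IsClosed K) (hconv : Convex ℝ K) {z : Vec d}
    (hz : z ∈ K) : proj K z = z := by
  have h := (proj_spec hne hc hconv z).2 z hz
  rw [real_inner_self_eq_norm_sq] at h
  have h1 : ‖z - proj K z‖ = 0 := by nlinarith [norm_nonneg (z - proj K z)]
  exact (sub_eq_zero.1 (norm_eq_zero.1 h1)).symm

theorem norm_proj_sub_le (hne : K.Nonempty) (hc : IsClosed K) (hconv : Convex ℝ K)
    (z : Vec d) {y : Vec d} (hy : y ∈ K) : ‖proj K z - y‖ ≤ ‖z - y‖ := by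
  have := norm_proj_sub_proj_le hne hc hconv z y
  rwa [proj_eq_self hne hc hconv hy] at this

theorem continuous_proj (hne : K.Nonempty) (hc : IsClosed K) (hconv : Convex ℝ K) :
    Continuous (proj K) :=
  (LipschitzWith.of_dist_le_mul (K := 1) fun z w => by
    simpa [dist_eq_norm] using norm_proj_sub_proj_le hne hc hconv z w).continuous

namespace IsConstraintSet

variable {Rl Ru : ℝ}

theorem zero_mem (h : IsConstraintSet K Rl Ru) : (0 : Vec d) ∈ K :=
  h.inner_ball (by simpa using h.inner_pos.le)

theorem norm_le (h : IsConstraintSet K Rl Ru) {x : Vec d} (hx : x ∈ K) : ‖x‖ ≤ Ru := by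
  simpa using h.outer_ball hx

theorem outer_nonneg (h : IsConstraintSet K Rl Ru) : 0 ≤ Ru := by
  simpa using h.norm_le h.zero_mem

theorem norm_sub_le (h : IsConstraintSet K Rl Ru) {x y : Vec d} (hx : x ∈ K) (hy : y ∈ K) :
    ‖x - y‖ ≤ 2 * Ru := by
  have := _root_.norm_sub_le x y
  linarith [h.norm_le hx, h.norm_le hy]

theorem shrink_nonempty (h : IsConstraintSet K Rl Ru) (ε : ℝ) : (shrink ε K).Nonempty :=
  ⟨_, 0, h.zero_mem, rfl⟩

theorem isClosed_shrink (h : IsConstraintSet K Rl Ru) (ε : ℝ) : IsClosed (shrink ε K) := by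
  have hK : IsCompact K :=
    Metric.isCompact_of_isClosed_isBounded h.closed (Metric.isBounded_closedBall.subset h.outer_ball)
  exact (hK.image (by fun_prop)).isClosed

theorem convex_shrink (h : IsConstraintSet K Rl Ru) (ε : ℝ) : Convex ℝ (shrink ε K) := by
  exact h.convex.smul (1 - ε)

theorem shrink_subset (h : IsConstraintSet K Rl Ru) {ε : ℝ} (h0 : 0 ≤ ε) (h1 : ε ≤ 1) :
    shrink ε K ⊆ K := by
  rintro _ ⟨x, hx, rfl⟩
  exact h.convex.smul_mem_of_zero_mem h.zero_mem hx ⟨by linarith, by linarith⟩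

/-- `(1 - ε) y + w` is a convex combination of `y` and `ε⁻¹ w`, the latter in the inner ball. This
is the purpose of shrinking: query points `x + μu` stay in `K` as soon as `μ ≤ ε Rl`. -/
theorem add_mem_of_mem_shrink (h : IsConstraintSet K Rl Ru) {ε : ℝ} (h0 : 0 < ε) (h1 : ε ≤ 1)
    {x w : Vec d} (hx : x ∈ shrink ε K) (hw : ‖w‖ ≤ ε * Rl) : x + w ∈ K := by
  obtain ⟨y, hy, rfl⟩ := hx
  have hv : ε⁻¹ • w ∈ K := by
    refine h.inner_ball ?_
    rw [mem_closedBall_zero_iff, norm_smul, norm_inv, Real.norm_of_nonneg h0.le,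
      inv_mul_le_iff₀ h0]
    exact hw
  have := h.convex hy hv (by linarith : 0 ≤ 1 - ε) h0.le (by ring)
  rwa [smul_inv_smul₀ h0.ne'] at this

end IsConstraintSet

end Projection

/-! ### The objective and the gradient estimator -/

/-- The gradient inequality for a convex function that is differentiable within its domain. -/
theorem ConvexOn.add_fderivWithin_le {E : Type*} [NormedAddCommGroup E] [NormedSpace ℝ E]
    {K : Set E} {f : E → ℝ} (hf : ConvexOn ℝ K f) {x y : E} (hx : x ∈ K) (hy : y ∈ K)
    {f' : E →L[ℝ] ℝ} (hd : HasFDerivWithinAt f f' K x) : f x + f' (y - x) ≤ f y := by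
  set l : ℝ →ᵃ[ℝ] E := AffineMap.lineMap x y with hl
  have hmaps : Set.MapsTo l (Set.Icc 0 1) K := by
    intro t ht
    exact hf.1.segment_subset hx hy (by
      rw [segment_eq_image_lineMap]; exact ⟨t, ht, rfl⟩)
  have hg : ConvexOn ℝ (Set.Icc 0 1) (f ∘ l) :=
    (hf.comp_affineMap l).subset hmaps (convex_Icc 0 1)
  have hl0 : l 0 = x := by simp [hl]
  have hl1 : l 1 = y := by simp [hl]
  have hd' : HasDerivWithinAt (f ∘ l) (f' (y - x)) (Set.Icc 0 1) 0 :=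
    HasFDerivWithinAt.comp_hasDerivWithinAt_of_eq (0 : ℝ) hd AffineMap.hasDerivWithinAt_lineMap
      hmaps hl0.symm
  have := hg.le_slope_of_hasDerivWithinAt (by simp) (by simp) zero_lt_one hd'
  rw [slope_def_field] at this
  simp only [Function.comp, hl0, hl1] at this
  linarith

section Objective

variable {d n : ℕ} {Ξ : Fin n → Type*} [∀ i, MeasurableSpace (Ξ i)] {K : Set (Vec d)}
  {P : ∀ i, Measure (Ξ i)} {F : ∀ i, Vec d → Ξ i → ℝ} {Lf Lm σ Rl Ru μ : ℝ}

theorem inner_gradEst {Z : Type*} (F : Vec d → Z → ℝ) (x v : Vec d) (u : UnitSphere d) (z : Z) :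
    inner ℝ (gradEst μ F x u z) v
      = (d : ℝ) / μ * (F (x + μ • (u : Vec d)) z - F x z) * inner ℝ (u : Vec d) v := by
  rw [gradEst, real_inner_smul_left]

theorem norm_gradEst_le {Z : Type*} {F : Vec d → Z → ℝ} {x : Vec d} {u : UnitSphere d} {z : Z}
    (hμ : 0 < μ) (h : |F (x + μ • (u : Vec d)) z - F x z| ≤ Lf * μ) :
    ‖gradEst μ F x u z‖ ≤ d * Lf := by
  rw [gradEst, norm_smul, norm_mul, Real.norm_eq_abs, Real.norm_eq_abs, abs_of_nonneg (by positivity)]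
  have hu : ‖(u : Vec d)‖ = 1 := by simp
  rw [hu, mul_one]
  calc (d : ℝ) / μ * |F (x + μ • (u : Vec d)) z - F x z| ≤ d / μ * (Lf * μ) := by gcongr
    _ = d * Lf := by field_simp

theorem _root_.Measurable.gradEst {Z A : Type*} [MeasurableSpace Z] [MeasurableSpace A]
    {f : Vec d → Z → ℝ} (hf : Measurable (Function.uncurry f)) {X : A → Vec d}
    {U : A → UnitSphere d} {ζ : A → Z} (hX : Measurable X) (hU : Measurable U)
    (hζ : Measurable ζ) : Measurable fun a => gradEst μ f (X a) (U a) (ζ a) := by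
  have h1 : Measurable fun a => f (X a + μ • (U a : Vec d)) (ζ a) :=
    hf.comp ((hX.add (measurable_subtype_coe.comp hU |>.fun_const_smul μ)).prodMk hζ)
  have h2 : Measurable fun a => f (X a) (ζ a) := hf.comp (hX.prodMk hζ)
  have h3 : Measurable fun a => (U a : Vec d) := measurable_subtype_coe.comp hU
  exact (((h1.sub h2).const_mul _).smul h3)

theorem measurable_gradEst {Z : Type*} [MeasurableSpace Z] {F : Vec d → Z → ℝ}
    (hF : Measurable (Function.uncurry F)) :
    Measurable fun p : Vec d × Z × UnitSphere d => gradEst μ F p.1 p.2.2 p.2.1 :=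
  hF.gradEst measurable_fst measurable_snd.snd measurable_snd.fst

namespace IsSmoothObjective

theorem convexOn_localLoss (h : IsSmoothObjective K P F Lf Lm σ) (hK : Convex ℝ K) (i : Fin n) :
    ConvexOn ℝ K (localLoss P F i) := by
  refine ⟨hK, fun x hx y hy a b ha hb hab => ?_⟩
  have hz := hK hx hy ha hb hab
  simp only [localLoss, smul_eq_mul]
  rw [← integral_const_mul, ← integral_const_mul,
    ← integral_add ((h.integrable i x hx).const_mul a) ((h.integrable i y hy).const_mul b)]
  refine integral_mono_ae (h.integrable i _ hz)
    (((h.integrable i x hx).const_mul a).add ((h.integrable i y hy).const_mul b)) ?_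
  filter_upwards [h.convex i] with z hc
  exact hc.2 hx hy ha hb hab

theorem abs_localLoss_sub_le (h : IsSmoothObjective K P F Lf Lm σ) (i : Fin n) {x y : Vec d}
    (hx : x ∈ K) (hy : y ∈ K) : |localLoss P F i x - localLoss P F i y| ≤ Lf * ‖x - y‖ := by
  have := h.prob i
  rw [localLoss, localLoss, ← integral_sub (h.integrable i x hx) (h.integrable i y hy),
    ← Real.norm_eq_abs]
  have := norm_integral_le_of_norm_le_const (μ := P i) (f := fun z => F i x z - F i y z)
    (C := Lf * ‖x - y‖) (by
      filter_upwards [h.lipschitz i] with z hz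
      exact hz x hx y hy)
  simpa using this

theorem measurable_localLoss (h : IsSmoothObjective K P F Lf Lm σ) (i : Fin n) :
    Measurable (localLoss P F i) := by
  have := h.prob i
  exact ((h.meas i).stronglyMeasurable.integral_prod_right).measurable

theorem measurable_globalLoss (h : IsSmoothObjective K P F Lf Lm σ) :
    Measurable (globalLoss P F) := by
  unfold globalLoss
  exact (Finset.measurable_fun_sum _ fun i _ => h.measurable_localLoss i).const_mul _

theorem abs_globalLoss_sub_le (h : IsSmoothObjective K P F Lf Lm σ) (hn : 1 ≤ n) {x y : Vec d}
    (hx : x ∈ K) (hy : y ∈ K) : |globalLoss P F x - globalLoss P F y| ≤ Lf * ‖x - y‖ := by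
  have hn0 : (0 : ℝ) < n := by positivity
  rw [globalLoss, globalLoss, ← mul_sub, ← Finset.sum_sub_distrib, abs_mul,
    abs_of_nonneg (by positivity)]
  calc 1 / (n : ℝ) * |∑ i, (localLoss P F i x - localLoss P F i y)|
      ≤ 1 / (n : ℝ) * ∑ i : Fin n, Lf * ‖x - y‖ := by
        gcongr
        exact (Finset.abs_sum_le_sum_abs _ _).trans
          (Finset.sum_le_sum fun i _ => h.abs_localLoss_sub_le i hx hy)
    _ = Lf * ‖x - y‖ := by
        rw [Finset.sum_const, Finset.card_univ, Fintype.card_fin, nsmul_eq_mul]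
        field_simp

/-- The first order Taylor estimate that follows from Lipschitz continuity of the gradient. -/
theorem abs_taylor_le (h : IsSmoothObjective K P F Lf Lm σ) (hLm : 0 ≤ Lm) (hK : Convex ℝ K)
    (i : Fin n) {x y : Vec d} (hx : x ∈ K) (hy : y ∈ K) :
    |localLoss P F i y - localLoss P F i x
      - inner ℝ (gradientWithin (localLoss P F i) K x) (y - x)| ≤ Lm * ‖y - x‖ ^ 2 := by
  have hseg : segment ℝ x y ⊆ K := hK.segment_subset hx hy
  -- Mean value inequality on the segment for the loss minus its linearization at `x`. It loses the
  -- usual factor `1/2`, which only affects a constant.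
  have key := (convex_segment x y).norm_image_sub_le_of_norm_hasFDerivWithin_le'
    (f := localLoss P F i) (f' := fderivWithin ℝ (localLoss P F i) K)
    (φ := fderivWithin ℝ (localLoss P F i) K x) (C := Lm * ‖y - x‖)
    (fun z hz => ((h.diff i z (hseg hz)).hasFDerivWithinAt).mono hseg)
    (fun z hz => ?_) (left_mem_segment ℝ x y) (right_mem_segment ℝ x y)
  · rw [gradientWithin, InnerProductSpace.toDual_symm_apply]
    rw [Real.norm_eq_abs] at key
    linarith
  · have h1 := h.smooth i z (hseg hz) x hx
    rw [gradientWithin, gradientWithin, ← map_sub, LinearIsometryEquiv.norm_map] at h1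
    refine h1.trans ?_
    gcongr
    obtain ⟨t, ht, rfl⟩ := (segment_eq_image_lineMap ℝ x y ▸ hz)
    rw [AffineMap.lineMap_apply, vsub_eq_sub, vadd_eq_add, add_sub_cancel_right, norm_smul,
      Real.norm_of_nonneg ht.1]
    exact mul_le_of_le_one_left (norm_nonneg _) ht.2

theorem localLoss_sub_le_inner (h : IsSmoothObjective K P F Lf Lm σ) (hK : Convex ℝ K)
    (i : Fin n) {x y : Vec d} (hx : x ∈ K) (hy : y ∈ K) :
    localLoss P F i x - localLoss P F i y
      ≤ inner ℝ (gradientWithin (localLoss P F i) K x) (x - y) := by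
  have := ConvexOn.add_fderivWithin_le (h.convexOn_localLoss hK i) hx hy
    (h.diff i x hx).hasFDerivWithinAt
  rw [gradientWithin, InnerProductSpace.toDual_symm_apply, ← neg_sub y x, map_neg]
  linarith

/-- The exceptional null set does not depend on `x` or `u`, so the bound can be used at random
iterates and directions. -/
theorem ae_abs_sub_le (h : IsSmoothObjective K P F Lf Lm σ) (hμ : 0 ≤ μ) (i : Fin n) :
    ∀ᵐ z ∂(P i), ∀ x ∈ K, ∀ u : UnitSphere d, x + μ • (u : Vec d) ∈ K →
      |F i (x + μ • (u : Vec d)) z - F i x z| ≤ Lf * μ := by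
  filter_upwards [h.lipschitz i] with z hz x hx u hu
  have := hz _ hu x hx
  rwa [add_sub_cancel_left, norm_smul, norm_eq_of_mem_sphere, mul_one,
    Real.norm_of_nonneg hμ] at this

theorem integrable_inner_gradEst (h : IsSmoothObjective K P F Lf Lm σ) (hd : 1 ≤ d) (hμ : 0 < μ)
    (i : Fin n) {x : Vec d} (hx : x ∈ K) (hxu : ∀ u : UnitSphere d, x + μ • (u : Vec d) ∈ K)
    (v : Vec d) :
    Integrable (fun p : Ξ i × UnitSphere d => inner ℝ (gradEst μ (F i) x p.2 p.1) v)
      ((P i).prod (uniformSphere d)) := by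
  have := h.prob i
  have := isProbabilityMeasure_uniformSphere hd
  refine Integrable.of_bound (C := d * Lf * ‖v‖) ?_ ?_
  · have h1 : Measurable fun p : Ξ i × UnitSphere d => gradEst μ (F i) x p.2 p.1 :=
      (measurable_gradEst (h.meas i)).comp (by fun_prop : Measurable
        fun p : Ξ i × UnitSphere d => (x, p.1, p.2))
    exact (h1.inner measurable_const).aestronglyMeasurable
  · have h2 := Measure.quasiMeasurePreserving_fst (μ := P i) (ν := uniformSphere d) |>.ae
      (h.ae_abs_sub_le hμ.le i)
    filter_upwards [h2] with p hp
    refine (norm_inner_le_norm _ _).trans ?_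
    gcongr
    exact norm_gradEst_le hμ (hp x hx p.2 (hxu p.2))

/-- The gradient estimator is nearly unbiased, in the form in which it is used with convexity. -/
theorem localLoss_sub_le_integral_inner_gradEst (h : IsSmoothObjective K P F Lf Lm σ)
    (hLm : 0 ≤ Lm) (hK : IsConstraintSet K Rl Ru) (hd : 1 ≤ d) (hμ : 0 < μ) (i : Fin n)
    {x y : Vec d} (hx : x ∈ K) (hxu : ∀ u : UnitSphere d, x + μ • (u : Vec d) ∈ K) (hy : y ∈ K) :
    localLoss P F i x - localLoss P F i y - 2 * d * Lm * Ru * μ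
      ≤ ∫ p : Ξ i × UnitSphere d, inner ℝ (gradEst μ (F i) x p.2 p.1) (x - y)
          ∂((P i).prod (uniformSphere d)) := by
  have := h.prob i
  have := isProbabilityMeasure_uniformSphere hd
  set g := gradientWithin (localLoss P F i) K x with hg
  have hint := h.integrable_inner_gradEst hd hμ i hx hxu (x - y)
  -- Averaging over the sample first replaces `F i` by the local loss, leaving only the average over
  -- directions.
  have hinner (u : UnitSphere d) : ∫ z, inner ℝ (gradEst μ (F i) x u z) (x - y) ∂(P i)
      = (d : ℝ) / μ * (localLoss P F i (x + μ • (u : Vec d)) - localLoss P F i x)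
        * inner ℝ (u : Vec d) (x - y) := by
    simp only [inner_gradEst]
    rw [integral_mul_const, integral_const_mul,
      integral_sub (h.integrable i _ (hxu u)) (h.integrable i x hx)]
    rfl
  have hint' := hint.integral_prod_right
  rw [integral_prod_symm _ hint]
  simp only [hinner] at hint' ⊢
  have hmom := integral_inner_mul_inner_uniformSphere hd g (x - y)
  have hint2 := integrable_inner_mul_inner_uniformSphere hd g (x - y)
  -- The loss difference is replaced by its linear part `μ⟨g, u⟩`; the error is at most `(d/μ) · Lm
  -- μ² · 2Ru = 2 d Lm Ru μ`. The linear part is then evaluated by the second moments of the sphere.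
  have hlow : ∫ u : UnitSphere d, ((d : ℝ) * (inner ℝ g (u : Vec d) * inner ℝ (x - y) (u : Vec d))
      - 2 * d * Lm * Ru * μ) ∂uniformSphere d
      ≤ ∫ u : UnitSphere d, (d : ℝ) / μ
        * (localLoss P F i (x + μ • (u : Vec d)) - localLoss P F i x)
        * inner ℝ (u : Vec d) (x - y) ∂uniformSphere d := by
    refine integral_mono ((hint2.const_mul _).sub (integrable_const _)) hint' fun u => ?_
    have hu : ‖(u : Vec d)‖ = 1 := by simp
    have ht := h.abs_taylor_le hLm hK.convex i hx (hxu u)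
    rw [add_sub_cancel_left, norm_smul, hu, mul_one, Real.norm_of_nonneg hμ.le,
      real_inner_smul_right, ← hg] at ht
    have hi : |inner ℝ (u : Vec d) (x - y)| ≤ 2 * Ru := by
      refine (abs_real_inner_le_norm _ _).trans ?_
      rw [hu, one_mul]
      exact hK.norm_sub_le hx hy
    set D := localLoss P F i (x + μ • (u : Vec d)) - localLoss P F i x with hD
    have hprod : |(D - μ * inner ℝ g (u : Vec d)) * inner ℝ (u : Vec d) (x - y)|
        ≤ Lm * μ ^ 2 * (2 * Ru) := by
      rw [abs_mul]
      gcongr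
    have h3 := (abs_le.1 hprod).1
    have h4 : (d : ℝ) / μ * (-(Lm * μ ^ 2 * (2 * Ru)))
        ≤ (d : ℝ) / μ * ((D - μ * inner ℝ g (u : Vec d)) * inner ℝ (u : Vec d) (x - y)) := by
      gcongr
    have e1 : (d : ℝ) / μ * (-(Lm * μ ^ 2 * (2 * Ru))) = - (2 * d * Lm * Ru * μ) := by
      field_simp
    have e2 : (d : ℝ) / μ * ((D - μ * inner ℝ g (u : Vec d)) * inner ℝ (u : Vec d) (x - y))
        = d / μ * D * inner ℝ (u : Vec d) (x - y)
          - d * (inner ℝ g (u : Vec d) * inner ℝ (x - y) (u : Vec d)) := by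
      rw [real_inner_comm (x - y) (u : Vec d)]
      field_simp
    rw [e1, e2] at h4
    simp only
    linarith
  rw [integral_sub (hint2.const_mul _) (integrable_const _), integral_const_mul, hmom] at hlow
  have hconv := h.localLoss_sub_le_inner hK.convex i hx hy
  rw [← hg] at hconv
  simp only [integral_const, probReal_univ, one_smul] at hlow
  linarith

end IsSmoothObjective

end Objective

/-! ### Compression -/

section Compression

variable {d : ℕ} {S : Type*} [MeasurableSpace S] {ν : Measure S} {Q : Vec d → S → Vec d}
  {r ω ψ : ℝ}

/-- `v - ψq` is the combination of `v` and `-(q/r - v)` with weights `1 - ψr` and `ψr`; the squared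
norm is convex. -/
theorem norm_sub_smul_sq_le (v q : Vec d) (hr : 0 < r) (hψ : 0 ≤ ψ) (hψr : ψ * r ≤ 1) :
    ‖v - ψ • q‖ ^ 2 ≤ (1 - ψ * r) * ‖v‖ ^ 2 + ψ * r * ‖(1 / r) • q - v‖ ^ 2 := by
  have e : v - ψ • q = (1 - ψ * r) • v - (ψ * r) • ((1 / r) • q - v) := by
    rw [smul_sub, smul_smul, show ψ * r * (1 / r) = ψ by field_simp]
    module
  have h0 : 0 ≤ ψ * r := by positivity
  have h1 : ‖v - ψ • q‖ ≤ (1 - ψ * r) * ‖v‖ + ψ * r * ‖(1 / r) • q - v‖ := by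
    rw [e]
    refine (norm_sub_le _ _).trans ?_
    rw [norm_smul, norm_smul, Real.norm_of_nonneg (by linarith : 0 ≤ 1 - ψ * r),
      Real.norm_of_nonneg h0]
  refine (pow_le_pow_left₀ (norm_nonneg _) h1 2).trans ?_
  nlinarith [mul_nonneg (mul_nonneg h0 (by linarith : 0 ≤ 1 - ψ * r))
    (sq_nonneg (‖v‖ - ‖(1 / r) • q - v‖))]

theorem enorm_sq_eq_ofReal (v : Vec d) : ‖v‖ₑ ^ 2 = ENNReal.ofReal (‖v‖ ^ 2) := by
  rw [← ofReal_norm, ENNReal.ofReal_pow (norm_nonneg _)]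

/-- Averaging the convexity bound gives the factor `(1 - ψr) + ψr(1 - ω) = 1 - ψrω`. The lower
integral is used so that integrability of the output need not be known beforehand. -/
theorem IsCompressor.lintegral_le (h : IsCompressor ν Q r ω) (hψ : 0 ≤ ψ) (hψr : ψ * r ≤ 1)
    (v : Vec d) :
    ∫⁻ s, ENNReal.ofReal (‖v - ψ • Q v s‖ ^ 2) ∂ν
      ≤ ENNReal.ofReal ((1 - ψ * r * ω) * ‖v‖ ^ 2) := by
  have := h.prob
  have hr : 0 < r := one_pos.trans_le h.one_le
  have h0 : 0 ≤ ψ * r := by positivity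
  have hm : Measurable fun s => ENNReal.ofReal (‖(1 / r) • Q v s - v‖ ^ 2) := by
    have : Measurable (Q v) := h.meas.comp measurable_prodMk_left
    fun_prop
  calc ∫⁻ s, ENNReal.ofReal (‖v - ψ • Q v s‖ ^ 2) ∂ν
      ≤ ∫⁻ s, (ENNReal.ofReal ((1 - ψ * r) * ‖v‖ ^ 2)
          + ENNReal.ofReal (ψ * r) * ENNReal.ofReal (‖(1 / r) • Q v s - v‖ ^ 2)) ∂ν := by
        refine lintegral_mono fun s => ?_
        rw [← ENNReal.ofReal_mul h0, ← ENNReal.ofReal_add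
          (mul_nonneg (by linarith) (by positivity)) (by positivity)]
        exact ENNReal.ofReal_le_ofReal (norm_sub_smul_sq_le v _ hr hψ hψr)
    _ = ENNReal.ofReal ((1 - ψ * r) * ‖v‖ ^ 2)
          + ENNReal.ofReal (ψ * r) * ∫⁻ s, ENNReal.ofReal (‖(1 / r) • Q v s - v‖ ^ 2) ∂ν := by
        rw [lintegral_add_left measurable_const, lintegral_const_mul _ hm]
        simp
    _ ≤ ENNReal.ofReal ((1 - ψ * r) * ‖v‖ ^ 2)
          + ENNReal.ofReal (ψ * r) * ENNReal.ofReal ((1 - ω) * ‖v‖ ^ 2) := by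
        gcongr
        simpa only [enorm_sq_eq_ofReal] using h.error v
    _ = ENNReal.ofReal ((1 - ψ * r * ω) * ‖v‖ ^ 2) := by
        have hω : 0 ≤ 1 - ω := by linarith [h.level_le]
        rw [← ENNReal.ofReal_mul h0, ← ENNReal.ofReal_add
          (mul_nonneg (by linarith) (by positivity)) (by positivity)]
        congr 1; ring

/-- The mean square error contraction of a compressor applied to an independent vector. -/
theorem IsCompressor.integral_le (h : IsCompressor ν Q r ω) (hψ : 0 ≤ ψ) (hψr : ψ * r ≤ 1)
    {A : Type*} [MeasurableSpace A] {Pr : Measure A} [IsProbabilityMeasure Pr]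
    {Y : A → Vec d} {s : A → S} (hY : Measurable Y) (hs : Measurable s)
    (hlaw : Pr.map (fun a => (Y a, s a)) = (Pr.map Y).prod ν)
    (hint : Integrable (fun a => ‖Y a‖ ^ 2) Pr) :
    Integrable (fun a => ‖Y a - ψ • Q (Y a) (s a)‖ ^ 2) Pr ∧
      ∫ a, ‖Y a - ψ • Q (Y a) (s a)‖ ^ 2 ∂Pr ≤ (1 - ψ * r * ω) * ∫ a, ‖Y a‖ ^ 2 ∂Pr := by
  have := h.prob
  have := Measure.isProbabilityMeasure_map (μ := Pr) hY.aemeasurable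
  have h0 : 0 ≤ ψ * r := mul_nonneg hψ (zero_le_one.trans h.one_le)
  have hfac : 0 ≤ 1 - ψ * r * ω := by
    have := mul_le_mul hψr h.level_le h.level_pos.le zero_le_one
    linarith
  have hmQ : Measurable fun p : Vec d × S => Q p.1 p.2 := h.meas
  have hmφ : Measurable fun p : Vec d × S => ENNReal.ofReal (‖p.1 - ψ • Q p.1 p.2‖ ^ 2) := by
    fun_prop
  -- The joint law is a product, so the compressor bound applies with the vector frozen; finiteness
  -- of this lower integral then yields integrability.
  have hle : ∫⁻ a, ENNReal.ofReal (‖Y a - ψ • Q (Y a) (s a)‖ ^ 2) ∂Pr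
      ≤ ENNReal.ofReal ((1 - ψ * r * ω) * ∫ a, ‖Y a‖ ^ 2 ∂Pr) := by
    calc ∫⁻ a, ENNReal.ofReal (‖Y a - ψ • Q (Y a) (s a)‖ ^ 2) ∂Pr
        = ∫⁻ p, ENNReal.ofReal (‖p.1 - ψ • Q p.1 p.2‖ ^ 2) ∂(Pr.map fun a => (Y a, s a)) :=
          (lintegral_map hmφ (hY.prodMk hs)).symm
      _ = ∫⁻ v, ∫⁻ s, ENNReal.ofReal (‖v - ψ • Q v s‖ ^ 2) ∂ν ∂(Pr.map Y) := by
          rw [hlaw, lintegral_prod _ hmφ.aemeasurable]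
      _ ≤ ∫⁻ v, ENNReal.ofReal ((1 - ψ * r * ω) * ‖v‖ ^ 2) ∂(Pr.map Y) :=
          lintegral_mono fun v => h.lintegral_le hψ hψr v
      _ = ∫⁻ a, ENNReal.ofReal ((1 - ψ * r * ω) * ‖Y a‖ ^ 2) ∂Pr :=
          lintegral_map (by fun_prop) hY
      _ = ENNReal.ofReal ((1 - ψ * r * ω) * ∫ a, ‖Y a‖ ^ 2 ∂Pr) := by
          rw [← integral_const_mul, ofReal_integral_eq_lintegral_ofReal (hint.const_mul _)]
          exact ae_of_all _ fun a => by positivity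
  have hm : AEStronglyMeasurable (fun a => ‖Y a - ψ • Q (Y a) (s a)‖ ^ 2) Pr := by
    have : Measurable fun a => Q (Y a) (s a) := hmQ.comp (hY.prodMk hs)
    exact Measurable.aestronglyMeasurable (by fun_prop)
  have hI : Integrable (fun a => ‖Y a - ψ • Q (Y a) (s a)‖ ^ 2) Pr := by
    refine ⟨hm, ?_⟩
    rw [hasFiniteIntegral_iff_ofReal (ae_of_all _ fun a => by positivity)]
    exact hle.trans_lt ENNReal.ofReal_lt_top
  refine ⟨hI, ?_⟩
  rw [← ofReal_integral_eq_lintegral_ofReal hI (ae_of_all _ fun a => by positivity)] at hle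
  exact (ENNReal.ofReal_le_ofReal_iff
    (mul_nonneg hfac (integral_nonneg fun a => by positivity))).1 hle

end Compression

/-! ### Measurability and independence along the run -/

section Sampling

variable {d n : ℕ} {Ξ : Fin n → Type*} [∀ i, MeasurableSpace (Ξ i)] {S : Type*} [MeasurableSpace S]
  {K : Set (Vec d)} {W : Matrix (Fin n) (Fin n) ℝ} {F : ∀ i, Vec d → Ξ i → ℝ}
  {Q : Vec d → S → Vec d} {μ ε ψ γ : ℝ} {η : ℕ → ℝ} {x₀ : Fin n → Vec d}

/-- Measurability of a random state. -/
structure State.IsMeasurable {A : Type*} [MeasurableSpace A] (st : A → State d n) : Prop where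
  x : ∀ i, Measurable fun a => (st a).x i
  xhat : ∀ i, Measurable fun a => (st a).xhat i
  b : ∀ i, Measurable fun a => (st a).b i

theorem State.isMeasurable_step {A : Type*} [MeasurableSpace A] {st : A → State d n}
    (h : State.IsMeasurable st) (hK : Measurable (proj (shrink ε K)))
    (hF : ∀ i, Measurable (Function.uncurry (F i))) (hQ : Measurable (Function.uncurry Q))
    {t : ℝ} {ξ : ∀ i, A → Ξ i} {u : Fin n → A → UnitSphere d} {s : Fin n → A → S}
    (hξ : ∀ i, Measurable (ξ i)) (hu : ∀ i, Measurable (u i)) (hs : ∀ i, Measurable (s i)) :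
    State.IsMeasurable fun a => step K W F Q μ ε ψ γ t (st a)
      (fun i => ξ i a) (fun i => u i a) (fun i => s i a) := by
  have hx := h.x
  have hxh := h.xhat
  have hb := h.b
  have hq (i : Fin n) : Measurable fun a => Q ((st a).x i - (st a).xhat i) (s i a) :=
    hQ.comp (((hx i).sub (hxh i)).prodMk (hs i))
  have hb' (i : Fin n) : Measurable fun a => (st a).b i
      + ψ • (Q ((st a).x i - (st a).xhat i) (s i a)
        - ∑ j, W i j • Q ((st a).x j - (st a).xhat j) (s j a)) := by
    have h1 : Measurable fun a => ∑ j, W i j • Q ((st a).x j - (st a).xhat j) (s j a) :=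
      Finset.measurable_fun_sum _ fun j _ => (hq j).fun_const_smul _
    exact (hb i).add (((hq i).sub h1).fun_const_smul _)
  have hg (i : Fin n) : Measurable fun a => gradEst μ (F i) ((st a).x i) (u i a) (ξ i a) :=
    (hF i).gradEst (hx i) (hu i) (hξ i)
  have hz {X B G : A → Vec d} (hX : Measurable X) (hB : Measurable B) (hG : Measurable G) :
      Measurable fun a => proj (shrink ε K) (X a - γ • B a - t • G a) :=
    hK.comp (by fun_prop)
  refine ⟨fun i => ?_, fun i => ?_, fun i => ?_⟩
  · exact hz (hx i) (hb' i) (hg i)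
  · exact (hxh i).add ((hq i).fun_const_smul _)
  · exact hb' i

theorem State.IsMeasurable.mono {A : Type*} {m m' : MeasurableSpace A} (hle : m ≤ m')
    {st : A → State d n} (h : @State.IsMeasurable d n A m st) : @State.IsMeasurable d n A m' st :=
  @State.IsMeasurable.mk d n A m' st
    (fun i => (@State.IsMeasurable.x d n A m st h i).mono hle le_rfl)
    (fun i => (@State.IsMeasurable.xhat d n A m st h i).mono hle le_rfl)
    (fun i => (@State.IsMeasurable.b d n A m st h i).mono hle le_rfl)

variable {A : Type*} {ξ : ∀ i, ℕ → A → Ξ i} {u : Fin n → ℕ → A → UnitSphere d}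
  {s : Fin n → ℕ → A → S}

/-- The σ-algebra generated by the draws of the iterations before `k`. -/
@[reducible] def pastDraws (ξ : ∀ i, ℕ → A → Ξ i) (u : Fin n → ℕ → A → UnitSphere d) (s : Fin n → ℕ → A → S)
    (k : ℕ) : MeasurableSpace A :=
  ⨆ p ∈ {p : Fin n × ℕ | p.2 < k}, MeasurableSpace.comap
    (fun a => (ξ p.1 p.2 a, u p.1 p.2 a, s p.1 p.2 a)) inferInstance

theorem pastDraws_mono {k l : ℕ} (h : k ≤ l) : pastDraws ξ u s k ≤ pastDraws ξ u s l :=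
  biSup_mono fun _ hp => lt_of_lt_of_le hp h

theorem measurable_draw_pastDraws (i : Fin n) (k : ℕ) :
    Measurable[pastDraws ξ u s (k + 1)] fun a => (ξ i k a, u i k a, s i k a) := by
  rw [measurable_iff_comap_le]
  exact le_biSup (fun p : Fin n × ℕ => MeasurableSpace.comap
    (fun a => (ξ p.1 p.2 a, u p.1 p.2 a, s p.1 p.2 a)) inferInstance)
    (show ((i, k) : Fin n × ℕ) ∈ {p : Fin n × ℕ | p.2 < k + 1} from Nat.lt_succ_self k)

/-- The state before iteration `k` is a function of the earlier draws only, which is what makes it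
independent of the draws of iteration `k`. -/
theorem State.isMeasurable_run (hK : Measurable (proj (shrink ε K)))
    (hF : ∀ i, Measurable (Function.uncurry (F i))) (hQ : Measurable (Function.uncurry Q)) (k : ℕ) :
    @State.IsMeasurable d n A (pastDraws ξ u s k) fun a => run K W F Q μ ε ψ γ η x₀
      (fun i k => ξ i k a) (fun i k => u i k a) (fun i k => s i k a) k := by
  induction k with
  | zero =>
    exact @State.IsMeasurable.mk d n A (pastDraws ξ u s 0) _ (fun i => measurable_const)
      (fun i => measurable_const) (fun i => measurable_const)
  | succ k ih =>
    have ih' := ih.mono (pastDraws_mono (ξ := ξ) (u := u) (s := s) (Nat.le_succ k))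
    have hdraw (i : Fin n) := measurable_draw_pastDraws (ξ := ξ) (u := u) (s := s) i k
    exact @State.isMeasurable_step d n Ξ _ S _ K W F Q μ ε ψ γ A (pastDraws ξ u s (k + 1)) _
      ih' hK hF hQ (η k) (fun i => ξ i k) (fun i => u i k) (fun i => s i k)
      (fun i => (hdraw i).fst) (fun i => (hdraw i).snd.fst) (fun i => (hdraw i).snd.snd)

variable [mA : MeasurableSpace A] {Pr : Measure A} {P : ∀ i, Measure (Ξ i)} {ν : Measure S}

namespace IsSampling

theorem measurable_draw (h : IsSampling Pr P ν ξ u s) (i : Fin n) (k : ℕ) :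
    Measurable fun a => (ξ i k a, u i k a, s i k a) :=
  (h.meas_sample i k).prodMk ((h.meas_dir i k).prodMk (h.meas_comp i k))

theorem pastDraws_le (h : IsSampling Pr P ν ξ u s) (k : ℕ) : pastDraws ξ u s k ≤ mA :=
  iSup₂_le fun p _ => (h.measurable_draw p.1 p.2).comap_le

/-- The draws of iteration `k` are independent of everything that happened before. -/
theorem map_prodMk_draw (h : IsSampling Pr P ν ξ u s) {β : Type*} [MeasurableSpace β] {Y : A → β}
    {k : ℕ} (hY : Measurable[pastDraws ξ u s k] Y) (i : Fin n) :
    Pr.map (fun a => (Y a, ξ i k a, u i k a, s i k a))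
      = (Pr.map Y).prod ((P i).prod ((uniformSphere d).prod ν)) := by
  have := h.prob
  have hind : Indep (pastDraws ξ u s k) (MeasurableSpace.comap
      (fun a => (ξ i k a, u i k a, s i k a)) inferInstance) Pr := by
    have h1 := indep_iSup_of_disjoint (fun p : Fin n × ℕ => (h.measurable_draw p.1 p.2).comap_le)
      ((iIndepFun_iff_iIndep _ _ _).1 h.indep)
      (S := {p : Fin n × ℕ | p.2 < k}) (T := {((i, k) : Fin n × ℕ)}) (by
        rw [Set.disjoint_singleton_right]
        exact lt_irrefl k)
    rw [iSup_singleton] at h1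
    exact h1
  have hfun : IndepFun Y (fun a => (ξ i k a, u i k a, s i k a)) Pr := by
    rw [IndepFun_iff_Indep]
    exact indep_of_indep_of_le_left hind hY.comap_le
  have hY' : Measurable Y := hY.mono (h.pastDraws_le k) le_rfl
  rw [(indepFun_iff_map_prod_eq_prod_map_map hY'.aemeasurable
    (h.measurable_draw i k).aemeasurable).1 hfun, h.law i k]

theorem map_prodMk_comp (h : IsSampling Pr P ν ξ u s) [∀ i, IsProbabilityMeasure (P i)]
    [IsProbabilityMeasure ν] (hd : 1 ≤ d) {β : Type*} [MeasurableSpace β] {Y : A → β}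
    {k : ℕ} (hY : Measurable[pastDraws ξ u s k] Y) (i : Fin n) :
    Pr.map (fun a => (Y a, s i k a)) = (Pr.map Y).prod ν := by
  have := h.prob
  have := isProbabilityMeasure_uniformSphere hd
  have hY' : Measurable Y := hY.mono (h.pastDraws_le k) le_rfl
  have := Measure.isProbabilityMeasure_map (μ := Pr) hY'.aemeasurable
  have h1 := congrArg (Measure.map (Prod.map (id : β → β)
    (fun q : Ξ i × UnitSphere d × S => q.2.2))) (h.map_prodMk_draw hY i)
  rw [Measure.map_map (by fun_prop) (hY'.prodMk (h.measurable_draw i k)),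
    ← Measure.map_prod_map _ _ measurable_id (by fun_prop), Measure.map_id] at h1
  have h2 : ((P i).prod ((uniformSphere d).prod ν)).map
      (fun q : Ξ i × UnitSphere d × S => q.2.2) = ν := by
    have : (fun q : Ξ i × UnitSphere d × S => q.2.2) = Prod.snd ∘ Prod.snd := rfl
    rw [this, ← Measure.map_map measurable_snd measurable_snd]
    simp
  rw [h2] at h1
  exact h1

theorem map_prodMk_sample (h : IsSampling Pr P ν ξ u s) [∀ i, IsProbabilityMeasure (P i)]
    [IsProbabilityMeasure ν] (hd : 1 ≤ d) {β : Type*} [MeasurableSpace β] {Y : A → β}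
    {k : ℕ} (hY : Measurable[pastDraws ξ u s k] Y) (i : Fin n) :
    Pr.map (fun a => (Y a, ξ i k a, u i k a))
      = (Pr.map Y).prod ((P i).prod (uniformSphere d)) := by
  have := h.prob
  have := isProbabilityMeasure_uniformSphere hd
  have hY' : Measurable Y := hY.mono (h.pastDraws_le k) le_rfl
  have := Measure.isProbabilityMeasure_map (μ := Pr) hY'.aemeasurable
  have h1 := congrArg (Measure.map (Prod.map (id : β → β)
    (Prod.map (id : Ξ i → Ξ i) (Prod.fst : UnitSphere d × S → UnitSphere d))))
    (h.map_prodMk_draw hY i)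
  rw [Measure.map_map (by fun_prop) (hY'.prodMk (h.measurable_draw i k)),
    ← Measure.map_prod_map _ _ measurable_id (by fun_prop),
    ← Measure.map_prod_map _ _ measurable_id measurable_fst, Measure.map_id, Measure.map_id] at h1
  simpa [Function.comp_def] using h1

theorem map_sample (h : IsSampling Pr P ν ξ u s) [∀ i, IsProbabilityMeasure (P i)]
    [IsProbabilityMeasure ν] (hd : 1 ≤ d) (i : Fin n) (k : ℕ) : Pr.map (ξ i k) = P i := by
  have := isProbabilityMeasure_uniformSphere hd
  have h1 := congrArg (Measure.map Prod.fst) (h.law i k)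
  rw [Measure.map_map measurable_fst (h.measurable_draw i k)] at h1
  simpa [Function.comp_def] using h1

/-- The expected first order progress of the estimator, along iterates inside the constraint set. -/
theorem integral_localLoss_sub_le {Lf Lm σ Rl Ru : ℝ} (h : IsSampling Pr P ν ξ u s)
    [IsProbabilityMeasure ν] (hF : IsSmoothObjective K P F Lf Lm σ) (hLf : 0 ≤ Lf) (hLm : 0 ≤ Lm)
    (hK : IsConstraintSet K Rl Ru) (hd : 1 ≤ d) (hμ : 0 < μ) {Y : A → Vec d} {k : ℕ}
    (hY : Measurable[pastDraws ξ u s k] Y) (hYK : ∀ a, Y a ∈ K)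
    (hYu : ∀ a, ∀ w : UnitSphere d, Y a + μ • (w : Vec d) ∈ K) (i : Fin n) {y : Vec d}
    (hy : y ∈ K) :
    Integrable (fun a => localLoss P F i (Y a)) Pr ∧
    Integrable (fun a => inner ℝ (gradEst μ (F i) (Y a) (u i k a) (ξ i k a)) (Y a - y)) Pr ∧
    ∫ a, localLoss P F i (Y a) ∂Pr - localLoss P F i y - 2 * d * Lm * Ru * μ
      ≤ ∫ a, inner ℝ (gradEst μ (F i) (Y a) (u i k a) (ξ i k a)) (Y a - y) ∂Pr := by
  have := h.prob
  have := hF.prob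
  have := isProbabilityMeasure_uniformSphere hd
  have hY' : Measurable Y := hY.mono (h.pastDraws_le k) le_rfl
  have := Measure.isProbabilityMeasure_map (μ := Pr) hY'.aemeasurable
  have hlaw := h.map_prodMk_sample hd hY i
  have hmp : Measurable fun a => (Y a, ξ i k a, u i k a) :=
    hY'.prodMk ((h.meas_sample i k).prodMk (h.meas_dir i k))
  have hI1 : Integrable (fun a => localLoss P F i (Y a)) Pr := by
    refine Integrable.of_bound (C := Lf * (2 * Ru) + |localLoss P F i y|)
      ((hF.measurable_localLoss i).comp hY').aestronglyMeasurable (ae_of_all _ fun a => ?_)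
    have h1 := hF.abs_localLoss_sub_le i (hYK a) hy
    have h2 : Lf * ‖Y a - y‖ ≤ Lf * (2 * Ru) := by
      gcongr; exact hK.norm_sub_le (hYK a) hy
    have h3 := abs_add_le (localLoss P F i (Y a) - localLoss P F i y) (localLoss P F i y)
    rw [sub_add_cancel] at h3
    rw [Real.norm_eq_abs]
    linarith
  have hmg : Measurable fun p : Vec d × Ξ i × UnitSphere d =>
      inner ℝ (gradEst μ (F i) p.1 p.2.2 p.2.1) (p.1 - y) :=
    (measurable_gradEst (hF.meas i)).inner (measurable_fst.sub measurable_const)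
  have hI2 : Integrable (fun a => inner ℝ (gradEst μ (F i) (Y a) (u i k a) (ξ i k a)) (Y a - y))
      Pr := by
    refine Integrable.of_bound (C := d * Lf * (2 * Ru)) (hmg.comp hmp).aestronglyMeasurable ?_
    -- The almost sure bound for `P i` is transported to the draw `ξ i k`, whose law is `P i`.
    have h2 := hF.ae_abs_sub_le hμ.le i
    rw [← h.map_sample hd i k] at h2
    filter_upwards [ae_of_ae_map (h.meas_sample i k).aemeasurable h2] with a ha
    refine (norm_inner_le_norm _ _).trans ?_
    gcongr
    · exact norm_gradEst_le hμ (ha _ (hYK a) _ (hYu a _))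
    · exact hK.norm_sub_le (hYK a) hy
  refine ⟨hI1, hI2, ?_⟩
  have hI3 : Integrable (fun p : Vec d × Ξ i × UnitSphere d =>
      inner ℝ (gradEst μ (F i) p.1 p.2.2 p.2.1) (p.1 - y))
      ((Pr.map Y).prod ((P i).prod (uniformSphere d))) := by
    rw [← hlaw, integrable_map_measure hmg.aestronglyMeasurable hmp.aemeasurable]
    exact hI2
  -- Conditioning on the past: the joint law of `Y` and the draw is a product, so the draw can be
  -- integrated with the iterate held fixed.
  have e1 : ∫ a, inner ℝ (gradEst μ (F i) (Y a) (u i k a) (ξ i k a)) (Y a - y) ∂Pr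
      = ∫ a, ∫ p : Ξ i × UnitSphere d, inner ℝ (gradEst μ (F i) (Y a) p.2 p.1) (Y a - y)
          ∂((P i).prod (uniformSphere d)) ∂Pr := by
    have h4 := integral_map hmp.aemeasurable hmg.aestronglyMeasurable (μ := Pr)
    rw [hlaw, integral_prod _ hI3] at h4
    rw [← h4, integral_map hY'.aemeasurable hI3.integral_prod_left.aestronglyMeasurable]
  rw [e1]
  have hI4 : Integrable (fun a => ∫ p : Ξ i × UnitSphere d,
      inner ℝ (gradEst μ (F i) (Y a) p.2 p.1) (Y a - y) ∂((P i).prod (uniformSphere d))) Pr := by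
    have := hI3.integral_prod_left
    rwa [integrable_map_measure this.aestronglyMeasurable hY'.aemeasurable] at this
  have e2 : ∫ a, localLoss P F i (Y a) ∂Pr - localLoss P F i y - 2 * d * Lm * Ru * μ
      = ∫ a, (localLoss P F i (Y a) - localLoss P F i y - 2 * d * Lm * Ru * μ) ∂Pr := by
    simp only [sub_sub]
    rw [integral_sub hI1 (integrable_const _)]
    simp
  rw [e2]
  refine integral_mono ((hI1.sub (integrable_const _)).sub (integrable_const _)) hI4 fun a => ?_
  exact hF.localLoss_sub_le_integral_inner_gradEst hLm hK hd hμ i (hYK a) (hYu a) hy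

end IsSampling

end Sampling

/-! ### One step inequalities -/

/-- Young's inequality for the square of a sum. -/
theorem norm_add_sq_le_young {E : Type*} [NormedAddCommGroup E] (a b : E)
    {t : ℝ} (ht : 0 < t) : ‖a + b‖ ^ 2 ≤ (1 + t) * ‖a‖ ^ 2 + (1 + t⁻¹) * ‖b‖ ^ 2 := by
  have h1 : ‖a + b‖ ^ 2 ≤ (‖a‖ + ‖b‖) ^ 2 := by
    gcongr; exact norm_add_le a b
  have h2 : 0 ≤ t⁻¹ * (t * ‖a‖ - ‖b‖) ^ 2 := by positivity
  have h3 : t⁻¹ * (t * ‖a‖ - ‖b‖) ^ 2 = t * ‖a‖ ^ 2 - 2 * (‖a‖ * ‖b‖) + t⁻¹ * ‖b‖ ^ 2 := by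
    field_simp; ring
  nlinarith

theorem sum_norm_add_sq_le_young {ι E : Type*} [Fintype ι] [NormedAddCommGroup E] (a b : ι → E)
    {t : ℝ} (ht : 0 < t) :
    ∑ i, ‖a i + b i‖ ^ 2 ≤ (1 + t) * ∑ i, ‖a i‖ ^ 2 + (1 + t⁻¹) * ∑ i, ‖b i‖ ^ 2 := by
  rw [Finset.mul_sum, Finset.mul_sum, ← Finset.sum_add_distrib]
  exact Finset.sum_le_sum fun i _ => norm_add_sq_le_young _ _ ht

theorem sum_norm_add_sq_le_two {ι E : Type*} [Fintype ι] [NormedAddCommGroup E] (a b : ι → E) :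
    ∑ i, ‖a i + b i‖ ^ 2 ≤ 2 * ∑ i, ‖a i‖ ^ 2 + 2 * ∑ i, ‖b i‖ ^ 2 := by
  have := sum_norm_add_sq_le_young a b one_pos
  norm_num at this
  exact this

theorem sum_norm_smul_sq {ι E : Type*} [Fintype ι] [NormedAddCommGroup E] [NormedSpace ℝ E]
    (t : ℝ) (a : ι → E) : ∑ i, ‖t • a i‖ ^ 2 = t ^ 2 * ∑ i, ‖a i‖ ^ 2 := by
  simp only [norm_smul, mul_pow, Finset.mul_sum, Real.norm_eq_abs, sq_abs]

section OneStep

variable {n d : ℕ} {G : SimpleGraph (Fin n)} {W : Matrix (Fin n) (Fin n) ℝ} {D : Set (Vec d)}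
  {γ η : ℝ} {X Xh g X' : Fin n → Vec d}

theorem IsNetwork.sum_norm_sq_act_one_sub_le (h : IsNetwork G W) (Y : Fin n → Vec d) :
    ∑ i, ‖act (1 - W) Y i‖ ^ 2 ≤ disagreementNorm W ^ 2 * ∑ i, ‖dev Y i‖ ^ 2 := by
  rw [← h.act_one_sub_dev]
  exact sum_norm_sq_act_le _ _

/-- The contraction of the consensus error. -/
theorem consensus_step (h : IsNetwork G W) (hn : 1 ≤ n) (hne : D.Nonempty) (hc : IsClosed D)
    (hconv : Convex ℝ D) (hγ0 : 0 < γ) (hγ1 : γ ≤ 1)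
    (hX' : ∀ i, X' i = proj D (X i - γ • act (1 - W) Xh i - η • g i)) {t : ℝ} (ht : 0 < t) :
    ∑ i, ‖dev X' i‖ ^ 2
      ≤ (1 + t) * (1 + t) * (1 - γ * spectralGap W) ^ 2 * ∑ i, ‖dev X i‖ ^ 2
        + (1 + t⁻¹) * (γ ^ 2 * disagreementNorm W ^ 2) * ∑ i, ‖X i - Xh i‖ ^ 2
        + (1 + t) * (1 + t⁻¹) * (η ^ 2 * ∑ i, ‖g i‖ ^ 2) := by
  set Z : Fin n → Vec d := X - γ • act (1 - W) Xh - η • g with hZ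
  have hnon : ∑ i, ‖dev X' i‖ ^ 2 ≤ ∑ i, ‖dev Z i‖ ^ 2 := by
    refine sum_norm_sq_dev_le_of_nonexpansive hn fun i j => ?_
    rw [hX' i, hX' j]
    exact norm_proj_sub_proj_le hne hc hconv _ _
  -- Writing `Xh = X - (X - Xh)` separates exact mixing of `X`, the gradient noise and the
  -- compression error.
  have hdev (i : Fin n) : dev Z i = ((dev X i - γ • act (1 - W) X i) + (-η) • dev g i)
      + γ • act (1 - W) (X - Xh) i := by
    have e1 : dev Z = dev X - γ • act (1 - W) Xh - η • dev g := by
      rw [hZ, dev, act_sub, act_sub, act_smul, act_smul]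
      change dev X - γ • dev (act (1 - W) Xh) - η • dev g = _
      rw [h.dev_act_one_sub]
    rw [e1, act_sub]
    simp only [Pi.sub_apply, Pi.smul_apply]
    module
  have hg : ∑ i, ‖dev g i‖ ^ 2 ≤ ∑ i, ‖g i‖ ^ 2 := by
    simpa using sum_norm_sq_dev_le hn g 0
  have hXX : ∑ i, ‖act (1 - W) (X - Xh) i‖ ^ 2
      ≤ disagreementNorm W ^ 2 * ∑ i, ‖X i - Xh i‖ ^ 2 := sum_norm_sq_act_le _ _
  have hmix := h.sum_norm_sq_mixing_le hγ0.le hγ1 hn X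
  calc ∑ i, ‖dev X' i‖ ^ 2 ≤ ∑ i, ‖dev Z i‖ ^ 2 := hnon
    _ ≤ (1 + t) * ∑ i, ‖(dev X i - γ • act (1 - W) X i) + (-η) • dev g i‖ ^ 2
        + (1 + t⁻¹) * ∑ i, ‖γ • act (1 - W) (X - Xh) i‖ ^ 2 := by
      simp only [hdev]
      exact sum_norm_add_sq_le_young _ _ ht
    _ ≤ (1 + t) * ((1 + t) * ∑ i, ‖dev X i - γ • act (1 - W) X i‖ ^ 2
          + (1 + t⁻¹) * ∑ i, ‖(-η) • dev g i‖ ^ 2)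
        + (1 + t⁻¹) * ∑ i, ‖γ • act (1 - W) (X - Xh) i‖ ^ 2 := by
      gcongr
      exact sum_norm_add_sq_le_young _ _ ht
    _ ≤ (1 + t) * ((1 + t) * ((1 - γ * spectralGap W) ^ 2 * ∑ i, ‖dev X i‖ ^ 2)
          + (1 + t⁻¹) * (η ^ 2 * ∑ i, ‖g i‖ ^ 2))
        + (1 + t⁻¹) * (γ ^ 2 * (disagreementNorm W ^ 2 * ∑ i, ‖X i - Xh i‖ ^ 2)) := by
      rw [sum_norm_smul_sq, sum_norm_smul_sq, neg_sq]
      gcongr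
    _ = _ := by ring

/-- Controls the displacement before projection, again by splitting `Xh = X - (X - Xh)`. The free
`t` serves both the compression step and the descent step. -/
theorem sum_norm_sq_direction_le (h : IsNetwork G W) {t : ℝ} (ht : 0 < t) :
    ∑ i, ‖γ • act (1 - W) Xh i + η • g i‖ ^ 2
      ≤ (1 + t⁻¹) * (γ ^ 2 * disagreementNorm W ^ 2) * ∑ i, ‖X i - Xh i‖ ^ 2
        + (1 + t) * (2 * γ ^ 2 * disagreementNorm W ^ 2 * ∑ i, ‖dev X i‖ ^ 2
          + 2 * (η ^ 2 * ∑ i, ‖g i‖ ^ 2)) := by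
  have e (i : Fin n) : γ • act (1 - W) Xh i + η • g i
      = (γ • act (1 - W) X i + η • g i) + (-γ) • act (1 - W) (X - Xh) i := by
    rw [act_sub]
    simp only [Pi.sub_apply]
    module
  have h1 := h.sum_norm_sq_act_one_sub_le X
  have h2 : ∑ i, ‖act (1 - W) (X - Xh) i‖ ^ 2
      ≤ disagreementNorm W ^ 2 * ∑ i, ‖X i - Xh i‖ ^ 2 := sum_norm_sq_act_le _ _
  simp only [e]
  calc _ ≤ (1 + t) * ∑ i, ‖γ • act (1 - W) X i + η • g i‖ ^ 2
        + (1 + t⁻¹) * ∑ i, ‖(-γ) • act (1 - W) (X - Xh) i‖ ^ 2 := sum_norm_add_sq_le_young _ _ ht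
    _ ≤ (1 + t) * (2 * ∑ i, ‖γ • act (1 - W) X i‖ ^ 2 + 2 * ∑ i, ‖η • g i‖ ^ 2)
        + (1 + t⁻¹) * ∑ i, ‖(-γ) • act (1 - W) (X - Xh) i‖ ^ 2 := by
      gcongr
      exact sum_norm_add_sq_le_two _ _
    _ ≤ (1 + t) * (2 * (γ ^ 2 * (disagreementNorm W ^ 2 * ∑ i, ‖dev X i‖ ^ 2))
          + 2 * (η ^ 2 * ∑ i, ‖g i‖ ^ 2))
        + (1 + t⁻¹) * (γ ^ 2 * (disagreementNorm W ^ 2 * ∑ i, ‖X i - Xh i‖ ^ 2)) := by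
      rw [sum_norm_smul_sq, sum_norm_smul_sq, sum_norm_smul_sq, neg_sq]
      gcongr
    _ = _ := by ring

/-- The growth of the compression error caused by the motion of the iterates. -/
theorem compression_step (h : IsNetwork G W) (hne : D.Nonempty) (hc : IsClosed D)
    (hconv : Convex ℝ D) (hXD : ∀ i, X i ∈ D)
    (hX' : ∀ i, X' i = proj D (X i - γ • act (1 - W) Xh i - η • g i)) {t : ℝ} (ht : 0 < t) :
    ∑ i, ‖X' i - Xh i‖ ^ 2
      ≤ (1 + t) * ∑ i, ‖X i - Xh i‖ ^ 2
        + (1 + t⁻¹) * ((1 + t⁻¹) * (γ ^ 2 * disagreementNorm W ^ 2) * ∑ i, ‖X i - Xh i‖ ^ 2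
        + (1 + t) * (2 * γ ^ 2 * disagreementNorm W ^ 2 * ∑ i, ‖dev X i‖ ^ 2
          + 2 * (η ^ 2 * ∑ i, ‖g i‖ ^ 2))) := by
  -- As `X i` is feasible it is its own projection, so projecting cannot lengthen the displacement.
  have hmove (i : Fin n) : ‖X' i - X i‖ ^ 2 ≤ ‖γ • act (1 - W) Xh i + η • g i‖ ^ 2 := by
    gcongr
    rw [hX' i]
    refine (norm_proj_sub_le hne hc hconv _ (hXD i)).trans (le_of_eq ?_)
    rw [← norm_neg]
    congr 1; abel
  have e (i : Fin n) : X' i - Xh i = (X i - Xh i) + (X' i - X i) := by abel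
  simp only [e]
  refine (sum_norm_add_sq_le_young _ _ ht).trans ?_
  gcongr
  exact (Finset.sum_le_sum fun i _ => hmove i).trans (sum_norm_sq_direction_le h ht)

/-- The joint contraction of the consensus error and the compression error. -/
theorem lyapunov_step (h : IsNetwork G W) (hn : 1 ≤ n) (hne : D.Nonempty) (hc : IsClosed D)
    (hconv : Convex ℝ D) (hγ0 : 0 < γ) (hγ1 : γ ≤ 1) (hXD : ∀ i, X i ∈ D)
    (hX' : ∀ i, X' i = proj D (X i - γ • act (1 - W) Xh i - η • g i)) {c : ℝ} (hc0 : 0 < c)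
    (hc1 : c ≤ 1 / 2) :
    ∑ i, ‖dev X' i‖ ^ 2 + (1 - 2 * c) * ∑ i, ‖X' i - Xh i‖ ^ 2
      ≤ κ₀ γ (spectralGap W) (disagreementNorm W) c
          * (∑ i, ‖dev X i‖ ^ 2 + ∑ i, ‖X i - Xh i‖ ^ 2)
        + C₃ γ (spectralGap W) c * (η ^ 2 * ∑ i, ‖g i‖ ^ 2) := by
  have hδ := h.spectralGap_pos hn
  set δ := spectralGap W
  set β := disagreementNorm W
  have ht : 0 < γ * δ / 2 := by positivity
  -- Young parameters: `γδ/2` for consensus and `c` for compression, those for which the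
  -- coefficients are exactly `C₁` and `C₂`.
  have h1 := consensus_step h hn hne hc hconv hγ0 hγ1 hX' ht
  have h2 := compression_step h hne hc hconv hXD hX' hc0
  set vx := ∑ i, ‖dev X i‖ ^ 2
  set ve := ∑ i, ‖X i - Xh i‖ ^ 2
  set w := η ^ 2 * ∑ i, ‖g i‖ ^ 2
  have hvx : 0 ≤ vx := Finset.sum_nonneg fun i _ => by positivity
  have hve : 0 ≤ ve := Finset.sum_nonneg fun i _ => by positivity
  have hw : 0 ≤ w := mul_nonneg (sq_nonneg _) (Finset.sum_nonneg fun i _ => by positivity)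
  have hc2 : 0 ≤ 1 - 2 * c := by linarith
  have h3 := mul_le_mul_of_nonneg_left h2 hc2
  have hC1 : C₁ γ δ β c * vx ≤ κ₀ γ δ β c * vx := by gcongr; exact le_max_left _ _
  have hC2 : C₂ γ δ β c * ve ≤ κ₀ γ δ β c * ve := by gcongr; exact le_max_right _ _
  -- `(1 + c)(1 - 2c) ≤ 1` bounds the compression part by `2(1 + c⁻¹)`; the consensus part needs
  -- only a quarter of its share in `C₃`.
  have hC3 : ((1 + γ * δ / 2) * (1 + (γ * δ / 2)⁻¹)
      + (1 - 2 * c) * ((1 + c⁻¹) * ((1 + c) * 2))) * w ≤ C₃ γ δ c * w := by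
    gcongr
    have e1 : (γ * δ / 2)⁻¹ = 2 / (γ * δ) := inv_div _ _
    have e2 : 0 ≤ (1 + γ * δ / 2) * (1 + 2 / (γ * δ)) := by positivity
    have e3 : (1 + c⁻¹) * ((1 - 2 * c) * (1 + c)) ≤ (1 + c⁻¹) * 1 := by
      gcongr
      nlinarith
    rw [C₃, e1]
    linarith
  have key : ∑ i, ‖dev X' i‖ ^ 2 + (1 - 2 * c) * ∑ i, ‖X' i - Xh i‖ ^ 2
      ≤ C₁ γ δ β c * vx + C₂ γ δ β c * ve + ((1 + γ * δ / 2) * (1 + (γ * δ / 2)⁻¹)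
      + (1 - 2 * c) * ((1 + c⁻¹) * ((1 + c) * 2))) * w := by
    rw [C₁, C₂]
    refine (add_le_add h1 h3).trans (le_of_eq ?_)
    ring
  linarith

/-- The descent inequality for the distance to a feasible point. -/
theorem descent_step (h : IsNetwork G W) (hne : D.Nonempty) (hc : IsClosed D)
    (hconv : Convex ℝ D) (hγβ : γ ^ 2 * disagreementNorm W ^ 2 ≤ 1) (hγ0 : 0 ≤ γ)
    (hX' : ∀ i, X' i = proj D (X i - γ • act (1 - W) Xh i - η • g i)) {y : Vec d} (hy : y ∈ D) :
    ∑ i, ‖X' i - y‖ ^ 2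
      ≤ ∑ i, ‖X i - y‖ ^ 2 - 2 * η * ∑ i, inner ℝ (g i) (X i - y)
        + 5 * (∑ i, ‖dev X i‖ ^ 2 + ∑ i, ‖X i - Xh i‖ ^ 2) + 4 * (η ^ 2 * ∑ i, ‖g i‖ ^ 2) := by
  have hpt (i : Fin n) : ‖X' i - y‖ ^ 2 ≤ ‖X i - y‖ ^ 2
      - 2 * γ * inner ℝ (act (1 - W) Xh i) (X i - y) - 2 * η * inner ℝ (g i) (X i - y)
      + ‖γ • act (1 - W) Xh i + η • g i‖ ^ 2 := by
    have h1 : ‖X' i - y‖ ^ 2 ≤ ‖(X i - y) - (γ • act (1 - W) Xh i + η • g i)‖ ^ 2 := by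
      gcongr
      rw [hX' i]
      refine (norm_proj_sub_le hne hc hconv _ hy).trans (le_of_eq ?_)
      congr 1; abel
    rw [norm_sub_sq_real (X i - y), inner_add_right, real_inner_smul_right, real_inner_smul_right,
      real_inner_comm (act (1 - W) Xh i), real_inner_comm (g i)] at h1
    linarith
  have hsum := Finset.sum_le_sum fun i (_ : i ∈ Finset.univ) => hpt i
  simp only [Finset.sum_add_distrib, Finset.sum_sub_distrib, ← Finset.mul_sum] at hsum
  -- With `t = 1` and `γ²β² ≤ 1` this costs `4 vx + 2 ve` plus four times the gradient term; the
  -- cross term below adds `vx + ve`, whence the constants `5` and `4`.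
  have hdir := sum_norm_sq_direction_le (X := X) (Xh := Xh) (g := g) (γ := γ) (η := η) h one_pos
  set vx := ∑ i, ‖dev X i‖ ^ 2
  set ve := ∑ i, ‖X i - Xh i‖ ^ 2 with hve_def
  have hvx : 0 ≤ vx := Finset.sum_nonneg fun i _ => by positivity
  have hve : 0 ≤ ve := Finset.sum_nonneg fun i _ => by positivity
  have b1 : γ ^ 2 * disagreementNorm W ^ 2 * vx ≤ vx := by nlinarith
  have b2 : γ ^ 2 * disagreementNorm W ^ 2 * ve ≤ ve := by nlinarith
  -- `I - W` is symmetric and kills constants, so `y` drops out. What remains is a nonnegative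
  -- quadratic form, which is discarded, and a pairing of the two errors.
  have hlin : ∑ i, inner ℝ (act (1 - W) Xh i) (X i - y)
      = ∑ i, inner ℝ (act (1 - W) X i) (X i) - ∑ i, inner ℝ (act (1 - W) (X - Xh) i) (dev X i) := by
    have e1 : ∑ i, inner ℝ (act (1 - W) Xh i) (X i - y)
        = ∑ i, inner ℝ (Xh i) (act (1 - W) X i) := by
      have := sum_inner_act (1 - W) Xh (X - fun _ => y)
      rw [h.transpose_one_sub, act_sub, h.act_one_sub_const, sub_zero] at this
      exact this
    have e2 := sum_inner_act (1 - W) X X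
    rw [h.transpose_one_sub] at e2
    have e3 := sum_inner_act (1 - W) (X - Xh) (dev X)
    rw [h.transpose_one_sub, h.act_one_sub_dev] at e3
    rw [e1, e2, e3, ← Finset.sum_sub_distrib]
    refine Finset.sum_congr rfl fun i _ => ?_
    rw [Pi.sub_apply, inner_sub_left]
    ring
  have hquad := h.sum_inner_act_one_sub_nonneg X
  have hcross : 2 * γ * ∑ i, inner ℝ (act (1 - W) (X - Xh) i) (dev X i) ≤ ve + vx := by
    have h3 : ∑ i, 2 * γ * inner ℝ (act (1 - W) (X - Xh) i) (dev X i)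
        ≤ ∑ i, (γ ^ 2 * ‖act (1 - W) (X - Xh) i‖ ^ 2 + ‖dev X i‖ ^ 2) := by
      refine Finset.sum_le_sum fun i _ => ?_
      have h4 := real_inner_le_norm (act (1 - W) (X - Xh) i) (dev X i)
      have h5 := mul_le_mul_of_nonneg_left h4 hγ0
      nlinarith [sq_nonneg (γ * ‖act (1 - W) (X - Xh) i‖ - ‖dev X i‖)]
    rw [← Finset.mul_sum, Finset.sum_add_distrib, ← Finset.mul_sum] at h3
    have h6 : γ ^ 2 * ∑ i, ‖act (1 - W) (X - Xh) i‖ ^ 2 ≤ γ ^ 2 * (disagreementNorm W ^ 2 * ve) := by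
      gcongr
      exact sum_norm_sq_act_le _ _
    linarith
  have hq' : 0 ≤ 2 * γ * ∑ i, inner ℝ (act (1 - W) X i) (X i) := by positivity
  rw [hlin, mul_sub] at hsum
  norm_num at hdir
  linarith

end OneStep

/-! ### Scalar sequences -/

section Sequences

/-- Summation by parts; the induction carries the stronger bound `w_T (B - D_{T+1})`, preserved
because raising the weight of `B - D ≥ 0` only helps. -/
theorem sum_mul_sub_le_of_monotone {w D : ℕ → ℝ} {B : ℝ} (hw0 : ∀ k, 0 ≤ w k)
    (hw : Monotone w) (hD0 : ∀ k, 0 ≤ D k) (hD : ∀ k, 1 ≤ k → D k ≤ B) {T : ℕ} (hT : 1 ≤ T) :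
    ∑ k ∈ Finset.Icc 1 T, w k * (D k - D (k + 1)) ≤ w T * B := by
  have key : ∑ k ∈ Finset.Icc 1 T, w k * (D k - D (k + 1)) ≤ w T * B - w T * D (T + 1) := by
    induction T, hT using Nat.le_induction with
    | base =>
      have := mul_le_mul_of_nonneg_left (hD 1 le_rfl) (hw0 1)
      simp only [Finset.Icc_self, Finset.sum_singleton]
      linarith
    | succ m hm ih =>
      rw [Finset.sum_Icc_succ_top (by omega)]
      have h1 : w m ≤ w (m + 1) := hw (Nat.le_succ m)
      have h2 := mul_le_mul_of_nonneg_right h1 (sub_nonneg.2 (hD (m + 1) (by omega)))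
      linarith
  have := mul_nonneg (hw0 T) (hD0 (T + 1))
  linarith

/-- Summation of a perturbed contraction. -/
theorem mul_sum_le_of_contraction {U e : ℕ → ℝ} {κ : ℝ} (hU : ∀ k, 0 ≤ U k) {T : ℕ}
    (hT : 1 ≤ T) (h : ∀ k, 1 ≤ k → U (k + 1) ≤ κ * U k + e k) :
    (1 - κ) * ∑ k ∈ Finset.Icc 1 T, U k ≤ U 1 + ∑ k ∈ Finset.Icc 1 T, e k := by
  have key : (1 - κ) * ∑ k ∈ Finset.Icc 1 T, U k
      ≤ U 1 - U (T + 1) + ∑ k ∈ Finset.Icc 1 T, e k := by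
    induction T, hT using Nat.le_induction with
    | base =>
      have := h 1 le_rfl
      simp only [Finset.Icc_self, Finset.sum_singleton]
      linarith
    | succ m hm ih =>
      rw [Finset.sum_Icc_succ_top (by omega), Finset.sum_Icc_succ_top (by omega)]
      have := h (m + 1) (by omega)
      linarith
  have := hU (T + 1)
  linarith

variable {c : ℝ}

theorem one_le_sqrt_add (hc : 4 < c) (k : ℕ) : 1 ≤ √((k : ℝ) + c) := by
  rw [Real.one_le_sqrt]
  have : (0 : ℝ) ≤ k := by positivity
  linarith

theorem sq_sqrt_add (hc : 4 < c) (k : ℕ) : √((k : ℝ) + c) ^ 2 = k + c := by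
  rw [Real.sq_sqrt]
  have : (0 : ℝ) ≤ k := by positivity
  linarith

theorem sqrt_add_mono (c : ℝ) : Monotone fun k : ℕ => √((k : ℝ) + c) := by
  intro k l h
  simp only
  gcongr

/-- For consecutive roots `a ≤ b`, `b² - a² = 1` gives `1/b ≤ 2(b - a)`, which telescopes. -/
theorem sum_inv_sqrt_add_le (hc : 4 < c) (T : ℕ) :
    ∑ k ∈ Finset.Icc 1 T, 1 / √((k : ℝ) + c) ≤ 2 * √((T : ℝ) + c) := by
  induction T with
  | zero => simp
  | succ m ih =>
    rw [Finset.sum_Icc_succ_top (by omega)]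
    have h1 := one_le_sqrt_add hc m
    have h2 := one_le_sqrt_add hc (m + 1)
    have e1 := sq_sqrt_add hc m
    have e2 := sq_sqrt_add hc (m + 1)
    have hm : √((m : ℝ) + c) ≤ √(((m + 1 : ℕ) : ℝ) + c) := sqrt_add_mono c (Nat.le_succ m)
    set a := √((m : ℝ) + c)
    set b := √(((m + 1 : ℕ) : ℝ) + c)
    push_cast at e2
    have h3 : 1 / b ≤ 2 * (b - a) := by
      rw [div_le_iff₀ (by linarith)]
      nlinarith
    linarith

/-- `1/b³ ≤ 2/a - 2/b` for consecutive roots telescopes to at most `2/√c`, which is at most `1`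
because `c > 4`. -/
theorem sum_inv_sqrt_add_cube_le (hc : 4 < c) (T : ℕ) :
    ∑ k ∈ Finset.Icc 1 T, 1 / √((k : ℝ) + c) ^ 3 ≤ 1 := by
  have key : ∑ k ∈ Finset.Icc 1 T, 1 / √((k : ℝ) + c) ^ 3
      ≤ 2 / √((0 : ℕ) + c) - 2 / √((T : ℝ) + c) := by
    induction T with
    | zero => simp
    | succ m ih =>
      rw [Finset.sum_Icc_succ_top (by omega)]
      have h1 := one_le_sqrt_add hc m
      have h2 := one_le_sqrt_add hc (m + 1)
      have e1 := sq_sqrt_add hc m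
      have e2 := sq_sqrt_add hc (m + 1)
      have hm : √((m : ℝ) + c) ≤ √(((m + 1 : ℕ) : ℝ) + c) := sqrt_add_mono c (Nat.le_succ m)
      set a := √((m : ℝ) + c)
      set b := √(((m + 1 : ℕ) : ℝ) + c)
      push_cast at e2
      have h3 : 1 / b ^ 3 ≤ 2 / a - 2 / b := by
        have ha : 0 < a := by linarith
        have hb : 0 < b := by linarith
        have e3 : (b - a) * (b + a) = 1 := by nlinarith
        rw [div_sub_div _ _ ha.ne' hb.ne', div_le_div_iff₀ (by positivity) (by positivity)]
        have e4 : (2 * b - a * 2) * b ^ 3 * (b + a) = 2 * b ^ 3 := by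
          linear_combination 2 * b ^ 3 * e3
        refine le_of_mul_le_mul_right ?_ (by positivity : 0 < b + a)
        rw [e4]
        have : a * b * (b + a) ≤ b * b * (b + b) := by gcongr
        nlinarith
      linarith
  have h0 : 2 / √((0 : ℕ) + c) ≤ 1 := by
    rw [div_le_one (by linarith [one_le_sqrt_add hc 0])]
    rw [Real.le_sqrt' two_pos]
    push_cast
    linarith
  have h1 : 0 ≤ 2 / √((T : ℝ) + c) := by positivity
  linarith

/-- Squaring the right side already gives more than `k + c + 1`. It bounds how much the growth of
the weights spoils the contraction. -/
theorem sqrt_add_succ_le (hc : 4 < c) (k : ℕ) :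
    √(((k + 1 : ℕ) : ℝ) + c) ≤ √((k : ℝ) + c) + 1 / (2 * √((k : ℝ) + c)) := by
  have h1 := one_le_sqrt_add hc k
  have e1 := sq_sqrt_add hc k
  refine Real.sqrt_le_iff.2 ⟨by positivity, ?_⟩
  set a := √((k : ℝ) + c)
  have ha : a ≠ 0 := by positivity
  have : (a + 1 / (2 * a)) ^ 2 = a ^ 2 + 1 + (1 / (2 * a)) ^ 2 := by field_simp; ring
  rw [this, e1]
  push_cast
  nlinarith [sq_nonneg (1 / (2 * a))]

/-- The weighted sum of a perturbed contraction with perturbations of order `1/k`. -/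
theorem sum_sqrt_mul_le_of_contraction {V : ℕ → ℝ} {κ b B : ℝ} (hc : 4 < c) (hV : ∀ k, 0 ≤ V k)
    (hκ0 : 0 ≤ κ) (hκ1 : κ < 1) (hb : 0 ≤ b) (hB : V 1 ≤ B)
    (h : ∀ k : ℕ, 1 ≤ k → V (k + 1) ≤ κ * V k + b * (1 / √((k : ℝ) + c) ^ 2)) {T : ℕ} (hT : 1 ≤ T)
    (hN : 1 / (1 - κ) ≤ √((T : ℝ) + c)) :
    ∑ k ∈ Finset.Icc 1 T, √((k : ℝ) + c) * V k
      ≤ 1 / (1 - κ) * (√((T : ℝ) + c) * (2 * B + 5 * b)) := by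
  have hw1 := one_le_sqrt_add hc
  have hwm := sqrt_add_mono c
  have hB0 : 0 ≤ B := (hV 1).trans hB
  have hκ : 0 < 1 - κ := by linarith
  -- First pass, with the decreasing weights `1/√(k + c)`: these preserve the contraction, and the
  -- perturbations become summable.
  have hlow : (1 - κ) * ∑ k ∈ Finset.Icc 1 T, V k / √((k : ℝ) + c) ≤ B + b := by
    have h1 := mul_sum_le_of_contraction (U := fun k : ℕ => V k / √((k : ℝ) + c))
      (e := fun k : ℕ => b * (1 / √((k : ℝ) + c) ^ 3)) (κ := κ)
      (fun k => div_nonneg (hV k) (Real.sqrt_nonneg _)) hT (fun k hk => by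
        have hp : 0 < √((k : ℝ) + c) := by linarith [hw1 k]
        have hm : √((k : ℝ) + c) ≤ √(((k + 1 : ℕ) : ℝ) + c) := hwm (Nat.le_succ k)
        calc V (k + 1) / √(((k + 1 : ℕ) : ℝ) + c) ≤ V (k + 1) / √((k : ℝ) + c) := by
              gcongr
              exact hV _
          _ ≤ (κ * V k + b * (1 / √((k : ℝ) + c) ^ 2)) / √((k : ℝ) + c) := by
              gcongr
              exact h k hk
          _ = _ := by field_simp)
    rw [← Finset.mul_sum] at h1
    have h2 := mul_le_mul_of_nonneg_left (sum_inv_sqrt_add_cube_le hc T) hb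
    have h3 : V 1 / √(((1 : ℕ) : ℝ) + c) ≤ B := by
      rw [div_le_iff₀ (by linarith [hw1 1])]
      nlinarith [hw1 1]
    linarith
  -- Second pass, with the growing weights: each step costs an extra `V k / (2√(k + c))`, charged to
  -- the sum of the first pass.
  have hhigh : (1 - κ) * ∑ k ∈ Finset.Icc 1 T, √((k : ℝ) + c) * V k
      ≤ √((1 : ℕ) + c) * V 1 + ∑ k ∈ Finset.Icc 1 T,
        (2 * b * (1 / √((k : ℝ) + c)) + (1 / 2) * (V k / √((k : ℝ) + c))) := by
    refine mul_sum_le_of_contraction (U := fun k : ℕ => √((k : ℝ) + c) * V k)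
      (fun k => mul_nonneg (Real.sqrt_nonneg _) (hV k)) hT (fun k hk => ?_)
    have hw := hw1 k
    have hs := sqrt_add_succ_le hc k
    have hk := h k hk
    set w := √((k : ℝ) + c)
    set w' := √(((k + 1 : ℕ) : ℝ) + c)
    have hw' : w' ≤ 2 * w := by
      have : 1 / (2 * w) ≤ w := by
        rw [div_le_iff₀ (by linarith)]
        nlinarith
      linarith
    have hw0 : 0 < w := by linarith
    have hw'0 : 0 ≤ w' := Real.sqrt_nonneg _
    calc w' * V (k + 1) ≤ w' * (κ * V k + b * (1 / w ^ 2)) := by gcongr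
      _ = κ * (w' * V k) + w' * (b * (1 / w ^ 2)) := by ring
      _ ≤ κ * ((w + 1 / (2 * w)) * V k) + 2 * w * (b * (1 / w ^ 2)) := by
          gcongr
          exact hV k
      _ = κ * (w * V k) + (2 * b * (1 / w) + κ * ((1 / 2) * (V k / w))) := by
          field_simp
          ring
      _ ≤ κ * (w * V k) + (2 * b * (1 / w) + 1 * ((1 / 2) * (V k / w))) := by
          gcongr
          have := hV k
          positivity
      _ = _ := by rw [one_mul]
  rw [Finset.sum_add_distrib, ← Finset.mul_sum, ← Finset.mul_sum] at hhigh
  have hS := sum_inv_sqrt_add_le hc T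
  have hWT := hw1 T
  have hW1 : √(((1 : ℕ) : ℝ) + c) ≤ √((T : ℝ) + c) := hwm hT
  set N := 1 / (1 - κ) with hN_def
  have hN0 : 0 < N := by positivity
  have hNκ : N * (1 - κ) = 1 := by rw [hN_def]; field_simp
  set WT := √((T : ℝ) + c)
  set L := ∑ k ∈ Finset.Icc 1 T, V k / √((k : ℝ) + c)
  set H := ∑ k ∈ Finset.Icc 1 T, √((k : ℝ) + c) * V k
  -- The first pass gives `N(B + b)`; one factor `N` is traded for `√(T + c)`, avoiding a bound
  -- quadratic in `1/(1 - κ)`.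
  have hL : L ≤ WT * (B + b) := by
    have : L = N * ((1 - κ) * L) := by rw [← mul_assoc, hNκ, one_mul]
    rw [this]
    calc N * ((1 - κ) * L) ≤ N * (B + b) := by gcongr
      _ ≤ WT * (B + b) := by gcongr
  have hH : H = N * ((1 - κ) * H) := by rw [← mul_assoc, hNκ, one_mul]
  refine hH.le.trans (mul_le_mul_of_nonneg_left ?_ hN0.le)
  have h5 : √(((1 : ℕ) : ℝ) + c) * V 1 ≤ WT * B := by
    gcongr
    exact hV 1
  have h6 : 2 * b * ∑ k ∈ Finset.Icc 1 T, 1 / √((k : ℝ) + c) ≤ 2 * b * (2 * WT) := by gcongr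
  have h7 : 0 ≤ WT * (B + b) := by positivity
  have h8 : 0 ≤ WT * B := by positivity
  have h9 : 0 ≤ WT * b := by positivity
  refine (hhigh.trans (add_le_add h5 (add_le_add h6
    (mul_le_mul_of_nonneg_left hL (by norm_num : (0 : ℝ) ≤ 1 / 2))))).trans ?_
  linarith

end Sequences

/-! ### Expected one step inequalities -/

section Trajectory

variable {d n : ℕ} {A : Type*} [MeasurableSpace A]

/-- The stochastic recursion followed by the iterates `x`, the compressed copies `xh` and the
gradient estimates `g`, where `1 - 2 c` is the mean square contraction factor of the compression. -/
structure IsTrajectory (K D : Set (Vec d)) (W : Matrix (Fin n) (Fin n) ℝ) (Pr : Measure A)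
    (γ : ℝ) (η : ℕ → ℝ) (c gb : ℝ) (x xh g : ℕ → A → Fin n → Vec d) : Prop where
  meas_x : ∀ k i, Measurable fun a => x k a i
  meas_xh : ∀ k i, Measurable fun a => xh k a i
  init_x : ∀ a i, x 0 a i ∈ K
  init_xh : ∀ a i, xh 0 a i = 0
  update : ∀ k a i,
    x (k + 1) a i = proj D (x k a i - γ • act (1 - W) (xh (k + 1) a) i - η k • g k a i)
  bound : ∀ k, 1 ≤ k → ∀ᵐ a ∂Pr, ∀ i, ‖g k a i‖ ≤ gb
  compress : ∀ k i, Integrable (fun a => ‖x k a i - xh k a i‖ ^ 2) Pr →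
    Integrable (fun a => ‖x k a i - xh (k + 1) a i‖ ^ 2) Pr ∧
      ∫ a, ‖x k a i - xh (k + 1) a i‖ ^ 2 ∂Pr ≤ (1 - 2 * c) * ∫ a, ‖x k a i - xh k a i‖ ^ 2 ∂Pr

/-- The consensus error plus the compression error. -/
noncomputable def lyapunov {A : Type*} (x xh : ℕ → A → Fin n → Vec d) (k : ℕ) (a : A) : ℝ :=
  ∑ i, ‖dev (x k a) i‖ ^ 2 + ∑ i, ‖x k a i - xh (k + 1) a i‖ ^ 2

theorem lyapunov_nonneg {A : Type*} (x xh : ℕ → A → Fin n → Vec d) (k : ℕ) (a : A) : 0 ≤ lyapunov x xh k a := by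
  unfold lyapunov; positivity

namespace IsTrajectory

variable {K : Set (Vec d)} {ε Rl Ru : ℝ} {W : Matrix (Fin n) (Fin n) ℝ} {G : SimpleGraph (Fin n)}
  {Pr : Measure A}
  {γ : ℝ} {η : ℕ → ℝ} {c gb : ℝ} {x xh g : ℕ → A → Fin n → Vec d}

theorem mem_shrink (h : IsTrajectory K (shrink ε K) W Pr γ η c gb x xh g)
    (hK : IsConstraintSet K Rl Ru) {k : ℕ} (hk : 1 ≤ k) (a : A) (i : Fin n) :
    x k a i ∈ shrink ε K := by
  obtain ⟨k, rfl⟩ := Nat.exists_eq_succ_of_ne_zero (by omega : k ≠ 0)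
  rw [Nat.succ_eq_add_one, h.update]
  exact proj_mem (hK.shrink_nonempty ε) (hK.isClosed_shrink ε) (hK.convex_shrink ε) _

theorem mem (h : IsTrajectory K (shrink ε K) W Pr γ η c gb x xh g)
    (hK : IsConstraintSet K Rl Ru) (hε0 : 0 ≤ ε) (hε1 : ε ≤ 1) (k : ℕ) (a : A) (i : Fin n) :
    x k a i ∈ K := by
  rcases Nat.eq_zero_or_pos k with rfl | hk
  · exact h.init_x a i
  · exact hK.shrink_subset hε0 hε1 (h.mem_shrink hK hk a i)

theorem measurable_dev (h : IsTrajectory K (shrink ε K) W Pr γ η c gb x xh g) (k : ℕ) (i : Fin n) :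
    Measurable fun a => dev (x k a) i := by
  have hmx := h.meas_x k
  simp only [dev_apply]
  have h1 : Measurable fun a => ∑ j, x k a j := Finset.measurable_fun_sum _ fun j _ => hmx j
  have h2 := hmx i
  fun_prop

theorem sum_norm_sq_dev_le (h : IsTrajectory K (shrink ε K) W Pr γ η c gb x xh g)
    (hK : IsConstraintSet K Rl Ru) (hn : 1 ≤ n) (hε0 : 0 ≤ ε) (hε1 : ε ≤ 1) (k : ℕ) (a : A) :
    ∑ i, ‖dev (x k a) i‖ ^ 2 ≤ n * Ru ^ 2 := by
  refine (ComDSZO.sum_norm_sq_dev_le hn (x k a) 0).trans ?_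
  calc ∑ i, ‖x k a i - 0‖ ^ 2 ≤ ∑ _i : Fin n, Ru ^ 2 := by
        gcongr with i
        rw [sub_zero]
        exact hK.norm_le (h.mem hK hε0 hε1 k a i)
    _ = n * Ru ^ 2 := by simp

theorem ae_sum_norm_sq_le (h : IsTrajectory K (shrink ε K) W Pr γ η c gb x xh g) {k : ℕ}
    (hk : 1 ≤ k) : ∀ᵐ a ∂Pr, ∑ i, ‖g k a i‖ ^ 2 ≤ n * gb ^ 2 := by
  filter_upwards [h.bound k hk] with a ha
  calc ∑ i, ‖g k a i‖ ^ 2 ≤ ∑ _i : Fin n, gb ^ 2 := by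
        gcongr with i
        exact ha i
    _ = n * gb ^ 2 := by simp

theorem sum_norm_sub_sq_le (h : IsTrajectory K (shrink ε K) W Pr γ η c gb x xh g)
    (hK : IsConstraintSet K Rl Ru) (hε0 : 0 ≤ ε) (hε1 : ε ≤ 1) (k : ℕ) {y : Vec d} (hy : y ∈ K)
    (a : A) : ∑ i, ‖x k a i - y‖ ^ 2 ≤ n * (2 * Ru) ^ 2 := by
  calc ∑ i, ‖x k a i - y‖ ^ 2 ≤ ∑ _i : Fin n, (2 * Ru) ^ 2 := by
        gcongr with i
        exact hK.norm_sub_le (h.mem hK hε0 hε1 k a i) hy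
    _ = n * (2 * Ru) ^ 2 := by simp

variable [IsProbabilityMeasure Pr]

/-- The copies `xh` need not be bounded. Compression preserves square integrability of the error,
and then `x` moves by at most the diameter of `K`, so induction closes. -/
theorem integrable_norm_sub_sq (h : IsTrajectory K (shrink ε K) W Pr γ η c gb x xh g)
    (hK : IsConstraintSet K Rl Ru) (hε0 : 0 ≤ ε) (hε1 : ε ≤ 1) (k : ℕ) (i : Fin n) :
    Integrable (fun a => ‖x k a i - xh k a i‖ ^ 2) Pr := by
  have hmx := h.meas_x
  have hmxh := h.meas_xh
  induction k with
  | zero =>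
    refine Integrable.of_bound (C := Ru ^ 2) ?_ (ae_of_all _ fun a => ?_)
    · have h1 := hmx 0 i
      have h2 := hmxh 0 i
      exact Measurable.aestronglyMeasurable (by fun_prop)
    · rw [h.init_xh, sub_zero, Real.norm_of_nonneg (by positivity)]
      gcongr
      exact hK.norm_le (h.init_x a i)
  | succ k ih =>
    have h1 := (h.compress k i ih).1
    have h2 : Integrable (fun a => 2 * (2 * Ru) ^ 2 + 2 * ‖x k a i - xh (k + 1) a i‖ ^ 2) Pr :=
      (integrable_const _).add (h1.const_mul 2)
    refine h2.mono' ?_ (ae_of_all _ fun a => ?_)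
    · have h1 := hmx (k + 1) i
      have h2 := hmxh (k + 1) i
      exact Measurable.aestronglyMeasurable (by fun_prop)
    · rw [Real.norm_of_nonneg (by positivity)]
      have h3 := norm_add_sq_le_young (x (k + 1) a i - x k a i) (x k a i - xh (k + 1) a i) one_pos
      have h4 : ‖x (k + 1) a i - x k a i‖ ^ 2 ≤ (2 * Ru) ^ 2 := by
        gcongr
        exact hK.norm_sub_le (h.mem hK hε0 hε1 _ a i) (h.mem hK hε0 hε1 _ a i)
      rw [sub_add_sub_cancel] at h3
      norm_num at h3
      linarith

theorem integrable_norm_sub_succ_sq (h : IsTrajectory K (shrink ε K) W Pr γ η c gb x xh g)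
    (hK : IsConstraintSet K Rl Ru) (hε0 : 0 ≤ ε) (hε1 : ε ≤ 1) (k : ℕ) (i : Fin n) :
    Integrable (fun a => ‖x k a i - xh (k + 1) a i‖ ^ 2) Pr :=
  (h.compress k i (h.integrable_norm_sub_sq hK hε0 hε1 k i)).1

theorem integrable_sum_norm_sq_dev (h : IsTrajectory K (shrink ε K) W Pr γ η c gb x xh g)
    (hK : IsConstraintSet K Rl Ru) (hn : 1 ≤ n) (hε0 : 0 ≤ ε) (hε1 : ε ≤ 1) (k : ℕ) :
    Integrable (fun a => ∑ i, ‖dev (x k a) i‖ ^ 2) Pr := by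
  refine Integrable.of_bound (C := n * Ru ^ 2) ?_ (ae_of_all _ fun a => ?_)
  · exact (Finset.measurable_fun_sum _ fun i _ =>
      (h.measurable_dev k i).norm.pow_const 2).aestronglyMeasurable
  · rw [Real.norm_of_nonneg (by positivity)]
    exact h.sum_norm_sq_dev_le hK hn hε0 hε1 k a

theorem integrable_lyapunov (h : IsTrajectory K (shrink ε K) W Pr γ η c gb x xh g)
    (hK : IsConstraintSet K Rl Ru) (hn : 1 ≤ n) (hε0 : 0 ≤ ε) (hε1 : ε ≤ 1) (k : ℕ) :
    Integrable (lyapunov x xh k) Pr :=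
  (h.integrable_sum_norm_sq_dev hK hn hε0 hε1 k).add
    (integrable_finsetSum _ fun i _ => h.integrable_norm_sub_succ_sq hK hε0 hε1 k i)

theorem integral_sum_norm_sub_succ_sq_le (h : IsTrajectory K (shrink ε K) W Pr γ η c gb x xh g)
    (hK : IsConstraintSet K Rl Ru) (hε0 : 0 ≤ ε) (hε1 : ε ≤ 1) (k : ℕ) :
    ∫ a, ∑ i, ‖x k a i - xh (k + 1) a i‖ ^ 2 ∂Pr
      ≤ (1 - 2 * c) * ∫ a, ∑ i, ‖x k a i - xh k a i‖ ^ 2 ∂Pr := by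
  rw [integral_finsetSum _ fun i _ => h.integrable_norm_sub_succ_sq hK hε0 hε1 k i,
    integral_finsetSum _ fun i _ => h.integrable_norm_sub_sq hK hε0 hε1 k i, Finset.mul_sum]
  exact Finset.sum_le_sum fun i _ => (h.compress k i (h.integrable_norm_sub_sq hK hε0 hε1 k i)).2

/-- Only feasibility is used, as `g 0` has no bound. The deviations cost `Ru²` per agent; the
compression error starts at `Ru²` and becomes `2(2Ru)² + 2Ru² = 10 Ru²` after the first move. -/
theorem integral_lyapunov_one_le (h : IsTrajectory K (shrink ε K) W Pr γ η c gb x xh g)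
    (hK : IsConstraintSet K Rl Ru) (hn : 1 ≤ n) (hε0 : 0 ≤ ε) (hε1 : ε ≤ 1)
    (hc0 : 0 ≤ c) :
    ∫ a, lyapunov x xh 1 a ∂Pr ≤ 11 * n * Ru ^ 2 := by
  have hI (k : ℕ) (i : Fin n) := h.integrable_norm_sub_sq hK hε0 hε1 k i
  have hI' (k : ℕ) (i : Fin n) := h.integrable_norm_sub_succ_sq hK hε0 hε1 k i
  have hcontr {y : ℝ} (hy : 0 ≤ y) : (1 - 2 * c) * y ≤ y := by nlinarith
  have h0 (i : Fin n) : ∫ a, ‖x 0 a i - xh 1 a i‖ ^ 2 ∂Pr ≤ Ru ^ 2 := by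
    refine ((h.compress 0 i (hI 0 i)).2.trans (hcontr (by positivity))).trans ?_
    calc ∫ a, ‖x 0 a i - xh 0 a i‖ ^ 2 ∂Pr ≤ ∫ _a, Ru ^ 2 ∂Pr := by
          refine integral_mono (hI 0 i) (integrable_const _) fun a => ?_
          simp only [h.init_xh, sub_zero]
          gcongr
          exact hK.norm_le (h.init_x a i)
      _ = Ru ^ 2 := by simp
  have h1 (i : Fin n) : ∫ a, ‖x 1 a i - xh 1 a i‖ ^ 2 ∂Pr ≤ 10 * Ru ^ 2 := by
    calc ∫ a, ‖x 1 a i - xh 1 a i‖ ^ 2 ∂Pr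
        ≤ ∫ a, (8 * Ru ^ 2 + 2 * ‖x 0 a i - xh 1 a i‖ ^ 2) ∂Pr := by
          refine integral_mono (hI 1 i) ((integrable_const _).add ((hI' 0 i).const_mul 2))
            fun a => ?_
          have h3 := norm_add_sq_le_young (x 1 a i - x 0 a i) (x 0 a i - xh 1 a i) one_pos
          have h4 : ‖x 1 a i - x 0 a i‖ ^ 2 ≤ (2 * Ru) ^ 2 := by
            gcongr
            exact hK.norm_sub_le (h.mem hK hε0 hε1 _ a i) (h.mem hK hε0 hε1 _ a i)
          rw [sub_add_sub_cancel] at h3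
          norm_num at h3
          simp only
          linarith
      _ = 8 * Ru ^ 2 + 2 * ∫ a, ‖x 0 a i - xh 1 a i‖ ^ 2 ∂Pr := by
          rw [integral_add (integrable_const _) ((hI' 0 i).const_mul 2),
            integral_const_mul 2 fun a => ‖x 0 a i - xh 1 a i‖ ^ 2]
          simp
      _ ≤ 10 * Ru ^ 2 := by linarith [h0 i]
  have h2 : ∫ a, ∑ i, ‖x 1 a i - xh 2 a i‖ ^ 2 ∂Pr ≤ n * (10 * Ru ^ 2) := by
    refine ((h.integral_sum_norm_sub_succ_sq_le hK hε0 hε1 1).trans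
      (hcontr (integral_nonneg fun a => by positivity))).trans ?_
    rw [integral_finsetSum _ fun i _ => hI 1 i]
    exact (Finset.sum_le_sum fun i _ => h1 i).trans (by simp)
  have h3 : ∫ a, ∑ i, ‖dev (x 1 a) i‖ ^ 2 ∂Pr ≤ n * Ru ^ 2 := by
    calc _ ≤ ∫ _a, n * Ru ^ 2 ∂Pr :=
          integral_mono (h.integrable_sum_norm_sq_dev hK hn hε0 hε1 1) (integrable_const _)
            fun a => h.sum_norm_sq_dev_le hK hn hε0 hε1 1 a
      _ = _ := by simp
  unfold lyapunov
  rw [integral_add (h.integrable_sum_norm_sq_dev hK hn hε0 hε1 1)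
    (integrable_finsetSum _ fun i _ => hI' 1 i)]
  linarith

/-- The fresh compression at iteration `k + 1` supplies, in expectation, the factor `1 - 2c` that
the pathwise `lyapunov_step` puts in front of the error before transmission. -/
theorem integral_lyapunov_succ_le (h : IsTrajectory K (shrink ε K) W Pr γ η c gb x xh g)
    (hW : IsNetwork G W) (hK : IsConstraintSet K Rl Ru) (hn : 1 ≤ n) (hε0 : 0 ≤ ε) (hε1 : ε ≤ 1)
    (hγ0 : 0 < γ) (hγ1 : γ ≤ 1) (hc0 : 0 < c) (hc1 : c ≤ 1 / 2) {k : ℕ} (hk : 1 ≤ k) :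
    ∫ a, lyapunov x xh (k + 1) a ∂Pr
      ≤ κ₀ γ (spectralGap W) (disagreementNorm W) c * ∫ a, lyapunov x xh k a ∂Pr
        + C₃ γ (spectralGap W) c * (η k ^ 2 * (n * gb ^ 2)) := by
  have hIv := h.integrable_sum_norm_sq_dev hK hn hε0 hε1 (k + 1)
  have hIe : Integrable (fun a => ∑ i, ‖x (k + 1) a i - xh (k + 1) a i‖ ^ 2) Pr :=
    integrable_finsetSum _ fun i _ => h.integrable_norm_sub_sq hK hε0 hε1 (k + 1) i
  have hIe' : Integrable (fun a => ∑ i, ‖x (k + 1) a i - xh (k + 1 + 1) a i‖ ^ 2) Pr :=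
    integrable_finsetSum _ fun i _ => h.integrable_norm_sub_succ_sq hK hε0 hε1 (k + 1) i
  have hIl := h.integrable_lyapunov hK hn hε0 hε1 k
  have hC₃ : 0 ≤ C₃ γ (spectralGap W) c :=
    (by norm_num : (0 : ℝ) ≤ 6).trans (six_le_C₃ (hW.spectralGap_pos hn) hγ0 hc0)
  calc ∫ a, lyapunov x xh (k + 1) a ∂Pr
      = ∫ a, ∑ i, ‖dev (x (k + 1) a) i‖ ^ 2 ∂Pr
        + ∫ a, ∑ i, ‖x (k + 1) a i - xh (k + 1 + 1) a i‖ ^ 2 ∂Pr := integral_add hIv hIe'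
    _ ≤ ∫ a, ∑ i, ‖dev (x (k + 1) a) i‖ ^ 2 ∂Pr
        + (1 - 2 * c) * ∫ a, ∑ i, ‖x (k + 1) a i - xh (k + 1) a i‖ ^ 2 ∂Pr := by
        gcongr
        exact h.integral_sum_norm_sub_succ_sq_le hK hε0 hε1 (k + 1)
    _ = ∫ a, (∑ i, ‖dev (x (k + 1) a) i‖ ^ 2
        + (1 - 2 * c) * ∑ i, ‖x (k + 1) a i - xh (k + 1) a i‖ ^ 2) ∂Pr := by
        rw [integral_add hIv (hIe.const_mul _), integral_const_mul]
    _ ≤ ∫ a, (κ₀ γ (spectralGap W) (disagreementNorm W) c * lyapunov x xh k a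
        + C₃ γ (spectralGap W) c * (η k ^ 2 * (n * gb ^ 2))) ∂Pr := by
        refine integral_mono_ae (hIv.add (hIe.const_mul _))
          ((hIl.const_mul _).add (integrable_const _)) ?_
        filter_upwards [h.ae_sum_norm_sq_le hk] with a ha
        refine (lyapunov_step hW hn (hK.shrink_nonempty ε) (hK.isClosed_shrink ε)
          (hK.convex_shrink ε) hγ0 hγ1 (h.mem_shrink hK hk a) (h.update k a) hc0 hc1).trans ?_
        unfold lyapunov
        gcongr
    _ = _ := by
        rw [integral_add (hIl.const_mul _) (integrable_const _), integral_const_mul]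
        simp

theorem integrable_sum_norm_sub_sq (h : IsTrajectory K (shrink ε K) W Pr γ η c gb x xh g)
    (hK : IsConstraintSet K Rl Ru) (hε0 : 0 ≤ ε) (hε1 : ε ≤ 1) (k : ℕ) {y : Vec d} (hy : y ∈ K) :
    Integrable (fun a => ∑ i, ‖x k a i - y‖ ^ 2) Pr := by
  refine Integrable.of_bound (C := n * (2 * Ru) ^ 2) ?_ (ae_of_all _ fun a => ?_)
  · exact (Finset.measurable_fun_sum _ fun i _ =>
      ((h.meas_x k i).sub measurable_const).norm.pow_const 2).aestronglyMeasurable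
  · rw [Real.norm_of_nonneg (by positivity)]
    exact h.sum_norm_sub_sq_le hK hε0 hε1 k hy a

theorem integral_sum_norm_sub_sq_le (h : IsTrajectory K (shrink ε K) W Pr γ η c gb x xh g)
    (hK : IsConstraintSet K Rl Ru) (hε0 : 0 ≤ ε) (hε1 : ε ≤ 1) (k : ℕ) {y : Vec d} (hy : y ∈ K) :
    ∫ a, ∑ i, ‖x k a i - y‖ ^ 2 ∂Pr ≤ n * (2 * Ru) ^ 2 := by
  calc _ ≤ ∫ _a, n * (2 * Ru) ^ 2 ∂Pr :=
        integral_mono (h.integrable_sum_norm_sub_sq hK hε0 hε1 k hy) (integrable_const _)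
          fun a => h.sum_norm_sub_sq_le hK hε0 hε1 k hy a
    _ = _ := by simp

theorem integral_descent (h : IsTrajectory K (shrink ε K) W Pr γ η c gb x xh g)
    (hW : IsNetwork G W) (hK : IsConstraintSet K Rl Ru) (hn : 1 ≤ n) (hε0 : 0 ≤ ε) (hε1 : ε ≤ 1)
    (hγβ : γ ^ 2 * disagreementNorm W ^ 2 ≤ 1) (hγ0 : 0 ≤ γ) {k : ℕ} (hk : 1 ≤ k)
    {y : Vec d} (hy : y ∈ shrink ε K)
    (hI : ∀ i, Integrable (fun a => inner ℝ (g k a i) (x k a i - y)) Pr) :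
    2 * η k * ∑ i, ∫ a, inner ℝ (g k a i) (x k a i - y) ∂Pr
      ≤ ∫ a, ∑ i, ‖x k a i - y‖ ^ 2 ∂Pr - ∫ a, ∑ i, ‖x (k + 1) a i - y‖ ^ 2 ∂Pr
        + 5 * ∫ a, lyapunov x xh k a ∂Pr + 4 * (η k ^ 2 * (n * gb ^ 2)) := by
  have hyK := hK.shrink_subset hε0 hε1 hy
  have hI0 := h.integrable_sum_norm_sub_sq hK hε0 hε1 k hyK
  have hI1 := h.integrable_sum_norm_sub_sq hK hε0 hε1 (k + 1) hyK
  have hIl := h.integrable_lyapunov hK hn hε0 hε1 k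
  have hIs : Integrable (fun a => ∑ i, inner ℝ (g k a i) (x k a i - y)) Pr :=
    integrable_finsetSum _ fun i _ => hI i
  have key : ∫ a, ∑ i, ‖x (k + 1) a i - y‖ ^ 2 ∂Pr
      ≤ ∫ a, (∑ i, ‖x k a i - y‖ ^ 2 - 2 * η k * ∑ i, inner ℝ (g k a i) (x k a i - y)
        + 5 * lyapunov x xh k a + 4 * (η k ^ 2 * (n * gb ^ 2))) ∂Pr := by
    refine integral_mono_ae hI1 (((hI0.sub (hIs.const_mul _)).add (hIl.const_mul _)).add
      (integrable_const _)) ?_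
    filter_upwards [h.ae_sum_norm_sq_le hk] with a ha
    refine (descent_step hW (hK.shrink_nonempty ε) (hK.isClosed_shrink ε)
      (hK.convex_shrink ε) hγβ hγ0 (h.update k a) hy).trans ?_
    unfold lyapunov
    gcongr
  have e1 := integral_add ((hI0.sub (hIs.const_mul (2 * η k))).add (hIl.const_mul 5))
    (integrable_const (μ := Pr) (4 * (η k ^ 2 * (n * gb ^ 2))))
  have e2 := integral_add (hI0.sub (hIs.const_mul (2 * η k))) (hIl.const_mul 5)
  have e3 := integral_sub hI0 (hIs.const_mul (2 * η k))
  simp only [Pi.add_apply, Pi.sub_apply, integral_const_mul, integral_const, probReal_univ,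
    one_smul] at e1 e2 e3
  rw [e1, e2, e3, integral_finsetSum _ fun i _ => hI i] at key
  linarith

end IsTrajectory

end Trajectory

/-! ### The run as a trajectory -/

section Run

/-- Both sides start at zero and gain `ψ (I - W) q` at each iteration. This eliminates `b` from the
analysis. -/
theorem run_b {d n : ℕ} {Ξ : Fin n → Type*} {S : Type*} {K : Set (Vec d)}
    {W : Matrix (Fin n) (Fin n) ℝ} {F : ∀ i, Vec d → Ξ i → ℝ} {Q : Vec d → S → Vec d}
    {μ ε ψ γ : ℝ} {η : ℕ → ℝ} {x₀ : Fin n → Vec d} (ξ : ∀ i, ℕ → Ξ i) (u : Fin n → ℕ → UnitSphere d) (s : Fin n → ℕ → S) (k : ℕ) :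
    (run K W F Q μ ε ψ γ η x₀ ξ u s k).b = act (1 - W) (run K W F Q μ ε ψ γ η x₀ ξ u s k).xhat := by
  induction k with
  | zero =>
    ext1 i
    simp [run, act]
  | succ k ih =>
    set st := run K W F Q μ ε ψ γ η x₀ ξ u s k with hst
    set q : Fin n → Vec d := fun i => Q (st.x i - st.xhat i) (s i k) with hq
    have e1 : (run K W F Q μ ε ψ γ η x₀ ξ u s (k + 1)).b
        = fun i => st.b i + ψ • (q i - ∑ j, W i j • q j) := rfl
    have e2 : (run K W F Q μ ε ψ γ η x₀ ξ u s (k + 1)).xhat = st.xhat + ψ • q := rfl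
    rw [e1, e2, act_add, act_smul, ih, sub_act 1 W q, one_act]
    rfl

variable {d n : ℕ} {Ξ : Fin n → Type*} [∀ i, MeasurableSpace (Ξ i)] {S : Type*} [MeasurableSpace S]
  {K : Set (Vec d)} {W : Matrix (Fin n) (Fin n) ℝ} {F : ∀ i, Vec d → Ξ i → ℝ}
  {Q : Vec d → S → Vec d} {μ ε ψ γ : ℝ} {η : ℕ → ℝ} {x₀ : Fin n → Vec d}
  {P : ∀ i, Measure (Ξ i)} {ν : Measure S}

/-- Extracts from the algorithm the abstract recursion behind the Lyapunov and descent estimates;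
randomness enters here through the a.s. gradient bound and the compression contraction. -/
theorem isTrajectory_run {A : Type*} [MeasurableSpace A] {Pr : Measure A} {ξ : ∀ i, ℕ → A → Ξ i}
    {u : Fin n → ℕ → A → UnitSphere d} {s : Fin n → ℕ → A → S} {Lf Lm σ Rl Ru r ω : ℝ}
    (h : IsSampling Pr P ν ξ u s) (hF : IsSmoothObjective K P F Lf Lm σ)
    (hQ : IsCompressor ν Q r ω) (hK : IsConstraintSet K Rl Ru) (hd : 1 ≤ d) (hμ : 0 < μ)
    (hμε : μ ≤ ε * Rl) (hε0 : 0 < ε) (hε1 : ε ≤ 1) (hψ : 0 ≤ ψ) (hψr : ψ * r ≤ 1)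
    (hx₀ : ∀ i, x₀ i ∈ K) :
    IsTrajectory K (shrink ε K) W Pr γ η (c₀ ψ r ω) (d * Lf)
      (fun k a => (run K W F Q μ ε ψ γ η x₀ (fun i k => ξ i k a) (fun i k => u i k a)
        (fun i k => s i k a) k).x)
      (fun k a => (run K W F Q μ ε ψ γ η x₀ (fun i k => ξ i k a) (fun i k => u i k a)
        (fun i k => s i k a) k).xhat)
      (fun k a i => gradEst μ (F i) ((run K W F Q μ ε ψ γ η x₀ (fun i k => ξ i k a)
        (fun i k => u i k a) (fun i k => s i k a) k).x i) (u i k a) (ξ i k a)) := by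
  have := h.prob
  have := hF.prob
  have := hQ.prob
  have hproj := (continuous_proj (hK.shrink_nonempty ε) (hK.isClosed_shrink ε)
    (hK.convex_shrink ε)).measurable
  have hmeas (k : ℕ) := State.isMeasurable_run (W := W) (μ := μ) (ψ := ψ) (γ := γ) (η := η)
    (x₀ := x₀) (ξ := ξ) (u := u) (s := s) hproj hF.meas hQ.meas k
  have hx (k : ℕ) (i : Fin n) := @State.IsMeasurable.x d n A (pastDraws ξ u s k) _ (hmeas k) i
  have hxh (k : ℕ) (i : Fin n) := @State.IsMeasurable.xhat d n A (pastDraws ξ u s k) _ (hmeas k) i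
  have hmem (k : ℕ) (a : A) (i : Fin n) : (run K W F Q μ ε ψ γ η x₀ (fun i k => ξ i k a)
      (fun i k => u i k a) (fun i k => s i k a) (k + 1)).x i ∈ shrink ε K :=
    proj_mem (hK.shrink_nonempty ε) (hK.isClosed_shrink ε) (hK.convex_shrink ε) _
  exact
    { meas_x := fun k i => (hx k i).mono (h.pastDraws_le k) le_rfl
      meas_xh := fun k i => (hxh k i).mono (h.pastDraws_le k) le_rfl
      init_x := fun a i => hx₀ i
      init_xh := fun a i => rfl
      update := fun k a i => by
        rw [← run_b]
        rfl
      -- For `k ≥ 1` the iterate comes out of a projection onto the shrunk set, so its query point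
      -- lies in `K` and the Lipschitz bound applies.
      bound := fun k hk => by
        obtain ⟨k, rfl⟩ := Nat.exists_eq_succ_of_ne_zero (by omega : k ≠ 0)
        rw [ae_all_iff]
        intro i
        have h2 := hF.ae_abs_sub_le hμ.le i
        rw [← h.map_sample hd i (k + 1)] at h2
        filter_upwards [ae_of_ae_map (h.meas_sample i (k + 1)).aemeasurable h2] with a ha
        refine norm_gradEst_le hμ (ha _ (hK.shrink_subset hε0.le hε1 (hmem k a i)) _ ?_)
        refine hK.add_mem_of_mem_shrink hε0 hε1 (hmem k a i) ?_
        rwa [norm_smul, norm_eq_of_mem_sphere, mul_one, Real.norm_of_nonneg hμ.le]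
      compress := fun k i hint => by
        have hY : Measurable[pastDraws ξ u s k] fun a =>
            (run K W F Q μ ε ψ γ η x₀ (fun i k => ξ i k a) (fun i k => u i k a)
              (fun i k => s i k a) k).x i
            - (run K W F Q μ ε ψ γ η x₀ (fun i k => ξ i k a) (fun i k => u i k a)
              (fun i k => s i k a) k).xhat i := (hx k i).sub (hxh k i)
        have key := hQ.integral_le hψ hψr (hY.mono (h.pastDraws_le k) le_rfl) (h.meas_comp i k)
          (h.map_prodMk_comp hd hY i) hint
        have e : 1 - 2 * c₀ ψ r ω = 1 - ψ * r * ω := by rw [c₀]; ring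
        rw [e]
        have e2 (a : A) : (run K W F Q μ ε ψ γ η x₀ (fun i k => ξ i k a) (fun i k => u i k a)
              (fun i k => s i k a) k).x i
            - (run K W F Q μ ε ψ γ η x₀ (fun i k => ξ i k a) (fun i k => u i k a)
              (fun i k => s i k a) (k + 1)).xhat i
            = ((run K W F Q μ ε ψ γ η x₀ (fun i k => ξ i k a) (fun i k => u i k a)
              (fun i k => s i k a) k).x i
            - (run K W F Q μ ε ψ γ η x₀ (fun i k => ξ i k a) (fun i k => u i k a)
              (fun i k => s i k a) k).xhat i)
            - ψ • Q ((run K W F Q μ ε ψ γ η x₀ (fun i k => ξ i k a) (fun i k => u i k a)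
              (fun i k => s i k a) k).x i
            - (run K W F Q μ ε ψ γ η x₀ (fun i k => ξ i k a) (fun i k => u i k a)
              (fun i k => s i k a) k).xhat i) (s i k a) := by
          rw [sub_sub]; rfl
        simp only [e2]
        exact key }

end Run

/-! ### Summation over the horizon -/

section Regret

variable {d n : ℕ} {Ξ : Fin n → Type*} [∀ i, MeasurableSpace (Ξ i)] {K : Set (Vec d)}
  {P : ∀ i, Measure (Ξ i)} {F : ∀ i, Vec d → Ξ i → ℝ} {Lf Lm σ Rl Ru ε : ℝ}

theorem mean_mem (hK : Convex ℝ K) (hn : 1 ≤ n) {X : Fin n → Vec d} (hX : ∀ i, X i ∈ K) :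
    (1 / (n : ℝ)) • ∑ i, X i ∈ K := by
  have hn0 : (n : ℝ) ≠ 0 := by positivity
  rw [Finset.smul_sum]
  refine hK.sum_mem (fun i _ => by positivity) ?_ fun i _ => hX i
  simp [hn0]

/-- The loss at the average in terms of the local losses at the agents' own iterates. -/
theorem IsSmoothObjective.mul_globalLoss_mean_sub_le (hF : IsSmoothObjective K P F Lf Lm σ)
    (hLf : 0 ≤ Lf) (hK : IsConstraintSet K Rl Ru) (hn : 1 ≤ n) (hε0 : 0 ≤ ε) (hε1 : ε ≤ 1)
    {X : Fin n → Vec d} (hX : ∀ i, X i ∈ K) {p : Vec d} (hp : p ∈ K) {w : ℝ} (hw : 0 < w) :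
    n * (globalLoss P F ((1 / (n : ℝ)) • ∑ i, X i) - globalLoss P F p)
      ≤ ∑ i, (localLoss P F i (X i) - localLoss P F i ((1 - ε) • p))
        + (Lf / 2 * (w * ∑ i, ‖dev X i‖ ^ 2) + n * (Lf / 2 * (1 / w) + Lf * Ru * ε)) := by
  have hn0 : (n : ℝ) ≠ 0 := by positivity
  set m := (1 / (n : ℝ)) • ∑ i, X i with hm
  have hmK : m ∈ K := mean_mem hK.convex hn hX
  have hy : (1 - ε) • p ∈ K := hK.shrink_subset hε0 hε1 ⟨p, hp, rfl⟩
  have e : n * (globalLoss P F m - globalLoss P F p)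
      = ∑ i, (localLoss P F i m - localLoss P F i p) := by
    rw [globalLoss, globalLoss, Finset.sum_sub_distrib]
    field_simp
  have hpt (i : Fin n) : localLoss P F i m - localLoss P F i p
      ≤ (localLoss P F i (X i) - localLoss P F i ((1 - ε) • p))
        + (Lf / 2 * (w * ‖dev X i‖ ^ 2) + (Lf / 2 * (1 / w) + Lf * Ru * ε)) := by
    have h1 := (abs_le.1 (hF.abs_localLoss_sub_le i (hX i) hmK)).1
    have h2 := (abs_le.1 (hF.abs_localLoss_sub_le i hy hp)).2
    have h3 : (1 - ε) • p - p = (-ε) • p := by module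
    rw [h3, norm_smul, norm_neg, Real.norm_of_nonneg hε0] at h2
    have h4 : Lf * (ε * ‖p‖) ≤ Lf * (ε * Ru) := by
      gcongr
      exact hK.norm_le hp
    rw [hm, ← dev_apply] at h1
    -- The parameter `w` will be `√(k + c)`: squared deviations then carry the same weight as the
    -- Lyapunov terms of the descent, and `1/w` sums to `O(√(T + c))`.
    have h5 : ‖dev X i‖ ≤ 1 / 2 * (w * ‖dev X i‖ ^ 2 + 1 / w) := by
      have : 0 ≤ (w * ‖dev X i‖ - 1) ^ 2 / w := by positivity
      have e2 : (w * ‖dev X i‖ - 1) ^ 2 / w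
          = w * ‖dev X i‖ ^ 2 - 2 * ‖dev X i‖ + 1 / w := by field_simp; ring
      linarith
    have h6 := mul_le_mul_of_nonneg_left h5 hLf
    linarith
  rw [e]
  refine (Finset.sum_le_sum fun i _ => hpt i).trans (le_of_eq ?_)
  rw [Finset.sum_add_distrib, Finset.sum_add_distrib, ← Finset.mul_sum, ← Finset.mul_sum,
    Finset.sum_const, Finset.card_univ, Fintype.card_fin, nsmul_eq_mul]

theorem IsSmoothObjective.integrable_globalLoss (hF : IsSmoothObjective K P F Lf Lm σ)
    (hLf : 0 ≤ Lf) (hK : IsConstraintSet K Rl Ru) (hn : 1 ≤ n) {A : Type*} [MeasurableSpace A]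
    {Pr : Measure A} [IsProbabilityMeasure Pr] {Y : A → Vec d} (hY : Measurable Y)
    (hYK : ∀ a, Y a ∈ K) : Integrable (fun a => globalLoss P F (Y a)) Pr := by
  refine Integrable.of_bound (C := Lf * (2 * Ru) + |globalLoss P F 0|)
    (hF.measurable_globalLoss.comp hY).aestronglyMeasurable (ae_of_all _ fun a => ?_)
  have h1 := hF.abs_globalLoss_sub_le hn (hYK a) hK.zero_mem
  have h2 : Lf * ‖Y a - 0‖ ≤ Lf * (2 * Ru) := by
    gcongr
    exact hK.norm_sub_le (hYK a) hK.zero_mem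
  have h3 := abs_add_le (globalLoss P F (Y a) - globalLoss P F 0) (globalLoss P F 0)
  rw [sub_add_cancel] at h3
  rw [Real.norm_eq_abs]
  linarith

theorem IsSmoothObjective.integral_globalLoss_sub_le (hF : IsSmoothObjective K P F Lf Lm σ)
    (hLf : 0 ≤ Lf) (hK : IsConstraintSet K Rl Ru) (hn : 1 ≤ n) {A : Type*} [MeasurableSpace A]
    {Pr : Measure A} [IsProbabilityMeasure Pr] {Y : A → Vec d} (hY : Measurable Y)
    (hYK : ∀ a, Y a ∈ K) {p : Vec d} (hp : p ∈ K) :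
    ∫ a, (globalLoss P F (Y a) - globalLoss P F p) ∂Pr ≤ 2 * Lf * Ru := by
  calc _ ≤ ∫ _a, 2 * Lf * Ru ∂Pr := by
        refine integral_mono ((hF.integrable_globalLoss hLf hK hn hY hYK).sub (integrable_const _))
          (integrable_const _) fun a => ?_
        have h1 := (le_abs_self _).trans (hF.abs_globalLoss_sub_le hn (hYK a) hp)
        have h2 : Lf * ‖Y a - p‖ ≤ Lf * (2 * Ru) := by
          gcongr
          exact hK.norm_sub_le (hYK a) hp
        simp only
        linarith
    _ = _ := by simp

variable {A : Type*} [MeasurableSpace A] {Pr : Measure A} [IsProbabilityMeasure Pr]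
  {W : Matrix (Fin n) (Fin n) ℝ} {G : SimpleGraph (Fin n)} {γ M c c' bias : ℝ}
  {x xh g : ℕ → A → Fin n → Vec d}

/-- The regret of a trajectory with step sizes `1 / (M √(k + c))`, before the weighted sum of the
Lyapunov function is estimated. -/
theorem IsTrajectory.mul_sum_integral_gap_le
    (h : IsTrajectory K (shrink ε K) W Pr γ (fun k => 1 / (M * √((k : ℝ) + c))) c' (d * Lf) x xh g)
    (hF : IsSmoothObjective K P F Lf Lm σ) (hLf : 0 ≤ Lf) (hW : IsNetwork G W)
    (hK : IsConstraintSet K Rl Ru) (hn : 1 ≤ n) (hε0 : 0 ≤ ε) (hε1 : ε ≤ 1)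
    (hγβ : γ ^ 2 * disagreementNorm W ^ 2 ≤ 1) (hγ0 : 0 ≤ γ) (hM : 0 < M) (hc : 4 < c)
    {p : Vec d} (hp : p ∈ K)
    (hIf : ∀ k, 1 ≤ k → ∀ i, Integrable (fun a => localLoss P F i (x k a i)) Pr)
    (hI : ∀ k, 1 ≤ k → ∀ i,
      Integrable (fun a => inner ℝ (g k a i) (x k a i - (1 - ε) • p)) Pr)
    (hgrad : ∀ k, 1 ≤ k → ∀ i,
      ∫ a, localLoss P F i (x k a i) ∂Pr - localLoss P F i ((1 - ε) • p) - bias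
        ≤ ∫ a, inner ℝ (g k a i) (x k a i - (1 - ε) • p) ∂Pr) {T : ℕ} (hT : 1 ≤ T) :
    n * ∑ k ∈ Finset.Icc 1 T, ∫ a, (globalLoss P F ((1 / (n : ℝ)) • ∑ i, x k a i)
        - globalLoss P F p) ∂Pr
      ≤ 2 * M * n * Ru ^ 2 * √((T : ℝ) + c)
        + (5 * M / 2 + Lf / 2) * ∑ k ∈ Finset.Icc 1 T, √((k : ℝ) + c) * ∫ a, lyapunov x xh k a ∂Pr
        + n * (2 * (d * Lf) ^ 2 / M + Lf / 2) * (2 * √((T : ℝ) + c))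
        + T * (n * (bias + Lf * Ru * ε)) := by
  set y := (1 - ε) • p with hy
  have hyS : y ∈ shrink ε K := ⟨p, hp, rfl⟩
  have hyK := hK.shrink_subset hε0 hε1 hyS
  set D : ℕ → ℝ := fun k => ∫ a, ∑ i, ‖x k a i - y‖ ^ 2 ∂Pr with hD
  set V : ℕ → ℝ := fun k => ∫ a, lyapunov x xh k a ∂Pr with hV
  have hstep (k : ℕ) (hk : k ∈ Finset.Icc 1 T) :
      n * ∫ a, (globalLoss P F ((1 / (n : ℝ)) • ∑ i, x k a i) - globalLoss P F p) ∂Pr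
        ≤ (M / 2) * (√((k : ℝ) + c) * (D k - D (k + 1)))
          + (5 * M / 2 + Lf / 2) * (√((k : ℝ) + c) * V k)
          + n * (2 * (d * Lf) ^ 2 / M + Lf / 2) * (1 / √((k : ℝ) + c))
          + n * (bias + Lf * Ru * ε) := by
    have hk1 : 1 ≤ k := (Finset.mem_Icc.1 hk).1
    have hw : 0 < √((k : ℝ) + c) := by linarith [one_le_sqrt_add hc k]
    have hdes := h.integral_descent hW hK hn hε0 hε1 hγβ hγ0 hk1 hyS (hI k hk1)
    set w := √((k : ℝ) + c) with hw_def
    have hIm : Integrable (fun a => globalLoss P F ((1 / (n : ℝ)) • ∑ i, x k a i)) Pr :=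
      hF.integrable_globalLoss hLf hK hn
        ((Finset.measurable_fun_sum _ fun i _ => h.meas_x k i).fun_const_smul _)
        fun a => mean_mem hK.convex hn fun i => h.mem hK hε0 hε1 k a i
    have hIl := h.integrable_lyapunov hK hn hε0 hε1 k
    have hIi (i : Fin n) :
        Integrable (fun a => localLoss P F i (x k a i) - localLoss P F i y) Pr :=
      (hIf k hk1 i).sub (integrable_const _)
    have hIs : Integrable (fun a => ∑ i, (localLoss P F i (x k a i) - localLoss P F i y)) Pr :=
      integrable_finsetSum _ fun i _ => hIi i
    have h1 : n * ∫ a, (globalLoss P F ((1 / (n : ℝ)) • ∑ i, x k a i) - globalLoss P F p) ∂Pr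
        ≤ ∑ i, (∫ a, localLoss P F i (x k a i) ∂Pr - localLoss P F i y)
          + (Lf / 2 * w * V k + n * (Lf / 2 * (1 / w) + Lf * Ru * ε)) := by
      calc n * ∫ a, (globalLoss P F ((1 / (n : ℝ)) • ∑ i, x k a i) - globalLoss P F p) ∂Pr
          = ∫ a, n * (globalLoss P F ((1 / (n : ℝ)) • ∑ i, x k a i) - globalLoss P F p) ∂Pr :=
            (integral_const_mul _ _).symm
        _ ≤ ∫ a, (∑ i, (localLoss P F i (x k a i) - localLoss P F i y)
            + (Lf / 2 * w * lyapunov x xh k a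
              + n * (Lf / 2 * (1 / w) + Lf * Ru * ε))) ∂Pr := by
            refine integral_mono ((hIm.sub (integrable_const _)).const_mul _)
              (hIs.add ((hIl.const_mul _).add (integrable_const _))) fun a => ?_
            refine (hF.mul_globalLoss_mean_sub_le hLf hK hn hε0 hε1
              (fun i => h.mem hK hε0 hε1 k a i) hp hw).trans ?_
            have h2 : ∑ i, ‖dev (x k a) i‖ ^ 2 ≤ lyapunov x xh k a :=
              le_add_of_nonneg_right (Finset.sum_nonneg fun i _ => by positivity)
            simp only [mul_assoc]
            gcongr
        _ = _ := by
            have hIv : Integrable (fun a => Lf / 2 * w * lyapunov x xh k a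
                + n * (Lf / 2 * (1 / w) + Lf * Ru * ε)) Pr :=
              (hIl.const_mul _).add (integrable_const _)
            rw [integral_add hIs hIv, integral_add (hIl.const_mul _) (integrable_const _), integral_const_mul,
              integral_finsetSum _ fun i _ => hIi i]
            congr 1
            · refine Finset.sum_congr rfl fun i _ => ?_
              rw [integral_sub (hIf k hk1 i) (integrable_const _)]
              simp
            · simp [hV]
    have h2 : ∑ i, (∫ a, localLoss P F i (x k a i) ∂Pr - localLoss P F i y)
        ≤ ∑ i, ∫ a, inner ℝ (g k a i) (x k a i - y) ∂Pr + n * bias := by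
      have : ∑ i, (∫ a, localLoss P F i (x k a i) ∂Pr - localLoss P F i y - bias)
          ≤ ∑ i, ∫ a, inner ℝ (g k a i) (x k a i - y) ∂Pr :=
        Finset.sum_le_sum fun i _ => hgrad k hk1 i
      rw [Finset.sum_sub_distrib, Finset.sum_const, Finset.card_univ, Fintype.card_fin,
        nsmul_eq_mul] at this
      linarith
    set I := ∑ i, ∫ a, inner ℝ (g k a i) (x k a i - y) ∂Pr with hI_def
    have h3 : I ≤ (M / 2) * (w * (D k - D (k + 1))) + 5 * M / 2 * (w * V k)
        + n * (2 * (d * Lf) ^ 2 / M) * (1 / w) := by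
      -- Division by `2 η_k`, as `1/(2 η_k) = M w / 2`.
      have h4 := mul_le_mul_of_nonneg_left hdes (by positivity : 0 ≤ M * w / 2)
      have e1 : M * w / 2 * (2 * (1 / (M * w)) * I) = I := by field_simp
      have e2 : M * w / 2 * (D k - D (k + 1) + 5 * V k
          + 4 * ((1 / (M * w)) ^ 2 * (n * (d * Lf) ^ 2)))
          = (M / 2) * (w * (D k - D (k + 1))) + 5 * M / 2 * (w * V k)
            + n * (2 * (d * Lf) ^ 2 / M) * (1 / w) := by
        field_simp
        ring
      rw [e1] at h4
      exact h4.trans e2.le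
    linarith
  have hDB (k : ℕ) (_ : 1 ≤ k) : D k ≤ n * (2 * Ru) ^ 2 :=
    h.integral_sum_norm_sub_sq_le hK hε0 hε1 k hyK
  have hD0 (k : ℕ) : 0 ≤ D k := integral_nonneg fun a => by positivity
  have habel := sum_mul_sub_le_of_monotone (w := fun k : ℕ => √((k : ℝ) + c))
    (fun k => Real.sqrt_nonneg _) (sqrt_add_mono c) hD0 hDB hT
  have hinv := sum_inv_sqrt_add_le hc T
  rw [Finset.mul_sum]
  refine (Finset.sum_le_sum hstep).trans ?_
  rw [Finset.sum_add_distrib, Finset.sum_add_distrib, Finset.sum_add_distrib, ← Finset.mul_sum,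
    ← Finset.mul_sum, ← Finset.mul_sum, Finset.sum_const, Nat.card_Icc, nsmul_eq_mul,
    Nat.add_sub_cancel]
  have h1 := mul_le_mul_of_nonneg_left habel (by positivity : 0 ≤ M / 2)
  have h2 := mul_le_mul_of_nonneg_left hinv
    (by positivity : 0 ≤ n * (2 * (d * Lf) ^ 2 / M + Lf / 2))
  have e : M / 2 * (√((T : ℝ) + c) * (n * (2 * Ru) ^ 2))
      = 2 * M * n * Ru ^ 2 * √((T : ℝ) + c) := by ring
  rw [e] at h1
  linarith

/-- If the contraction factor is so close to one that the weighted estimate is not available, the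
trivial bound on the regret suffices. -/
theorem le_of_regret_bounds {n : ℕ} (hn : 1 ≤ n) {Lf M κ k₃ a₁ a₂ B L S H T t w l : ℝ} (hLf : 0 < Lf)
    (hκ1 : κ < 1) (hκ0 : 0 ≤ κ) (hk₃ : 6 * Lf ^ 2 ≤ k₃) (ha₁ : 0 ≤ a₁) (ha₂ : 0 ≤ a₂) (hB : 0 ≤ B)
    (hL : 0 ≤ L) (ht : t * t = T) (ht0 : 0 ≤ t) (htw : t ≤ w) (hl : 0 ≤ l)
    (hreg : n * S ≤ a₁ * w + a₂ * H)
    (hV : 1 / (1 - κ) ≤ w → H ≤ 1 / (1 - κ) * (w * (2 * B + 5 * (k₃ / M ^ 2))))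
    (htriv : S ≤ T * L) :
    S ≤ ((a₁ + L) / (6 * Lf ^ 2) + a₂ * (2 * B / (6 * Lf ^ 2) + 5 / M ^ 2)) * t
      + ((a₁ + L) / (6 * Lf ^ 2) + a₂ * (2 * B / (6 * Lf ^ 2) + 5 / M ^ 2))
        * (k₃ / (1 - κ) * (w + l)) := by
  have hκ : 0 < 1 - κ := by linarith
  set N := 1 / (1 - κ) with hN
  have hN1 : 1 ≤ N := by
    rw [hN, le_div_iff₀ hκ]
    linarith
  have hw0 : 0 ≤ w := ht0.trans htw
  have hLf2 : 0 < 6 * Lf ^ 2 := by positivity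
  have hk₃0 : 0 ≤ k₃ := hLf2.le.trans hk₃
  set C := (a₁ + L) / (6 * Lf ^ 2) + a₂ * (2 * B / (6 * Lf ^ 2) + 5 / M ^ 2) with hC
  have hC0 : 0 ≤ C := by positivity
  have hfrac : k₃ / (1 - κ) = k₃ * N := by rw [hN]; ring
  -- The lower bound `6 Lf² ≤ k₃` inserts the factor `k₃` into terms that do not contain it.
  have hNw : N * w ≤ k₃ * N * w / (6 * Lf ^ 2) := by
    rw [le_div_iff₀ hLf2]
    calc N * w * (6 * Lf ^ 2) ≤ N * w * k₃ := by gcongr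
      _ = k₃ * N * w := by ring
  have hw : w ≤ k₃ * N * w / (6 * Lf ^ 2) := by
    refine le_trans ?_ hNw
    nlinarith
  have hmain : S ≤ C * (k₃ * N * w) := by
    have e : C * (k₃ * N * w) = a₁ * (k₃ * N * w / (6 * Lf ^ 2))
        + L * (k₃ * N * w / (6 * Lf ^ 2))
        + a₂ * (2 * B * (k₃ * N * w / (6 * Lf ^ 2)) + 5 * (k₃ / M ^ 2) * N * w) := by
      rw [hC]; ring
    have hR0 : 0 ≤ k₃ * N * w / (6 * Lf ^ 2) := by positivity
    -- If `N ≤ w` the weighted estimate applies; if `w ≤ N` then `T = t² ≤ N w` and the trivial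
    -- bound suffices.
    rcases le_total N w with h | h
    · have h1 := hV h
      have h2 : n * S ≤ C * (k₃ * N * w) := by
        rw [e]
        have h3 : a₁ * w ≤ a₁ * (k₃ * N * w / (6 * Lf ^ 2)) := by gcongr
        have h4 : a₂ * H ≤ a₂ * (2 * B * (k₃ * N * w / (6 * Lf ^ 2))
            + 5 * (k₃ / M ^ 2) * N * w) := by
          gcongr
          have h5 : 2 * B * (N * w) ≤ 2 * B * (k₃ * N * w / (6 * Lf ^ 2)) := by gcongr
          linarith
        have h6 : 0 ≤ L * (k₃ * N * w / (6 * Lf ^ 2)) := by positivity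
        linarith
      -- Dropping the factor `n` by `S ≤ n S` requires `S ≥ 0`; for `S ≤ 0` the claim is immediate.
      rcases le_total S 0 with hS | hS
      · exact hS.trans (by positivity)
      · refine le_trans ?_ h2
        exact le_mul_of_one_le_left hS (by exact_mod_cast hn)
    · rw [e]
      have h1 : T * L ≤ N * w * L := by
        rw [← ht]
        gcongr
        exact htw.trans h
      have h2 : N * w * L ≤ L * (k₃ * N * w / (6 * Lf ^ 2)) := by
        rw [mul_comm]
        gcongr
      have h3 : 0 ≤ a₁ * (k₃ * N * w / (6 * Lf ^ 2)) := by positivity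
      have h4 : 0 ≤ a₂ * (2 * B * (k₃ * N * w / (6 * Lf ^ 2)) + 5 * (k₃ / M ^ 2) * N * w) := by
        positivity
      linarith
  rw [hfrac]
  -- The `t` and `l` terms of the claim are not needed beyond being nonnegative.
  have h1 : 0 ≤ C * t := by positivity
  have h2 : 0 ≤ C * (k₃ * N * l) := by positivity
  linarith

end Regret

end ComDSZO

/-! ### Choice of the constants and conclusion -/

theorem theorem1 (d n : ℕ) (hd : 1 ≤ d) (hn : 1 ≤ n) (Lf Lm σ Rl Ru c : ℝ)
    (hLf : 0 < Lf) (hLm : 0 < Lm) (hσ : 0 < σ) (hRl : 1 ≤ 2 * Rl ^ 2) (hc : 4 < c) :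
    ∃ C : ℝ,
      ∀ (G : SimpleGraph (Fin n)) (W : Matrix (Fin n) (Fin n) ℝ), IsNetwork G W →
      ∀ K : Set (Vec d), IsConstraintSet K Rl Ru →
      ∀ (Ξ : Fin n → Type*) [∀ i, MeasurableSpace (Ξ i)] (P : ∀ i, Measure (Ξ i))
        (F : ∀ i, Vec d → Ξ i → ℝ), IsSmoothObjective K P F Lf Lm σ →
      ∀ (S : Type*) [MeasurableSpace S] (ν : Measure S) (Q : Vec d → S → Vec d) (r ω : ℝ),
        IsCompressor ν Q r ω →
      ∀ (A : Type*) [MeasurableSpace A] (Pr : Measure A) (ξ : ∀ i, ℕ → A → Ξ i)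
        (u : Fin n → ℕ → A → UnitSphere d) (s : Fin n → ℕ → A → S), IsSampling Pr P ν ξ u s →
      ∀ ψ γ : ℝ, 0 < ψ → ψ ≤ r⁻¹ →
        IsConsensusStep γ (spectralGap W) (disagreementNorm W) (c₀ ψ r ω) →
      ∀ xstar ∈ K, IsMinOn (globalLoss P F) K xstar →
      ∀ T : ℕ, 4 * Rl ^ 2 ≤ T →
      ∀ x₀ : Fin n → Vec d, (∀ i, x₀ i ∈ K) →
        κ₀ γ (spectralGap W) (disagreementNorm W) (c₀ ψ r ω) < 1 ∧
        (∀ k ∈ Finset.Icc 1 T, Integrable (fun a => globalLoss P F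
          (meanIterate K W F Q Rl (M₁ d n Lm) c ψ γ T x₀
            (fun i k => ξ i k a) (fun i k => u i k a) (fun i k => s i k a) k)) Pr) ∧
        ∑ k ∈ Finset.Icc 1 T, ∫ a, (globalLoss P F
            (meanIterate K W F Q Rl (M₁ d n Lm) c ψ γ T x₀
              (fun i k => ξ i k a) (fun i k => u i k a) (fun i k => s i k a) k)
            - globalLoss P F xstar) ∂Pr
          ≤ C * √T + C * (κ₃ d n Lf γ (spectralGap W) (c₀ ψ r ω) /
              (1 - κ₀ γ (spectralGap W) (disagreementNorm W) (c₀ ψ r ω))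
              * (√(T + c) + Real.log (T + c))) := by
  set M := M₁ d n Lm with hM_def
  have hM : 0 < M := by rw [hM_def, M₁]; positivity
  -- `B` bounds the first Lyapunov value, `a₁` collects the coefficients of `√(T + c)` in the
  -- regret, and `a₂` is the coefficient of the weighted Lyapunov sum.
  set B := 11 * n * Ru ^ 2 with hB_def
  set a₁ := 2 * M * n * Ru ^ 2 + n * (2 * (d * Lf) ^ 2 / M + Lf / 2) * 2
    + n * (2 * d * Lm * Ru + 2 * Lf * Ru * Rl) with ha₁
  set a₂ := 5 * M / 2 + Lf / 2 with ha₂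
  refine ⟨(a₁ + 2 * Lf * Ru) / (6 * Lf ^ 2) + a₂ * (2 * B / (6 * Lf ^ 2) + 5 / M ^ 2), ?_⟩
  intro G W hW K hK Ξ _ P F hF S _ ν Q r ω hQ A _ Pr ξ u s hS ψ γ hψ hψr hstep xstar hx _ T hT x₀
    hx₀
  have := hS.prob
  have := hQ.prob
  have hr : 0 < r := one_pos.trans_le hQ.one_le
  have hψr1 : ψ * r ≤ 1 := by
    calc ψ * r ≤ r⁻¹ * r := by gcongr
      _ = 1 := inv_mul_cancel₀ hr.ne'
  have hω0 := hQ.level_pos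
  have hc0 : 0 < c₀ ψ r ω := by rw [c₀]; positivity
  have hc1 : c₀ ψ r ω ≤ 1 / 2 := by
    have := mul_le_mul hψr1 hQ.level_le hω0.le zero_le_one
    rw [c₀]; linarith
  have hδ := hW.spectralGap_pos hn
  have hκ1 := κ₀_lt_one hδ (spectralGap_le_one W) hc0 hc1 hstep
  have hκ0 := κ₀_nonneg (β := disagreementNorm W) hδ hstep.pos hc0 hc1
  have hγβ := mul_disagreement_sq_le_one hδ hc1 hstep
  have hC₃ := six_le_C₃ hδ hstep.pos hc0
  have hRl0 := hK.inner_pos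
  have hRu := hK.outer_nonneg
  have hT2 : (2 : ℝ) ≤ T := by linarith
  have hT1 : 1 ≤ T := by
    have : (1 : ℝ) ≤ T := by linarith
    exact_mod_cast this
  have hsT : 0 < √(T : ℝ) := Real.sqrt_pos.2 (by linarith)
  have hsq : √(T : ℝ) * √(T : ℝ) = T := Real.mul_self_sqrt (by linarith)
  set μ := 1 / √(T : ℝ) with hμ_def
  set ε := 2 * Rl / √(T : ℝ) with hε_def
  have hμ : 0 < μ := by positivity
  have hε0 : 0 < ε := by positivity
  -- This is the condition `T ≥ 4 Rl²`.
  have hε1 : ε ≤ 1 := by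
    rw [hε_def, div_le_one hsT, Real.le_sqrt' (by positivity)]
    linarith
  -- This is the condition `2 Rl² ≥ 1`: the smoothing radius fits in the margin left by shrinking.
  have hμε : μ ≤ ε * Rl := by
    rw [hμ_def, hε_def, div_mul_eq_mul_div]
    gcongr
    linarith
  have htraj := isTrajectory_run (W := W) (γ := γ) (η := fun k => 1 / (M * √((k : ℝ) + c)))
    hS hF hQ hK hd hμ hμε hε0 hε1 hψ.le hψr1 hx₀
  have hproj := (continuous_proj (hK.shrink_nonempty ε) (hK.isClosed_shrink ε)
    (hK.convex_shrink ε)).measurable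
  have hmean (k : ℕ) : Measurable fun a => meanIterate K W F Q Rl M c ψ γ T x₀
      (fun i k => ξ i k a) (fun i k => u i k a) (fun i k => s i k a) k :=
    (Finset.measurable_fun_sum _ fun i _ => htraj.meas_x k i).fun_const_smul _
  have hmeanK (k : ℕ) (a : A) : meanIterate K W F Q Rl M c ψ γ T x₀
      (fun i k => ξ i k a) (fun i k => u i k a) (fun i k => s i k a) k ∈ K :=
    mean_mem hK.convex hn fun i => htraj.mem hK hε0.le hε1 k a i
  refine ⟨hκ1, fun k _ => hF.integrable_globalLoss hLf.le hK hn (hmean k) (hmeanK k), ?_⟩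
  have hgrad (k : ℕ) (hk : 1 ≤ k) (i : Fin n) :=
    hS.integral_localLoss_sub_le (k := k) (μ := μ) (y := (1 - ε) • xstar) hF hLf.le hLm.le hK hd hμ
      (@State.IsMeasurable.x d n A (pastDraws ξ u s k) _
        (State.isMeasurable_run (W := W) (μ := μ) (ψ := ψ) (γ := γ)
          (η := fun k => 1 / (M * √((k : ℝ) + c))) (x₀ := x₀) hproj hF.meas hQ.meas k) i)
      (fun a => htraj.mem hK hε0.le hε1 k a i)
      (fun a w => hK.add_mem_of_mem_shrink hε0 hε1 (htraj.mem_shrink hK hk a i) (by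
        rwa [norm_smul, norm_eq_of_mem_sphere, mul_one, Real.norm_of_nonneg hμ.le]))
      i (hK.shrink_subset hε0.le hε1 ⟨xstar, hx, rfl⟩)
  have hreg := htraj.mul_sum_integral_gap_le hF hLf.le hW hK hn hε0.le hε1 hγβ hstep.pos.le hM hc hx
    (fun k hk i => (hgrad k hk i).1) (fun k hk i => (hgrad k hk i).2.1)
    (fun k hk i => (hgrad k hk i).2.2) hT1
  -- The perturbation is `C₃ η_k² n (d Lf)² = (κ₃ / M²) / (k + c)`, which fixes `b`.
  have hV := sum_sqrt_mul_le_of_contraction (b := κ₃ d n Lf γ (spectralGap W) (c₀ ψ r ω) / M ^ 2)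
    (B := B) hc (fun k => integral_nonneg fun a => lyapunov_nonneg _ _ k a) hκ0 hκ1
    (by rw [κ₃]; positivity) (htraj.integral_lyapunov_one_le hK hn hε0.le hε1 hc0.le)
    (fun k hk => (htraj.integral_lyapunov_succ_le hW hK hn hε0.le hε1 hstep.pos hstep.lt_one.le
      hc0 hc1 hk).trans (le_of_eq (by rw [κ₃]; field_simp))) hT1
  have htriv : ∑ k ∈ Finset.Icc 1 T, ∫ a, (globalLoss P F
      (meanIterate K W F Q Rl M c ψ γ T x₀
        (fun i k => ξ i k a) (fun i k => u i k a) (fun i k => s i k a) k)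
        - globalLoss P F xstar) ∂Pr ≤ T * (2 * Lf * Ru) := by
    refine (Finset.sum_le_sum fun k _ => hF.integral_globalLoss_sub_le hLf.le hK hn (hmean k)
      (hmeanK k) hx).trans (le_of_eq ?_)
    simp
  have hκ₃ : 6 * Lf ^ 2 ≤ κ₃ d n Lf γ (spectralGap W) (c₀ ψ r ω) := by
    have hn1 : (1 : ℝ) ≤ n := by exact_mod_cast hn
    have hd1 : (1 : ℝ) ≤ (d : ℝ) ^ 2 := one_le_pow₀ (by exact_mod_cast hd)
    calc 6 * Lf ^ 2 = 1 * 1 * Lf ^ 2 * 6 := by ring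
      _ ≤ n * (d : ℝ) ^ 2 * Lf ^ 2 * C₃ γ (spectralGap W) (c₀ ψ r ω) := by gcongr
      _ = _ := by rw [κ₃]
  set S₁ := ∑ k ∈ Finset.Icc 1 T, ∫ a, (globalLoss P F
      (meanIterate K W F Q Rl M c ψ γ T x₀
        (fun i k => ξ i k a) (fun i k => u i k a) (fun i k => s i k a) k)
        - globalLoss P F xstar) ∂Pr
  replace hreg : n * S₁ ≤ _ := hreg
  -- Both `μ` and `ε` are of order `1/√T`, so over `T` iterations the biases of smoothing and
  -- shrinking add up to order `√T`.
  have hTμ : T * (n * (2 * d * Lm * Ru * μ + Lf * Ru * ε))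
      = n * (2 * d * Lm * Ru + 2 * Lf * Ru * Rl) * √(T : ℝ) := by
    have h1 : T * μ = √(T : ℝ) := by rw [hμ_def, mul_one_div, div_eq_iff hsT.ne', hsq]
    have h2 : ε = 2 * Rl * μ := by rw [hε_def, hμ_def]; ring
    rw [h2, ← h1]
    ring
  rw [hTμ] at hreg
  have hWT : √(T : ℝ) ≤ √((T : ℝ) + c) := Real.sqrt_le_sqrt (by linarith)
  have hreg' : n * S₁ ≤ a₁ * √((T : ℝ) + c) + a₂ * ∑ k ∈ Finset.Icc 1 T, √((k : ℝ) + c)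
      * ∫ a, lyapunov (fun k a => (run K W F Q μ ε ψ γ (fun k => 1 / (M * √((k : ℝ) + c))) x₀
          (fun i k => ξ i k a) (fun i k => u i k a) (fun i k => s i k a) k).x)
        (fun k a => (run K W F Q μ ε ψ γ (fun k => 1 / (M * √((k : ℝ) + c))) x₀
          (fun i k => ξ i k a) (fun i k => u i k a) (fun i k => s i k a) k).xhat) k a ∂Pr := by
    have h1 := mul_le_mul_of_nonneg_left hWT
      (by positivity : 0 ≤ n * (2 * d * Lm * Ru + 2 * Lf * Ru * Rl))
    refine hreg.trans ?_
    rw [ha₁, ha₂]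
    linarith
  exact le_of_regret_bounds hn hLf hκ1 hκ0 hκ₃ (by positivity) (by positivity) (by positivity)
    (by positivity) hsq hsT.le hWT (Real.log_nonneg (by linarith)) hreg' hV htriv
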